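/- For $r\ge 0$ let $D_r\subset\mathbb{R}^2$ be the closed disk of radius $r$ centered at the origin (so $D_0$ is the origin alone), let $\oplus$ denote the Minkowski sum, and for $A,B\subset\mathbb{R}^2$ and $\alpha\in[0,1]$ put \[ S_\alpha(A,B)=(A\oplus D_\alpha)\cap(B\oplus D_{1-\alpha}). \] A simple polygon with $n\ge 3$ vertices is the closed bounded region enclosed by a closed polygonal curve with $n$ nondegenerate edges and no self-intersections (consecutive edges may be collinear). A subdivision of a set $X\subset\mathbb{R}^2$ is a representation of $X$ as the disjoint union of finitely many points (vertices), nondegenerate open line segments and nondegenerate open circular arcs, such that the endpoints of all the segments and arcs are among the vertices; its size is the total number of its vertices, segments and arcs. (Upper bound) There is an absolute constant $C>0$ such that for all simple polygons $A$ and $B$ with $n$ and $m$ vertices, respectively, and every $\alpha\in[0,1]$, the boundary $\partial S_\alpha(A,B)$ has a subdivision of size at most $C\,nm$. (Tightness) There is an absolute constant $c>0$ such that for all integers $n,m\ge 3$ there are simple polygons $A$ and $B$ with $n$ and $m$ vertices, respectively, and with Hausdorff distance $d_H(A,B)=1$, such that every subdivision of $\partial S_{1/2}(A,B)$ has size at least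 $c\,nm$. -/

import Mathlib

/-- The Euclidean plane. -/
abbrev Plane : Type := EuclideanSpace ℝ (Fin 2)

/-- A polygon is simple if its closed boundary curve has no self-intersections: it has at least
three vertices, its edges are nondegenerate, and the half-open edges `[v i, v (i + 1))`
(indices taken cyclically) are pairwise disjoint. -/
def IsSimplePolygon {n : ℕ} (P : Polygon Plane n) : Prop :=
  3 ≤ n ∧ P.HasNondegenerateEdges ∧
    ∀ i j : Fin n, i ≠ j →
      Disjoint (P.edgePath ℝ i '' Set.Ico (0 : ℝ) 1) (P.edgePath ℝ j '' Set.Ico (0 : ℝ) 1)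

/-- The closed region bounded by a polygon: its boundary curve together with the bounded
connected components of the complement of this curve. -/
def polygonRegion {n : ℕ} (P : Polygon Plane n) : Set Plane :=
  P.boundary ℝ ∪
    {x | x ∉ P.boundary ℝ ∧ Bornology.IsBounded (connectedComponentIn (P.boundary ℝ)ᶜ x)}

section Dilation

open scoped Pointwise

/-- The Minkowski sum of `A` and the closed disk of radius `r` centered at the origin. -/
def dilate (A : Set Plane) (r : ℝ) : Set Plane :=
  A + Metric.closedBall (0 : Plane) r

end Dilation

/-- `S_α(A, B)`, the intersection of `A ⊕ D_α` and `B ⊕ D_(1 - α)`. -/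
def middleSet (A B : Set Plane) (α : ℝ) : Set Plane :=
  dilate A α ∩ dilate B (1 - α)

/-- The point at angle `θ` on the circle with center `c` and radius `r`. -/
noncomputable def circlePoint (c : Plane) (r θ : ℝ) : Plane :=
  c + !₂[r * Real.cos θ, r * Real.sin θ]

/-- `e` is a nondegenerate line segment, without its endpoints `p` and `q`. -/
def IsOpenSegment (e : Set Plane) (p q : Plane) : Prop :=
  p ≠ q ∧ e = openSegment ℝ p q

/-- `e` is a nondegenerate circular arc, without its endpoints `p` and `q`
(which coincide if the arc is a circle minus a point). -/
def IsOpenArc (e : Set Plane) (p q : Plane) : Prop :=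
  ∃ (c : Plane) (r θ₁ θ₂ : ℝ), 0 < r ∧ θ₁ < θ₂ ∧ θ₂ ≤ θ₁ + 2 * Real.pi ∧
    p = circlePoint c r θ₁ ∧ q = circlePoint c r θ₂ ∧ e = circlePoint c r '' Set.Ioo θ₁ θ₂

/-- A subdivision of a planar set `X` into finitely many vertices, line segments and circular
arcs. The segments and arcs are represented without their endpoints; their endpoints are vertices,
no vertex lies on an open segment or open arc, distinct open segments and arcs are disjoint, and
all these features together form exactly `X`. -/
structure FeatureDecomposition (X : Set Plane) where
  vertices : Finset Plane
  segments : Finset (Set Plane)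
  arcs : Finset (Set Plane)
  segment_spec : ∀ e ∈ segments, ∃ p ∈ vertices, ∃ q ∈ vertices, IsOpenSegment e p q
  arc_spec : ∀ e ∈ arcs, ∃ p ∈ vertices, ∃ q ∈ vertices, IsOpenArc e p q
  edges_disjoint : ((segments : Set (Set Plane)) ∪ (arcs : Set (Set Plane))).PairwiseDisjoint id
  vertex_not_mem : ∀ v ∈ vertices, ∀ e, e ∈ segments ∨ e ∈ arcs → v ∉ e
  union_eq : (vertices : Set Plane) ∪ (⋃ e ∈ segments, e) ∪ (⋃ e ∈ arcs, e) = X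

/-- The total number of vertices, line segments and circular arcs of a subdivision. -/
def FeatureDecomposition.size {X : Set Plane} (D : FeatureDecomposition X) : ℕ :=
  D.vertices.card + D.segments.card + D.arcs.card

/-!
# The complexity of the frontier of `S_α(A, B)` for polygons `A` and `B`

*Upper bound.* The frontier of an intersection `X ∩ Y` of closed sets lies in the union of the
frontiers of `X` and `Y`. Each edge of a subdivision is relatively open in its line or circle, so
two edges share at most two points besides those near which they coincide (`IsEdge.inter`). Cutting
the edges of subdivisions of `frontier X` and `frontier Y` at all these points therefore gives a
subdivision of `frontier (X ∩ Y)` whose size is bounded by a multiple of the product of the two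
sizes (`exists_featureDecomposition_inter`). It remains to see that a dilated polygon with `n`
vertices has a frontier of complexity `O(n)` (`exists_featureDecomposition_frontier_dilate`).

For radius `r > 0`, a frontier point of the dilation has distance exactly `r` from the polygon, and
its nearest points lie on the boundary of the polygon. Hence it lies on an offset curve: the circle
of radius `r` about a vertex or one of the two parallels of an edge at distance `r`. Around a point
with only one nearest point, apart from the `O(n)` endpoints of the parallels, the frontier is a
whole neighborhood in such a curve. So it has `O(n)` features once it has `O(n)` points with several
nearest points, each counted with the number of edges that contain one of them
(`exists_finset_multiple_nearPts`). The open disk of radius `r`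
about a frontier point misses the polygon, so the chord between two neighboring nearest points runs
in the exterior, and chords coming from different disks do not cross. Two disjoint chords in the
exterior of a closed curve cannot have interleaved endpoints on it (`chords_not_interleaved`): a
chord together with the part of the curve between its endpoints is a closed curve, and the winding
angle around the points of the other chord would have to be both constant and not constant. A
noncrossing family of pairs of edges has linear size (`card_le_of_noncrossing`), and each pair of
edges accounts for at most `18` frontier points (`exists_finset_of_mem_nearEdges`).

*Lower bound.* All polygons are regions under graphs of piecewise linear functions with equidistant
nodes (`polygonRegion_mountain`), finally rescaled to Hausdorff distance one
(`exists_polygons_hausdorffDist_eq_one`). If both numbers of vertices are large, the polygons are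
two combs, one of them turned by a right angle. Near the tips the teeth cross in a grid of cells;
the set meets the interior of each cell but none of the cell walls, so each cell contains a whole
piece of the frontier and uses up a feature of its own (`card_le_size_of_cells`,
`exists_polygons_of_combs`). If one of the numbers is bounded, a thin strip is laid across the teeth
of a saw: the axis of the strip alternates between the interior and the exterior of the set, and a
feature contains at most two of the points where it changes
(`card_le_two_mul_size_of_openSegment`, `exists_polygons_of_saw`).
-/

open Set Filter Topology

/-! ### Curves and subdivisions -/

/-- A function that is locally constant along a preconnected set is constant on it. -/
lemma IsPreconnected.eq_of_eventually_eq {X Y : Type*} [TopologicalSpace X] {s : Set X}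
    (hs : IsPreconnected s) {f : X → Y} (h : ∀ x ∈ s, ∀ᶠ y in 𝓝[s] x, f y = f x)
    {x y : X} (hx : x ∈ s) (hy : y ∈ s) : f x = f y := by
  let _ : TopologicalSpace Y := ⊥
  have : DiscreteTopology Y := ⟨rfl⟩
  refine hs.constant (f := f) (fun z hz => ?_) hx hy
  exact tendsto_const_nhds.congr' ((h z hz).mono fun y hy => hy.symm)

/-- `γ` parametrizes, on the open interval `(a, b)`, an open segment or an open arc, and so does
its restriction to every subinterval. -/
structure IsCurve (γ : ℝ → Plane) (a b : ℝ) : Prop where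
  lt : a < b
  cont : Continuous γ
  inj : InjOn γ (Ioo a b)
  piece : ∀ s t, a ≤ s → s < t → t ≤ b →
    IsOpenSegment (γ '' Ioo s t) (γ s) (γ t) ∨ IsOpenArc (γ '' Ioo s t) (γ s) (γ t)

lemma isCurve_lineMap {p q : Plane} (h : p ≠ q) :
    IsCurve (fun t => AffineMap.lineMap p q t) 0 1 where
  lt := one_pos
  cont := AffineMap.lineMap_continuous
  inj := (AffineMap.lineMap_injective ℝ h).injOn
  piece s t _ hst _ := by
    refine Or.inl ⟨(AffineMap.lineMap_injective ℝ h).ne hst.ne, ?_⟩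
    rw [← openSegment_eq_Ioo hst]
    exact image_openSegment ℝ (AffineMap.lineMap p q) s t

lemma continuous_circlePoint (c : Plane) (r : ℝ) : Continuous (circlePoint c r) := by
  unfold circlePoint
  refine continuous_const.add ?_
  refine (PiLp.continuous_toLp 2 _).comp ?_
  refine continuous_pi fun i => ?_
  fin_cases i <;> simp <;> fun_prop

lemma circlePoint_eq_iff {c : Plane} {r : ℝ} (hr : 0 < r) {θ θ' : ℝ} :
    circlePoint c r θ = circlePoint c r θ' ↔ Real.cos θ = Real.cos θ' ∧ Real.sin θ = Real.sin θ' := by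
  constructor
  · intro h
    have h' := add_left_cancel h
    have h0 := congrArg (fun p : Plane => p 0) h'
    have h1 := congrArg (fun p : Plane => p 1) h'
    simp at h0 h1
    exact ⟨h0.resolve_right hr.ne', h1.resolve_right hr.ne'⟩
  · rintro ⟨h0, h1⟩
    simp [circlePoint, h0, h1]

lemma circlePoint_injOn {c : Plane} {r a b : ℝ} (hr : 0 < r) (hab : b ≤ a + 2 * Real.pi) :
    InjOn (circlePoint c r) (Ico a b) := by
  intro s hs t ht h
  obtain ⟨h0, h1⟩ := (circlePoint_eq_iff hr).1 h
  have := Real.Angle.cos_sin_inj h0 h1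
  obtain ⟨k, hk⟩ := Real.Angle.angle_eq_iff_two_pi_dvd_sub.1 this
  have hpi := Real.pi_pos
  have h1 : s - t < 2 * Real.pi := by linarith [hs.1, hs.2, ht.1, ht.2]
  have h2 : -(2 * Real.pi) < s - t := by linarith [hs.1, hs.2, ht.1, ht.2]
  have hk0 : k = 0 := by
    have a1 : (k : ℝ) < 1 := by
      by_contra! hc
      nlinarith
    have a2 : (-1 : ℝ) < k := by
      by_contra! hc
      nlinarith
    have : k < 1 := by exact_mod_cast a1
    have : -1 < k := by exact_mod_cast a2
    omega
  subst hk0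
  simp at hk
  linarith

lemma isCurve_circlePoint {c : Plane} {r a b : ℝ} (hr : 0 < r) (hab : a < b)
    (hb : b ≤ a + 2 * Real.pi) : IsCurve (circlePoint c r) a b where
  lt := hab
  cont := continuous_circlePoint c r
  inj := (circlePoint_injOn hr hb).mono Ioo_subset_Ico_self
  piece s t hs hst ht := Or.inr ⟨c, r, s, t, hr, hst, by linarith, rfl, rfl, rfl⟩

section Refinement

open scoped Classical in
/-- Cutting one curve at finitely many points: a subset `G` of the curve that is open and closed
relative to the curve minus the finite set `P` is a disjoint union of few subcurves, each of which
ends at a point of `P` or at an end of the curve. -/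
lemma IsCurve.exists_pieces {γ : ℝ → Plane} {a b : ℝ} (hγ : IsCurve γ a b) (P : Finset Plane)
    {G : Set Plane} (hG : G ⊆ γ '' Ioo a b) (hGP : ∀ x ∈ G, x ∉ P)
    (hop : ∀ t ∈ Ioo a b, γ t ∉ P → γ t ∈ G → ∀ᶠ s in 𝓝 t, γ s ∈ G)
    (hcl : ∀ t ∈ Ioo a b, γ t ∉ P → γ t ∉ G → ∀ᶠ s in 𝓝 t, γ s ∉ G) :
    ∃ K : Finset (Set Plane), K.card ≤ (P.filter (· ∈ γ '' Ioo a b)).card + 1 ∧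
      (∀ e ∈ K, e ⊆ G ∧ ∃ s t, a ≤ s ∧ s < t ∧ t ≤ b ∧ e = γ '' Ioo s t ∧
        (γ s ∈ P ∨ s = a) ∧ (γ t ∈ P ∨ t = b)) ∧
      (K : Set (Set Plane)).PairwiseDisjoint id ∧ G ⊆ ⋃ e ∈ K, e := by
  have hfin : {t | t ∈ Ioo a b ∧ γ t ∈ P}.Finite :=
    Set.Finite.of_injOn (f := γ) (t := (P : Set Plane)) (fun t ht => ht.2)
      (hγ.inj.mono fun t ht => ht.1) P.finite_toSet
  set T : Finset ℝ := hfin.toFinset with hT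
  have memT : ∀ t, t ∈ T ↔ t ∈ Ioo a b ∧ γ t ∈ P := fun t => by simp [hT]
  have hTcard : T.card ≤ (P.filter (· ∈ γ '' Ioo a b)).card := by
    refine Finset.card_le_card_of_injOn γ (fun t ht => ?_) (fun s hs t ht h => ?_)
    · have := (memT t).1 ht
      simp only [Finset.coe_filter, mem_ofPred_eq]
      exact ⟨this.2, t, this.1, rfl⟩
    · exact hγ.inj ((memT s).1 hs).1 ((memT t).1 ht).1 h
  have hnext : ∀ t, t ∈ insert a T → ∃ u ∈ insert b T, t < u ∧ ∀ s ∈ insert b T, t < s → u ≤ s := by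
    intro t ht
    have hne : ((insert b T).filter (t < ·)).Nonempty := by
      refine ⟨b, ?_⟩
      simp only [Finset.mem_filter, Finset.mem_insert, true_or, true_and]
      rcases Finset.mem_insert.1 ht with rfl | h
      · exact hγ.lt
      · exact ((memT t).1 h).1.2
    obtain ⟨u, hu, hmin⟩ := Finset.exists_min_image _ id hne
    rw [Finset.mem_filter] at hu
    exact ⟨u, hu.1, hu.2, fun s hs hts => hmin s (Finset.mem_filter.2 ⟨hs, hts⟩)⟩
  choose! nx hnx1 hnx2 hnx3 using hnext
  have hCa : ∀ t ∈ insert a T, a ≤ t := by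
    intro t ht
    rcases Finset.mem_insert.1 ht with rfl | h
    · exact le_rfl
    · exact ((memT t).1 h).1.1.le
  have hCb : ∀ t ∈ insert b T, t ≤ b := by
    intro t ht
    rcases Finset.mem_insert.1 ht with rfl | h
    · exact le_rfl
    · exact ((memT t).1 h).1.2.le
  have hsub : ∀ t ∈ insert a T, Ioo t (nx t) ⊆ Ioo a b := fun t ht =>
    Ioo_subset_Ioo (hCa t ht) (hCb _ (hnx1 t ht))
  have hnoP : ∀ t ∈ insert a T, ∀ s ∈ Ioo t (nx t), γ s ∉ P := by
    intro t ht s hs hP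
    have : s ∈ T := (memT s).2 ⟨hsub t ht hs, hP⟩
    exact absurd (hnx3 t ht s (Finset.mem_insert_of_mem this) hs.1) (not_le.2 hs.2)
  have hall : ∀ t ∈ insert a T, ∀ s ∈ Ioo t (nx t), γ s ∈ G → γ '' Ioo t (nx t) ⊆ G := by
    rintro t ht s hs hsG _ ⟨s', hs', rfl⟩
    have := isPreconnected_Ioo.eq_of_eventually_eq (f := fun u => (γ u ∈ G)) (fun u hu => ?_) hs hs'
    · rwa [← this]
    · refine Filter.Eventually.filter_mono nhdsWithin_le_nhds ?_
      by_cases hu' : γ u ∈ G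
      · filter_upwards [hop u (hsub t ht hu) (hnoP t ht u hu) hu'] with v hv
        simp [hv, hu']
      · filter_upwards [hcl u (hsub t ht hu) (hnoP t ht u hu) hu'] with v hv
        simp [hv, hu']
  have hord : ∀ t ∈ insert a T, ∀ t' ∈ insert a T, t < t' → nx t ≤ t' := by
    intro t ht t' ht' hlt
    rcases Finset.mem_insert.1 ht' with rfl | h
    · exact absurd (hCa t ht) (not_le.2 hlt)
    · exact hnx3 t ht t' (Finset.mem_insert_of_mem h) hlt
  refine ⟨((insert a T).image fun t => γ '' Ioo t (nx t)).filter (· ⊆ G), ?_, ?_, ?_, ?_⟩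
  · calc _ ≤ ((insert a T).image fun t => γ '' Ioo t (nx t)).card := Finset.card_filter_le _ _
      _ ≤ (insert a T).card := Finset.card_image_le
      _ ≤ T.card + 1 := Finset.card_insert_le _ _
      _ ≤ _ := by omega
  · intro e he
    obtain ⟨he, heG⟩ := Finset.mem_filter.1 he
    obtain ⟨t, ht, rfl⟩ := Finset.mem_image.1 he
    refine ⟨heG, t, nx t, hCa t ht, hnx2 t ht, hCb _ (hnx1 t ht), rfl, ?_, ?_⟩
    · rcases Finset.mem_insert.1 ht with rfl | h
      · exact Or.inr rfl
      · exact Or.inl ((memT t).1 h).2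
    · rcases Finset.mem_insert.1 (hnx1 t ht) with h | h
      · exact Or.inr h
      · exact Or.inl ((memT _).1 h).2
  · intro e he e' he' hne
    obtain ⟨he, -⟩ := Finset.mem_filter.1 he
    obtain ⟨t, ht, rfl⟩ := Finset.mem_image.1 he
    obtain ⟨he', -⟩ := Finset.mem_filter.1 he'
    obtain ⟨t', ht', rfl⟩ := Finset.mem_image.1 he'
    have htt : t ≠ t' := fun h => hne (by rw [h])
    rw [Function.onFun, Set.disjoint_left]
    rintro _ ⟨s, hs, rfl⟩ ⟨s', hs', h⟩
    have := hγ.inj (hsub t' ht' hs') (hsub t ht hs) h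
    subst this
    rcases lt_or_gt_of_ne htt with h | h
    · linarith [hord t ht t' ht' h, hs.2, hs'.1]
    · linarith [hord t' ht' t ht h, hs.1, hs'.2]
  · intro x hx
    obtain ⟨s, hs, rfl⟩ := hG hx
    obtain ⟨t, ht, hmax⟩ := Finset.exists_max_image ((insert a T).filter (· < s)) id
      ⟨a, by simp [hs.1]⟩
    rw [Finset.mem_filter] at ht
    have hsn : s < nx t := by
      rcases Finset.mem_insert.1 (hnx1 t ht.1) with h | h
      · rw [h]; exact hs.2
      · by_contra! hle
        rcases hle.lt_or_eq with h' | h'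
        · have := hmax (nx t) (Finset.mem_filter.2 ⟨Finset.mem_insert_of_mem h, h'⟩)
          exact absurd (hnx2 t ht.1) (not_lt.2 this)
        · exact hGP _ hx (h' ▸ ((memT _).1 h).2)
    simp only [mem_iUnion]
    refine ⟨γ '' Ioo t (nx t), Finset.mem_filter.2 ⟨Finset.mem_image.2 ⟨t, ht.1, rfl⟩, ?_⟩,
      s, ⟨ht.2, hsn⟩, rfl⟩
    exact hall t ht.1 s ⟨ht.2, hsn⟩ hx

open scoped Classical in
/-- A closed set that is the union of finitely many points and of pairwise disjoint relatively
clopen parts of finitely many curves cut at these points has a subdivision whose size is controlled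
by the incidences between the points and the curves. -/
theorem exists_featureDecomposition {ι : Type*} (I : Finset ι) {γ : ι → ℝ → Plane} {a b : ι → ℝ}
    (hγ : ∀ i ∈ I, IsCurve (γ i) (a i) (b i)) {F : Set Plane} (hF : IsClosed F) (P : Finset Plane)
    (hPF : ∀ p ∈ P, p ∈ F) {G : ι → Set Plane} (hG : ∀ i ∈ I, G i ⊆ γ i '' Ioo (a i) (b i))
    (hGF : ∀ i ∈ I, G i ⊆ F) (hGP : ∀ i ∈ I, ∀ x ∈ G i, x ∉ P)
    (hop : ∀ i ∈ I, ∀ t ∈ Ioo (a i) (b i), γ i t ∉ P → γ i t ∈ G i → ∀ᶠ s in 𝓝 t, γ i s ∈ G i)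
    (hcl : ∀ i ∈ I, ∀ t ∈ Ioo (a i) (b i), γ i t ∉ P → γ i t ∉ G i → ∀ᶠ s in 𝓝 t, γ i s ∉ G i)
    (hdis : ∀ i ∈ I, ∀ j ∈ I, i ≠ j → Disjoint (G i) (G j))
    (hcov : ∀ x ∈ F, x ∈ P ∨ ∃ i ∈ I, x ∈ G i)
    (hends : ∀ i ∈ I, (γ i (a i) ∈ F → γ i (a i) ∈ P) ∧ (γ i (b i) ∈ F → γ i (b i) ∈ P)) :
    ∃ D : FeatureDecomposition F, D.size ≤
      P.card + ∑ i ∈ I, ((P.filter (· ∈ γ i '' Ioo (a i) (b i))).card + 1) := by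
  have key : ∀ i, i ∈ I → ∃ K : Finset (Set Plane),
      K.card ≤ (P.filter (· ∈ γ i '' Ioo (a i) (b i))).card + 1 ∧
      (∀ e ∈ K, e ⊆ G i ∧ ∃ s t, a i ≤ s ∧ s < t ∧ t ≤ b i ∧ e = γ i '' Ioo s t ∧
        (γ i s ∈ P ∨ s = a i) ∧ (γ i t ∈ P ∨ t = b i)) ∧
      (K : Set (Set Plane)).PairwiseDisjoint id ∧ G i ⊆ ⋃ e ∈ K, e := fun i hi =>
    (hγ i hi).exists_pieces P (hG i hi) (hGP i hi) (hop i hi) (hcl i hi)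
  choose! K hK1 hK2 hK3 hK4 using key
  have hclos : ∀ i ∈ I, ∀ s t, s < t → γ i '' Ioo s t ⊆ G i → γ i s ∈ F ∧ γ i t ∈ F := by
    intro i hi s t hst hsub
    have h1 : γ i '' Icc s t ⊆ F := by
      rw [← closure_Ioo hst.ne]
      refine (image_closure_subset_closure_image (hγ i hi).cont).trans ?_
      exact closure_minimal (hsub.trans (hGF i hi)) hF
    exact ⟨h1 ⟨s, ⟨le_rfl, hst.le⟩, rfl⟩, h1 ⟨t, ⟨hst.le, le_rfl⟩, rfl⟩⟩
  have hspec : ∀ i ∈ I, ∀ e ∈ K i, ∃ p ∈ P, ∃ q ∈ P, IsOpenSegment e p q ∨ IsOpenArc e p q := by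
    intro i hi e he
    obtain ⟨heG, s, t, hs, hst, ht, rfl, h1, h2⟩ := hK2 i hi e he
    obtain ⟨f1, f2⟩ := hclos i hi s t hst heG
    refine ⟨γ i s, ?_, γ i t, ?_, (hγ i hi).piece s t hs hst ht⟩
    · rcases h1 with h | rfl
      · exact h
      · exact (hends i hi).1 f1
    · rcases h2 with h | rfl
      · exact h
      · exact (hends i hi).2 f2
  set L : Finset (Set Plane) := I.biUnion K with hL
  have hLdis : (L : Set (Set Plane)).PairwiseDisjoint id := by
    intro e he e' he' hne
    obtain ⟨i, hi, he⟩ := Finset.mem_biUnion.1 he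
    obtain ⟨j, hj, he'⟩ := Finset.mem_biUnion.1 he'
    by_cases hij : i = j
    · subst hij
      exact hK3 i hi he he' hne
    · exact (hdis i hi j hj hij).mono (hK2 i hi e he).1 (hK2 j hj e' he').1
  set S : Finset (Set Plane) := L.filter (fun e => ∃ p ∈ P, ∃ q ∈ P, IsOpenSegment e p q)
  set R : Finset (Set Plane) := L.filter (fun e => ¬ ∃ p ∈ P, ∃ q ∈ P, IsOpenSegment e p q)
  have hSR : S.card + R.card = L.card := Finset.card_filter_add_card_filter_not _
  have hmem : ∀ e, e ∈ S ∨ e ∈ R ↔ e ∈ L := by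
    intro e
    rw [← Finset.mem_union, Finset.filter_union_filter_not_eq]
  let D : FeatureDecomposition F :=
    { vertices := P
      segments := S
      arcs := R
      segment_spec := fun e he => (Finset.mem_filter.1 he).2
      arc_spec := by
        intro e he
        obtain ⟨he, hn⟩ := Finset.mem_filter.1 he
        obtain ⟨i, hi, he⟩ := Finset.mem_biUnion.1 he
        obtain ⟨p, hp, q, hq, h | h⟩ := hspec i hi e he
        · exact absurd ⟨p, hp, q, hq, h⟩ hn
        · exact ⟨p, hp, q, hq, h⟩
      edges_disjoint := by
        refine hLdis.subset ?_
        rintro e (he | he)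
        · exact (Finset.mem_filter.1 he).1
        · exact (Finset.mem_filter.1 he).1
      vertex_not_mem := by
        intro v hv e he hve
        obtain ⟨i, hi, he⟩ := Finset.mem_biUnion.1 ((hmem e).1 he)
        exact hGP i hi v ((hK2 i hi e he).1 hve) hv
      union_eq := by
        ext x
        simp only [mem_union, mem_iUnion, Finset.mem_coe, exists_prop]
        constructor
        · have aux : ∀ e ∈ L, x ∈ e → x ∈ F := by
            intro e he hx
            obtain ⟨i, hi, he⟩ := Finset.mem_biUnion.1 he
            exact hGF i hi ((hK2 i hi e he).1 hx)
          rintro ((h | ⟨e, he, hx⟩) | ⟨e, he, hx⟩)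
          · exact hPF x h
          · exact aux e (Finset.mem_filter.1 he).1 hx
          · exact aux e (Finset.mem_filter.1 he).1 hx
        · intro hx
          rcases hcov x hx with h | ⟨i, hi, h⟩
          · exact Or.inl (Or.inl h)
          · have := hK4 i hi h
            simp only [mem_iUnion, exists_prop] at this
            obtain ⟨e, he, hxe⟩ := this
            rcases (hmem e).2 (Finset.mem_biUnion.2 ⟨i, hi, he⟩) with h | h
            · exact Or.inl (Or.inr ⟨e, h, hxe⟩)
            · exact Or.inr ⟨e, h, hxe⟩ }
  refine ⟨D, ?_⟩
  have : L.card ≤ ∑ i ∈ I, ((P.filter (· ∈ γ i '' Ioo (a i) (b i))).card + 1) :=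
    Finset.card_biUnion_le.trans (Finset.sum_le_sum fun i hi => hK1 i hi)
  change P.card + S.card + R.card ≤ _
  omega

end Refinement

/-! ### Lines and circles -/

lemma Plane.ext_iff' {x y : Plane} : x = y ↔ x 0 = y 0 ∧ x 1 = y 1 := by
  constructor
  · rintro rfl; exact ⟨rfl, rfl⟩
  · rintro ⟨h0, h1⟩
    ext i
    fin_cases i
    · exact h0
    · exact h1

lemma Plane.dist_sq (x y : Plane) : dist x y ^ 2 = (x 0 - y 0) ^ 2 + (x 1 - y 1) ^ 2 := by
  rw [EuclideanSpace.dist_eq, Real.sq_sqrt (by positivity), Fin.sum_univ_two, Real.dist_eq,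
    Real.dist_eq, sq_abs, sq_abs]

lemma Plane.dist_le_iff {x y : Plane} {r : ℝ} (hr : 0 ≤ r) :
    dist x y ≤ r ↔ (x 0 - y 0) ^ 2 + (x 1 - y 1) ^ 2 ≤ r ^ 2 := by
  rw [← Plane.dist_sq, pow_le_pow_iff_left₀ dist_nonneg hr two_ne_zero]

lemma Plane.dist_eq_iff {x y : Plane} {r : ℝ} (hr : 0 ≤ r) :
    dist x y = r ↔ (x 0 - y 0) ^ 2 + (x 1 - y 1) ^ 2 = r ^ 2 := by
  rw [← Plane.dist_sq, pow_left_inj₀ dist_nonneg hr two_ne_zero]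

/-- A line or a circle of positive radius. -/
def IsSupport (L : Set Plane) : Prop :=
  (∃ u v k : ℝ, (u ≠ 0 ∨ v ≠ 0) ∧ L = {x : Plane | u * x 0 + v * x 1 = k}) ∨
    ∃ (c : Plane) (r : ℝ), 0 < r ∧ L = Metric.sphere c r

lemma exists_smul_of_mem_line {u v k : ℝ} (huv : u ≠ 0 ∨ v ≠ 0) {x y : Plane}
    (hx : u * x 0 + v * x 1 = k) (hy : u * y 0 + v * y 1 = k) :
    ∃ t : ℝ, y 0 = x 0 - t * v ∧ y 1 = x 1 + t * u := by
  have hpos : 0 < u ^ 2 + v ^ 2 := by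
    rcases huv with h | h
    · have := sq_pos_of_ne_zero h
      positivity
    · have := sq_pos_of_ne_zero h
      positivity
  have e : u * (y 0 - x 0) + v * (y 1 - x 1) = 0 := by linarith
  refine ⟨(-(y 0 - x 0) * v + (y 1 - x 1) * u) / (u ^ 2 + v ^ 2), ?_, ?_⟩
  · field_simp
    linear_combination u * e
  · field_simp
    linear_combination v * e

/-- A line meets a circle in at most two points. -/
lemma line_inter_circle {u v k : ℝ} (huv : u ≠ 0 ∨ v ≠ 0) {c : Plane} {r : ℝ} {x y z : Plane}
    (hx : u * x 0 + v * x 1 = k) (hy : u * y 0 + v * y 1 = k) (hz : u * z 0 + v * z 1 = k)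
    (hx' : dist x c = r) (hy' : dist y c = r) (hz' : dist z c = r) :
    x = y ∨ x = z ∨ y = z := by
  have hr : 0 ≤ r := hx' ▸ dist_nonneg
  obtain ⟨t, hy0, hy1⟩ := exists_smul_of_mem_line huv hx hy
  obtain ⟨s, hz0, hz1⟩ := exists_smul_of_mem_line huv hx hz
  rw [Plane.dist_eq_iff hr] at hx' hy' hz'
  have hpos : u ^ 2 + v ^ 2 ≠ 0 := by
    rcases huv with h | h
    · have := sq_pos_of_ne_zero h
      positivity
    · have := sq_pos_of_ne_zero h
      positivity
  rw [hy0, hy1] at hy'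
  rw [hz0, hz1] at hz'
  have e1 : t * (t * (u ^ 2 + v ^ 2) + 2 * ((x 1 - c 1) * u - (x 0 - c 0) * v)) = 0 := by
    linear_combination hy' - hx'
  have e2 : s * (s * (u ^ 2 + v ^ 2) + 2 * ((x 1 - c 1) * u - (x 0 - c 0) * v)) = 0 := by
    linear_combination hz' - hx'
  rcases mul_eq_zero.1 e1 with h1 | h1
  · left
    rw [Plane.ext_iff', hy0, hy1, h1]
    simp
  rcases mul_eq_zero.1 e2 with h2 | h2
  · right; left
    rw [Plane.ext_iff', hz0, hz1, h2]
    simp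
  · right; right
    have : t = s := by
      have : (t - s) * (u ^ 2 + v ^ 2) = 0 := by linear_combination h1 - h2
      have := (mul_eq_zero.1 this).resolve_right hpos
      linarith
    rw [Plane.ext_iff', hz0, hz1, hy0, hy1, this]
    simp

/-- Two circles with different centers meet in at most two points. -/
lemma circle_inter_circle {c c' : Plane} (hc : c ≠ c') {r r' : ℝ} {x y z : Plane}
    (hx : dist x c = r) (hy : dist y c = r) (hz : dist z c = r)
    (hx' : dist x c' = r') (hy' : dist y c' = r') (hz' : dist z c' = r') :
    x = y ∨ x = z ∨ y = z := by
  have hr : 0 ≤ r := hx ▸ dist_nonneg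
  have hr' : 0 ≤ r' := hx' ▸ dist_nonneg
  have huv : c' 0 - c 0 ≠ 0 ∨ c' 1 - c 1 ≠ 0 := by
    by_contra! h
    exact hc (Plane.ext_iff'.2 ⟨by linarith [h.1], by linarith [h.2]⟩)
  have key : ∀ w : Plane, dist w c = r → dist w c' = r' → (c' 0 - c 0) * w 0 + (c' 1 - c 1) * w 1 =
      (r ^ 2 - r' ^ 2 - (c 0 ^ 2 + c 1 ^ 2) + (c' 0 ^ 2 + c' 1 ^ 2)) / 2 := by
    intro w h h'
    rw [Plane.dist_eq_iff hr] at h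
    rw [Plane.dist_eq_iff hr'] at h'
    linear_combination (h - h') / 2
  exact line_inter_circle huv (key x hx hx') (key y hy hy') (key z hz hz') hx hy hz

lemma line_subset_line {u v k u' v' k' : ℝ} (huv : u ≠ 0 ∨ v ≠ 0)
    {x y z : Plane} (hxy : x ≠ y) (hx : u * x 0 + v * x 1 = k) (hy : u * y 0 + v * y 1 = k)
    (hx' : u' * x 0 + v' * x 1 = k') (hy' : u' * y 0 + v' * y 1 = k')
    (hz : u * z 0 + v * z 1 = k) : u' * z 0 + v' * z 1 = k' := by
  obtain ⟨t, hy0, hy1⟩ := exists_smul_of_mem_line huv hx hy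
  obtain ⟨s, hz0, hz1⟩ := exists_smul_of_mem_line huv hx hz
  have ht : t ≠ 0 := by
    rintro rfl
    exact hxy (Plane.ext_iff'.2 ⟨by rw [hy0]; ring, by rw [hy1]; ring⟩)
  rw [hz0, hz1]
  have : t * (u' * -v + v' * u) = 0 := by
    rw [hy0, hy1] at hy'
    linear_combination hy' - hx'
  have := (mul_eq_zero.1 this).resolve_left ht
  linear_combination hx' + s * this

/-- Two different lines or circles meet in at most two points. -/
lemma IsSupport.inter {L M : Set Plane} (hL : IsSupport L) (hM : IsSupport M) (hne : L ≠ M)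
    {x y z : Plane} (hx : x ∈ L) (hy : y ∈ L) (hz : z ∈ L) (hx' : x ∈ M) (hy' : y ∈ M)
    (hz' : z ∈ M) : x = y ∨ x = z ∨ y = z := by
  rcases hL with ⟨u, v, k, huv, rfl⟩ | ⟨c, r, hr, rfl⟩ <;>
    rcases hM with ⟨u', v', k', huv', rfl⟩ | ⟨c', r', hr', rfl⟩
  · left
    by_contra hxy
    refine hne (Set.ext fun w => ⟨fun hw => ?_, fun hw => ?_⟩)
    · exact line_subset_line huv hxy hx hy hx' hy' hw
    · exact line_subset_line huv' hxy hx' hy' hx hy hw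
  · exact line_inter_circle huv hx hy hz hx' hy' hz'
  · exact line_inter_circle huv' hx' hy' hz' hx hy hz
  · by_cases hc : c = c'
    · subst hc
      refine absurd ?_ hne
      rw [Metric.mem_sphere] at hx hx'
      rw [← hx, ← hx']
    · exact circle_inter_circle hc hx hy hz hx' hy' hz'

lemma exists_finset_card_le_two {X : Type*} {S : Set X}
    (h : ∀ x ∈ S, ∀ y ∈ S, ∀ z ∈ S, x = y ∨ x = z ∨ y = z) :
    ∃ B : Finset X, B.card ≤ 2 ∧ S ⊆ B := by
  classical
  by_cases h1 : ∃ x ∈ S, ∃ y ∈ S, x ≠ y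
  · obtain ⟨x, hx, y, hy, hxy⟩ := h1
    refine ⟨{x, y}, Finset.card_le_two, fun z hz => ?_⟩
    rcases h x hx y hy z hz with h | h | h
    · exact absurd h hxy
    · simp [h]
    · simp [h]
  · push Not at h1
    rcases S.eq_empty_or_nonempty with rfl | ⟨x, hx⟩
    · exact ⟨∅, by simp, by simp⟩
    · refine ⟨{x}, by simp, fun z hz => ?_⟩
      simp [h1 z hz x hx]

/-! ### Open segments and arcs are relatively open in their line or circle -/

lemma IsOpenSegment.exists_support {e : Set Plane} {p q : Plane} (h : IsOpenSegment e p q) :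
    ∃ L, IsSupport L ∧ e ⊆ L ∧ ∀ x ∈ e, e ∈ 𝓝[L] x := by
  obtain ⟨hpq, rfl⟩ := h
  set a := q 0 - p 0 with ha
  set b := q 1 - p 1 with hb
  have hab : -b ≠ 0 ∨ a ≠ 0 := by
    by_contra! h
    exact hpq (Plane.ext_iff'.2 ⟨by linarith [h.2], by linarith [h.1]⟩)
  have hpos : 0 < a ^ 2 + b ^ 2 := by
    rcases hab with h | h
    · have := sq_pos_of_ne_zero h
      nlinarith [sq_nonneg a]
    · have := sq_pos_of_ne_zero h
      positivity
  set φ : Plane → ℝ := fun x => ((x 0 - p 0) * a + (x 1 - p 1) * b) / (a ^ 2 + b ^ 2) with hφ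
  have hφc : Continuous φ := by
    simp only [hφ]
    fun_prop
  have mem : ∀ x, x ∈ openSegment ℝ p q ↔
      (-b * x 0 + a * x 1 = -b * p 0 + a * p 1) ∧ φ x ∈ Ioo 0 1 := by
    intro x
    rw [openSegment_eq_image_lineMap]
    constructor
    · rintro ⟨t, ht, rfl⟩
      have e0 : (AffineMap.lineMap p q t : Plane) 0 = p 0 + t * a := by
        simp [AffineMap.lineMap_apply, ha]; ring
      have e1 : (AffineMap.lineMap p q t : Plane) 1 = p 1 + t * b := by
        simp [AffineMap.lineMap_apply, hb]; ring
      refine ⟨by rw [e0, e1]; ring, ?_⟩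
      have : φ (AffineMap.lineMap p q t) = t := by
        simp only [hφ]
        rw [e0, e1]
        field_simp
        ring
      rwa [this]
    · rintro ⟨h1, h2⟩
      refine ⟨φ x, h2, ?_⟩
      rw [Plane.ext_iff']
      have e0 : (AffineMap.lineMap p q (φ x) : Plane) 0 = p 0 + φ x * a := by
        simp [AffineMap.lineMap_apply, ha]; ring
      have e1 : (AffineMap.lineMap p q (φ x) : Plane) 1 = p 1 + φ x * b := by
        simp [AffineMap.lineMap_apply, hb]; ring
      rw [e0, e1]
      simp only [hφ]
      constructor
      · field_simp
        linear_combination b * h1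
      · field_simp
        linear_combination -a * h1
  refine ⟨{x : Plane | -b * x 0 + a * x 1 = -b * p 0 + a * p 1}, Or.inl ⟨_, _, _, hab, rfl⟩,
    fun x hx => ((mem x).1 hx).1, fun x hx => ?_⟩
  rw [mem_nhdsWithin]
  refine ⟨φ ⁻¹' Ioo 0 1, isOpen_Ioo.preimage hφc, ((mem x).1 hx).2, ?_⟩
  rintro y ⟨hy1, hy2⟩
  exact (mem y).2 ⟨hy2, hy1⟩

lemma circlePoint_mem_sphere (c : Plane) {r : ℝ} (hr : 0 ≤ r) (θ : ℝ) :
    circlePoint c r θ ∈ Metric.sphere c r := by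
  rw [Metric.mem_sphere, Plane.dist_eq_iff hr]
  simp [circlePoint]
  linear_combination r ^ 2 * Real.cos_sq_add_sin_sq θ

/-- The circle is the image of any parameter interval of length `2π`. -/
lemma exists_circlePoint_eq {c x : Plane} {r : ℝ} (hr : 0 < r) (hx : x ∈ Metric.sphere c r)
    (a : ℝ) : ∃ θ ∈ Ico a (a + 2 * Real.pi), x = circlePoint c r θ := by
  rw [Metric.mem_sphere, Plane.dist_eq_iff hr.le] at hx
  set z : ℂ := ⟨x 0 - c 0, x 1 - c 1⟩ with hz
  have hn : ‖z‖ = r := by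
    rw [Complex.norm_def, Complex.normSq_mk]
    rw [show (x 0 - c 0) * (x 0 - c 0) + (x 1 - c 1) * (x 1 - c 1) = r ^ 2 by rw [← hx]; ring]
    exact Real.sqrt_sq hr.le
  have h2pi : (0 : ℝ) < 2 * Real.pi := by positivity
  refine ⟨toIcoMod h2pi a z.arg, toIcoMod_mem_Ico h2pi a _, ?_⟩
  have hre : x 0 - c 0 = r * Real.cos z.arg := by
    rw [← hn, Complex.norm_mul_cos_arg]
  have him : x 1 - c 1 = r * Real.sin z.arg := by
    rw [← hn, Complex.norm_mul_sin_arg]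
  have e := self_sub_toIcoDiv_zsmul h2pi a z.arg
  have hcos : Real.cos (toIcoMod h2pi a z.arg) = Real.cos z.arg := by
    rw [← e, zsmul_eq_mul, Real.cos_sub_int_mul_two_pi]
  have hsin : Real.sin (toIcoMod h2pi a z.arg) = Real.sin z.arg := by
    rw [← e, zsmul_eq_mul, Real.sin_sub_int_mul_two_pi]
  rw [Plane.ext_iff']
  simp only [circlePoint, PiLp.add_apply, hcos, hsin]
  simp
  constructor <;> linarith

lemma IsOpenArc.exists_support {e : Set Plane} {p q : Plane} (h : IsOpenArc e p q) :
    ∃ L, IsSupport L ∧ e ⊆ L ∧ ∀ x ∈ e, e ∈ 𝓝[L] x := by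
  obtain ⟨c, r, a, b, hr, hab, hb, -, -, rfl⟩ := h
  refine ⟨Metric.sphere c r, Or.inr ⟨c, r, hr, rfl⟩, ?_, ?_⟩
  · rintro _ ⟨θ, -, rfl⟩
    exact circlePoint_mem_sphere c hr.le θ
  · intro x hx
    -- the rest of the circle is the compact image of the complementary parameter interval
    rw [mem_nhdsWithin]
    refine ⟨(circlePoint c r '' Icc b (a + 2 * Real.pi))ᶜ,
      (isCompact_Icc.image (continuous_circlePoint c r)).isClosed.isOpen_compl, ?_, ?_⟩
    · obtain ⟨θ, hθ, rfl⟩ := hx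
      rintro ⟨θ', hθ', h⟩
      rcases hθ'.2.lt_or_eq with h' | h'
      · have := circlePoint_injOn hr (le_refl (a + 2 * Real.pi))
          ⟨by linarith [hθ'.1], h'⟩ ⟨hθ.1.le, by linarith [hθ.2]⟩ h
        linarith [hθ'.1, hθ.2]
      · have h3 : circlePoint c r a = circlePoint c r θ := by
          rw [← h, h', circlePoint_eq_iff hr]
          simp
        have := circlePoint_injOn hr (le_refl (a + 2 * Real.pi))
          ⟨le_rfl, by linarith⟩ ⟨hθ.1.le, by linarith [hθ.2]⟩ h3
        linarith [hθ.1]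
    · rintro y ⟨hy1, hy2⟩
      obtain ⟨θ, hθ, rfl⟩ := exists_circlePoint_eq hr hy2 a
      have hlt : θ < b := by
        by_contra! hle
        exact hy1 ⟨θ, ⟨hle, hθ.2.le⟩, rfl⟩
      rcases hθ.1.lt_or_eq with h' | h'
      · exact ⟨θ, ⟨h', hlt⟩, rfl⟩
      · refine absurd ⟨a + 2 * Real.pi, ⟨hb, le_rfl⟩, ?_⟩ hy1
        rw [← h', circlePoint_eq_iff hr]
        simp

/-- An edge of a subdivision: an open segment or an open arc. -/
def IsEdge (e : Set Plane) (p q : Plane) : Prop := IsOpenSegment e p q ∨ IsOpenArc e p q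

lemma IsEdge.exists_support {e : Set Plane} {p q : Plane} (h : IsEdge e p q) :
    ∃ L, IsSupport L ∧ e ⊆ L ∧ ∀ x ∈ e, e ∈ 𝓝[L] x :=
  h.elim IsOpenSegment.exists_support IsOpenArc.exists_support

lemma IsEdge.exists_curve {e : Set Plane} {p q : Plane} (h : IsEdge e p q) :
    ∃ γ a b, IsCurve γ a b ∧ e = γ '' Ioo a b ∧ p = γ a ∧ q = γ b := by
  rcases h with ⟨hpq, rfl⟩ | ⟨c, r, a, b, hr, hab, hb, rfl, rfl, rfl⟩
  · exact ⟨_, 0, 1, isCurve_lineMap hpq, openSegment_eq_image_lineMap ℝ p q, by simp, by simp⟩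
  · exact ⟨_, a, b, isCurve_circlePoint hr hab hb, rfl, rfl, rfl⟩

/-- Away from at most two points, two edges of subdivisions coincide near each common point. -/
lemma IsEdge.inter {e e' : Set Plane} {p q p' q' : Plane} (h : IsEdge e p q)
    (h' : IsEdge e' p' q') : ∃ B : Finset Plane, B.card ≤ 2 ∧
      ∀ x ∈ e, x ∈ e' → x ∉ B → e' ∈ 𝓝[e] x ∧ e ∈ 𝓝[e'] x := by
  obtain ⟨L, hL, heL, hLn⟩ := h.exists_support
  obtain ⟨M, hM, heM, hMn⟩ := h'.exists_support
  by_cases hLM : L = M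
  · subst hLM
    exact ⟨∅, by simp, fun x hx hx' _ =>
      ⟨nhdsWithin_mono x heL (hMn x hx'), nhdsWithin_mono x heM (hLn x hx)⟩⟩
  · obtain ⟨B, hB, hsub⟩ := exists_finset_card_le_two (S := L ∩ M) fun x hx y hy z hz =>
      hL.inter hM hLM hx.1 hy.1 hz.1 hx.2 hy.2 hz.2
    exact ⟨B, hB, fun x hx hx' hxB => absurd (hsub ⟨heL hx, heM hx'⟩) hxB⟩

/-! ### The frontier of an intersection -/

lemma frontier_inter_eq {X : Type*} [TopologicalSpace X] {s t : Set X} (hs : IsClosed s)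
    (ht : IsClosed t) : frontier (s ∩ t) = (frontier s ∩ t) ∪ (s ∩ frontier t) := by
  rw [(hs.inter ht).frontier_eq, hs.frontier_eq, ht.frontier_eq, interior_inter]
  ext x
  simp only [Set.mem_sdiff, mem_inter_iff, mem_union]
  tauto

open scoped Classical in
/-- The edges (segments and arcs) of a subdivision. -/
noncomputable def FeatureDecomposition.edges {X : Set Plane} (D : FeatureDecomposition X) :
    Finset (Set Plane) := D.segments ∪ D.arcs

namespace FeatureDecomposition

variable {X : Set Plane} (D : FeatureDecomposition X)

lemma mem_edges {e : Set Plane} : e ∈ D.edges ↔ e ∈ D.segments ∨ e ∈ D.arcs := by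
  classical
  simp [edges]

lemma card_vertices_add_card_edges_le : D.vertices.card + D.edges.card ≤ D.size := by
  classical
  have : D.edges.card ≤ D.segments.card + D.arcs.card := Finset.card_union_le _ _
  unfold size
  omega

lemma edge_spec {e : Set Plane} (he : e ∈ D.edges) :
    ∃ p ∈ D.vertices, ∃ q ∈ D.vertices, IsEdge e p q := by
  rcases D.mem_edges.1 he with h | h
  · obtain ⟨p, hp, q, hq, h⟩ := D.segment_spec e h
    exact ⟨p, hp, q, hq, Or.inl h⟩
  · obtain ⟨p, hp, q, hq, h⟩ := D.arc_spec e h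
    exact ⟨p, hp, q, hq, Or.inr h⟩

lemma edge_disjoint {e e' : Set Plane} (he : e ∈ D.edges) (he' : e' ∈ D.edges) (hne : e ≠ e') :
    Disjoint e e' := D.edges_disjoint (D.mem_edges.1 he) (D.mem_edges.1 he') hne

lemma mem_iff {x : Plane} : x ∈ X ↔ x ∈ D.vertices ∨ ∃ e ∈ D.edges, x ∈ e := by
  conv_lhs => rw [← D.union_eq]
  simp only [mem_union, mem_iUnion, Finset.mem_coe, exists_prop, D.mem_edges]
  grind

lemma edge_subset {e : Set Plane} (he : e ∈ D.edges) : e ⊆ X := fun _ hx =>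
  D.mem_iff.2 (Or.inr ⟨e, he, hx⟩)

end FeatureDecomposition

open scoped Classical in
/-- In a finite family of pairwise disjoint sets, the points of a finite set are counted at most
once. -/
lemma sum_card_filter_mem_le {X : Type*} (E : Finset (Set X))
    (hE : ∀ e ∈ E, ∀ e' ∈ E, e ≠ e' → Disjoint e e') (P : Finset X) :
    ∑ e ∈ E, (P.filter (· ∈ e)).card ≤ P.card := by
  rw [← Finset.card_biUnion]
  · refine Finset.card_le_card (Finset.biUnion_subset.2 fun e _ => Finset.filter_subset _ _)
  · intro e he e' he' hne
    rw [Function.onFun, Finset.disjoint_left]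
    intro x hx hx'
    exact Set.disjoint_left.1 (hE e he e' he' hne) (Finset.mem_filter.1 hx).2
      (Finset.mem_filter.1 hx').2

open scoped Classical in
/-- The frontier of the intersection of two closed sets has a subdivision whose size is at most
proportional to the product of the sizes of subdivisions of the two frontiers. -/
theorem exists_featureDecomposition_inter {X Y : Set Plane} (hX : IsClosed X) (hY : IsClosed Y)
    (D : FeatureDecomposition (frontier X)) (D' : FeatureDecomposition (frontier Y)) :
    ∃ E : FeatureDecomposition (frontier (X ∩ Y)),
      E.size ≤ 6 * ((D.size + 1) * (D'.size + 1)) := by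
  have hB : ∀ e ∈ D.edges, ∀ e' ∈ D'.edges, ∃ B : Finset Plane, B.card ≤ 2 ∧
      ∀ x ∈ e, x ∈ e' → x ∉ B → e' ∈ 𝓝[e] x ∧ e ∈ 𝓝[e'] x := by
    intro e he e' he'
    obtain ⟨p, -, q, -, h⟩ := D.edge_spec he
    obtain ⟨p', -, q', -, h'⟩ := D'.edge_spec he'
    exact h.inter h'
  choose! B hB1 hB2 using hB
  set F := frontier (X ∩ Y) with hFdef
  have hFeq : F = (frontier X ∩ Y) ∪ (X ∩ frontier Y) := frontier_inter_eq hX hY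
  have hFX : F ⊆ X := (hX.inter hY).frontier_subset.trans inter_subset_left
  have hF : IsClosed F := isClosed_frontier
  have hfX : frontier X ⊆ X := hX.frontier_subset
  have hfY : frontier Y ⊆ Y := hY.frontier_subset
  have hint : ∀ {Z : Set Plane}, IsClosed Z → ∀ x ∈ Z, x ∉ frontier Z → Z ∈ 𝓝 x := by
    intro Z hZ x hx hx'
    rw [hZ.frontier_eq] at hx'
    exact mem_interior_iff_mem_nhds.1 (by_contra fun h => hx' ⟨hx, h⟩)
  set Q : Finset Plane := D.vertices ∪ D'.vertices ∪
    D.edges.biUnion fun e => D'.edges.biUnion fun e' => B e e' with hQ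
  have hQcard : Q.card ≤ D.vertices.card + D'.vertices.card +
      D.edges.card * (D'.edges.card * 2) := by
    refine (Finset.card_union_le _ _).trans (add_le_add (Finset.card_union_le _ _) ?_)
    refine Finset.card_biUnion_le_card_mul _ _ _ fun e he => ?_
    exact Finset.card_biUnion_le_card_mul _ _ _ fun e' he' => hB1 e he e' he'
  set P := Q.filter (· ∈ F) with hP
  have hPQ : P.card ≤ Q.card := Finset.card_filter_le _ _
  have hnP : ∀ x ∈ F, x ∉ P → x ∉ D.vertices ∧ x ∉ D'.vertices ∧
      ∀ e ∈ D.edges, ∀ e' ∈ D'.edges, x ∉ B e e' := by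
    intro x hxF hxP
    have hxQ : x ∉ Q := fun h => hxP (Finset.mem_filter.2 ⟨h, hxF⟩)
    simp only [hQ, Finset.mem_union, Finset.mem_biUnion, not_or, not_exists, not_and] at hxQ
    exact ⟨hxQ.1.1, hxQ.1.2, hxQ.2⟩
  have hPn : ∀ x, x ∉ P → (P : Set Plane)ᶜ ∈ 𝓝 x := fun x hx =>
    P.finite_toSet.isClosed.isOpen_compl.mem_nhds hx
  have hcur : ∀ i : Set Plane ⊕ Set Plane, i ∈ D.edges.disjSum D'.edges →
      ∃ γ a b, IsCurve γ a b ∧ Sum.elim id id i = γ '' Ioo a b ∧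
        γ a ∈ D.vertices ∪ D'.vertices ∧ γ b ∈ D.vertices ∪ D'.vertices := by
    rintro (e | e) he
    · obtain ⟨p, hp, q, hq, h⟩ := D.edge_spec (Finset.inl_mem_disjSum.1 he)
      obtain ⟨γ, a, b, h1, h2, rfl, rfl⟩ := h.exists_curve
      exact ⟨γ, a, b, h1, h2, Finset.mem_union_left _ hp, Finset.mem_union_left _ hq⟩
    · obtain ⟨p, hp, q, hq, h⟩ := D'.edge_spec (Finset.inr_mem_disjSum.1 he)
      obtain ⟨γ, a, b, h1, h2, rfl, rfl⟩ := h.exists_curve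
      exact ⟨γ, a, b, h1, h2, Finset.mem_union_right _ hp, Finset.mem_union_right _ hq⟩
  choose! γ a b hγ hγe hγa hγb using hcur
  -- edges of `frontier Y` inside `frontier X` are already covered by edges of `frontier X`
  let G : Set Plane ⊕ Set Plane → Set Plane :=
    Sum.elim (fun e => (e ∩ F) \ P) (fun e => (e ∩ F) \ (frontier X ∪ P))
  have hGsub : ∀ i, G i ⊆ (Sum.elim id id i ∩ F) \ (P : Set Plane) := by
    rintro (e | e) x hx
    · exact hx
    · exact ⟨hx.1, fun h => hx.2 (Or.inr h)⟩
  have htends : ∀ i ∈ D.edges.disjSum D'.edges, ∀ t ∈ Ioo (a i) (b i),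
      Tendsto (γ i) (𝓝 t) (𝓝[Sum.elim id id i] (γ i t)) := by
    intro i hi t ht
    refine tendsto_nhdsWithin_iff.2 ⟨(hγ i hi).cont.continuousAt, ?_⟩
    filter_upwards [isOpen_Ioo.mem_nhds ht] with s hs
    rw [hγe i hi]
    exact ⟨s, hs, rfl⟩
  have hmemi : ∀ i ∈ D.edges.disjSum D'.edges, ∀ t ∈ Ioo (a i) (b i),
      γ i t ∈ Sum.elim id id i := by
    intro i hi t ht
    rw [hγe i hi]
    exact ⟨t, ht, rfl⟩
  suffices main : ∃ E : FeatureDecomposition F, E.size ≤ P.card +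
      ∑ i ∈ D.edges.disjSum D'.edges, ((P.filter (· ∈ γ i '' Ioo (a i) (b i))).card + 1) by
    obtain ⟨E, hE⟩ := main
    refine ⟨E, hE.trans ?_⟩
    have h1 : ∑ i ∈ D.edges.disjSum D'.edges, ((P.filter (· ∈ γ i '' Ioo (a i) (b i))).card + 1) =
        ∑ i ∈ D.edges.disjSum D'.edges, ((P.filter (· ∈ Sum.elim id id i)).card + 1) := by
      refine Finset.sum_congr rfl fun i hi => ?_
      rw [hγe i hi]
    have h2 : ∑ e ∈ D.edges, (P.filter
        (· ∈ (Sum.elim id id (Sum.inl e : Set Plane ⊕ Set Plane) : Set Plane))).card ≤ P.card :=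
      sum_card_filter_mem_le D.edges (fun e he e' he' => D.edge_disjoint he he') P
    have h3 : ∑ e ∈ D'.edges, (P.filter
        (· ∈ (Sum.elim id id (Sum.inr e : Set Plane ⊕ Set Plane) : Set Plane))).card ≤ P.card :=
      sum_card_filter_mem_le D'.edges (fun e he e' he' => D'.edge_disjoint he he') P
    have h4 := D.card_vertices_add_card_edges_le
    have h5 := D'.card_vertices_add_card_edges_le
    rw [h1, Finset.sum_disjSum]
    simp only [Finset.sum_add_distrib, Finset.sum_const, smul_eq_mul, mul_one]
    have h6 : D.edges.card * D'.edges.card ≤ D.size * D'.size :=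
      Nat.mul_le_mul (by omega) (by omega)
    have h7 : D.edges.card * (D'.edges.card * 2) = 2 * (D.edges.card * D'.edges.card) := by ring
    have h8 : 6 * ((D.size + 1) * (D'.size + 1)) =
      6 * (D.size * D'.size) + 6 * D.size + 6 * D'.size + 6 := by ring
    omega
  refine exists_featureDecomposition (D.edges.disjSum D'.edges) (γ := γ) (a := a)
    (b := b) hγ hF P (fun p hp => (Finset.mem_filter.1 hp).2) (G := G)
    (fun i hi x hx => hγe i hi ▸ ((hGsub i) hx).1.1)
    (fun i hi x hx => ((hGsub i) hx).1.2)
    (fun i hi x hx => ((hGsub i) hx).2) ?_ ?_ ?_ ?_ ?_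
  · -- the kept parts are relatively open
    rintro (e | e) hi t ht hP' hx
    · have he := Finset.inl_mem_disjSum.1 hi
      have hte := htends _ hi t ht
      have hx1 : γ (Sum.inl e) t ∈ e := hx.1.1
      have hxF : γ (Sum.inl e) t ∈ F := hx.1.2
      have hxX : γ (Sum.inl e) t ∈ frontier X := D.edge_subset he hx1
      obtain ⟨-, hv, hb⟩ := hnP _ hxF hP'
      have hxY : γ (Sum.inl e) t ∈ Y := by
        rw [hFeq] at hxF
        rcases hxF with h | h
        · exact h.2
        · exact hfY h.2
      have hYn : ∀ᶠ y in 𝓝[e] (γ (Sum.inl e) t), y ∈ Y := by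
        by_cases hfr : γ (Sum.inl e) t ∈ frontier Y
        · obtain ⟨e', he', hxe'⟩ := (D'.mem_iff.1 hfr).resolve_left hv
          filter_upwards [(hB2 e he e' he' _ hx1 hxe' (hb e he e' he')).1] with y hy
          exact hfY (D'.edge_subset he' hy)
        · exact nhdsWithin_le_nhds (hint hY _ hxY hfr)
      filter_upwards [hte.eventually hYn, hte.eventually eventually_mem_nhdsWithin,
        hte.eventually (nhdsWithin_le_nhds (hPn _ hP'))] with s h1 h2 h3
      refine ⟨⟨h2, ?_⟩, h3⟩
      rw [hFeq]
      exact Or.inl ⟨D.edge_subset he h2, h1⟩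
    · have he := Finset.inr_mem_disjSum.1 hi
      have hte := htends _ hi t ht
      have hx1 : γ (Sum.inr e) t ∈ e := hx.1.1
      have hxF : γ (Sum.inr e) t ∈ F := hx.1.2
      have hxn : γ (Sum.inr e) t ∉ frontier X := fun h => hx.2 (Or.inl h)
      have hXn : interior X ∈ 𝓝 (γ (Sum.inr e) t) := interior_mem_nhds.2 (hint hX _ (hFX hxF) hxn)
      filter_upwards [hte.eventually (nhdsWithin_le_nhds hXn),
        hte.eventually eventually_mem_nhdsWithin,
        hte.eventually (nhdsWithin_le_nhds (hPn _ hP'))] with s h1 h2 h3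
      refine ⟨⟨h2, ?_⟩, ?_⟩
      · rw [hFeq]
        exact Or.inr ⟨interior_subset h1, D'.edge_subset he h2⟩
      · rintro (h | h)
        · exact h.2 h1
        · exact h3 h
  · -- the discarded parts are relatively open
    rintro (e | e) hi t ht hP' hx
    · have hx1 : γ (Sum.inl e) t ∈ e := hmemi _ hi t ht
      have hxF : γ (Sum.inl e) t ∉ F := fun h => hx ⟨⟨hx1, h⟩, hP'⟩
      filter_upwards [(hγ _ hi).cont.continuousAt.eventually (hF.isOpen_compl.mem_nhds hxF)]
        with s hs h
      exact hs h.1.2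
    · have hx1 : γ (Sum.inr e) t ∈ e := hmemi _ hi t ht
      have he := Finset.inr_mem_disjSum.1 hi
      by_cases hxF : γ (Sum.inr e) t ∈ F
      · obtain ⟨hv, -, hb⟩ := hnP _ hxF hP'
        have hfr : γ (Sum.inr e) t ∈ frontier X := by
          by_contra hfr
          exact hx ⟨⟨hx1, hxF⟩, fun h => h.elim hfr hP'⟩
        obtain ⟨e', he', hxe'⟩ := (D.mem_iff.1 hfr).resolve_left hv
        have hte := htends _ hi t ht
        filter_upwards [hte.eventually (hB2 e' he' e he _ hxe' hx1 (hb e' he' e he)).2] with s hs h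
        exact h.2 (Or.inl (D.edge_subset he' hs))
      · filter_upwards [(hγ _ hi).cont.continuousAt.eventually (hF.isOpen_compl.mem_nhds hxF)]
          with s hs h
        exact hs h.1.2
  · rintro (e | e) he (e' | e') he' hne
    · refine (D.edge_disjoint (Finset.inl_mem_disjSum.1 he) (Finset.inl_mem_disjSum.1 he')
        fun h => hne (by rw [h])).mono ?_ ?_
      · exact fun x hx => hx.1.1
      · exact fun x hx => hx.1.1
    · rw [Set.disjoint_left]
      exact fun x hx hx' => hx'.2 (Or.inl (D.edge_subset (Finset.inl_mem_disjSum.1 he) hx.1.1))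
    · rw [Set.disjoint_left]
      exact fun x hx hx' => hx.2 (Or.inl (D.edge_subset (Finset.inl_mem_disjSum.1 he') hx'.1.1))
    · refine (D'.edge_disjoint (Finset.inr_mem_disjSum.1 he) (Finset.inr_mem_disjSum.1 he')
        fun h => hne (by rw [h])).mono ?_ ?_
      · exact fun x hx => hx.1.1
      · exact fun x hx => hx.1.1
  · intro x hx
    by_cases hxP : x ∈ P
    · exact Or.inl hxP
    right
    obtain ⟨hv, hv', -⟩ := hnP x hx hxP
    by_cases hfr : x ∈ frontier X
    · obtain ⟨e, he, hxe⟩ := (D.mem_iff.1 hfr).resolve_left hv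
      exact ⟨Sum.inl e, Finset.inl_mem_disjSum.2 he, ⟨hxe, hx⟩, hxP⟩
    · have hfr' : x ∈ frontier Y := by
        rw [hFeq] at hx
        rcases hx with h | h
        · exact absurd h.1 hfr
        · exact h.2
      obtain ⟨e, he, hxe⟩ := (D'.mem_iff.1 hfr').resolve_left hv'
      exact ⟨Sum.inr e, Finset.inr_mem_disjSum.2 he, ⟨hxe, hx⟩, fun h => h.elim hfr hxP⟩
  · intro i hi
    refine ⟨fun h => Finset.mem_filter.2 ⟨?_, h⟩, fun h => Finset.mem_filter.2 ⟨?_, h⟩⟩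
    · exact Finset.mem_union_left _ (hγa i hi)
    · exact Finset.mem_union_left _ (hγb i hi)

/-! ### Noncrossing chords -/

/-- A family of pairwise noncrossing chords of a cyclically ordered set of `n` points has at most
`2 * n` elements: every chord `(i, j)` is either the longest one starting at `i`, or the only one
ending at `j` that is not the longest one at its start. -/
lemma card_le_of_noncrossing {n : ℕ} (E : Finset (ℕ × ℕ)) (hE : ∀ e ∈ E, e.1 < e.2 ∧ e.2 < n)
    (hnc : ∀ e ∈ E, ∀ e' ∈ E, ¬(e.1 < e'.1 ∧ e'.1 < e.2 ∧ e.2 < e'.2)) : E.card ≤ 2 * n := by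
  classical
  set E1 := E.filter fun e => ∀ e' ∈ E, e'.1 = e.1 → e'.2 ≤ e.2
  set E2 := E.filter fun e => ¬ ∀ e' ∈ E, e'.1 = e.1 → e'.2 ≤ e.2
  have h0 : E1.card + E2.card = E.card := Finset.card_filter_add_card_filter_not _
  have h1 : E1.card ≤ n := by
    rw [← Finset.card_range n]
    refine Finset.card_le_card_of_injOn Prod.fst (fun e he => ?_) (fun e he e' he' h => ?_)
    · have := hE e (Finset.mem_filter.1 he).1
      simp only [Finset.coe_range, mem_Iio]
      omega
    · obtain ⟨he, hm⟩ := Finset.mem_filter.1 he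
      obtain ⟨he', hm'⟩ := Finset.mem_filter.1 he'
      exact Prod.ext h (le_antisymm (hm' e he h) (hm e' he' h.symm))
  have h2 : E2.card ≤ n := by
    rw [← Finset.card_range n]
    have aux : ∀ e ∈ E2, ∀ e' ∈ E2, e.2 = e'.2 → ¬ e.1 < e'.1 := by
      intro e he e' he' h hlt
      obtain ⟨he, -⟩ := Finset.mem_filter.1 he
      obtain ⟨he', hm'⟩ := Finset.mem_filter.1 he'
      push Not at hm'
      obtain ⟨f, hf, hf1, hf2⟩ := hm'
      have := hE e' he'
      exact hnc e he f hf ⟨by omega, by omega, by omega⟩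
    refine Finset.card_le_card_of_injOn Prod.snd (fun e he => ?_) (fun e he e' he' h => ?_)
    · have := hE e (Finset.mem_filter.1 he).1
      simp only [Finset.coe_range, mem_Iio]
      omega
    · refine Prod.ext ?_ h
      have := aux e he e' he' h
      have := aux e' he' e he h.symm
      omega
  omega

/-! ### Piecewise linear curves -/

section PiecewiseLinear

variable {E : Type*} [NormedAddCommGroup E] [NormedSpace ℝ E]

/-- The piecewise linear map on `ℝ` with the values `u 0, …, u N` at `0, …, N`, constant outside
`[0, N]`. -/
noncomputable def plMap (u : ℕ → E) (N : ℕ) (s : ℝ) : E :=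
  u 0 + ∑ k ∈ Finset.range N, max 0 (min 1 (s - k)) • (u (k + 1) - u k)

lemma continuous_plMap (u : ℕ → E) (N : ℕ) : Continuous (plMap u N) := by
  unfold plMap
  fun_prop

lemma plMap_of_ge (u : ℕ → E) (N : ℕ) {s : ℝ} (hs : (N : ℝ) ≤ s) : plMap u N s = u N := by
  induction N with
  | zero => simp [plMap]
  | succ N ih =>
    push_cast at hs
    have h1 := ih (by linarith)
    rw [plMap, Finset.sum_range_succ, ← add_assoc, ← plMap, h1, min_eq_left (by linarith)]
    simp

lemma plMap_eq (u : ℕ → E) {N k : ℕ} (hk : k < N) {s : ℝ} (h1 : (k : ℝ) ≤ s) (h2 : s ≤ k + 1) :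
    plMap u N s = u k + (s - k) • (u (k + 1) - u k) := by
  induction N with
  | zero => omega
  | succ N ih =>
    rw [plMap, Finset.sum_range_succ, ← add_assoc, ← plMap]
    rcases Nat.lt_succ_iff_lt_or_eq.1 hk with h | rfl
    · have : (k : ℝ) + 1 ≤ N := by exact_mod_cast h
      rw [ih h, max_eq_left ((min_le_right _ _).trans (by linarith))]
      simp
    · rw [plMap_of_ge u k h1, min_eq_right (by linarith), max_eq_right (by linarith)]

lemma plMap_natCast (u : ℕ → E) {N k : ℕ} (hk : k ≤ N) : plMap u N k = u k := by
  rcases hk.lt_or_eq with h | rfl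
  · rw [plMap_eq u h le_rfl (by linarith)]
    simp
  · exact plMap_of_ge u k le_rfl

lemma plMap_eq_lineMap (u : ℕ → E) {N k : ℕ} (hk : k < N) {s : ℝ} (h1 : (k : ℝ) ≤ s)
    (h2 : s ≤ k + 1) : plMap u N s = AffineMap.lineMap (u k) (u (k + 1)) (s - k) := by
  rw [plMap_eq u hk h1 h2, AffineMap.lineMap_apply, vsub_eq_sub, vadd_eq_add, add_comm]

/-- On the part of a unit interval between two integers the piecewise linear map is affine. -/
lemma segment_plMap_subset (u : ℕ → E) {N k : ℕ} (hk : k < N) {s t : ℝ} (hs : (k : ℝ) ≤ s)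
    (hst : s ≤ t) (ht : t ≤ k + 1) :
    segment ℝ (plMap u N s) (plMap u N t) ⊆ plMap u N '' Icc s t := by
  rw [plMap_eq_lineMap u hk hs (hst.trans ht), plMap_eq_lineMap u hk (hs.trans hst) ht,
    ← image_segment, segment_eq_Icc (by linarith)]
  rintro _ ⟨r, hr, rfl⟩
  refine ⟨r + k, ⟨by linarith [hr.1], by linarith [hr.2]⟩, ?_⟩
  rw [plMap_eq_lineMap u hk (by linarith [hr.1]) (by linarith [hr.2])]
  simp

end PiecewiseLinear

/-! ### Winding of planar curves around points -/

/-- The angle, in `(-π, π]`, under which the segment from `u` to `v` is seen from `p`. -/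
noncomputable def viewAngle (u v p : ℂ) : ℝ := Complex.arg ((v - p) / (u - p))

/-- `θ` is a possible angle by which the direction from `p` turns when moving from `u` to `v`. -/
def IsTurn (p u v : ℂ) (θ : ℝ) : Prop :=
  ∃ ρ : ℝ, 0 < ρ ∧ v - p = ρ * Complex.exp (θ * Complex.I) * (u - p)

lemma IsTurn.trans {p u v w : ℂ} {θ φ : ℝ} (h : IsTurn p u v θ) (h' : IsTurn p v w φ) :
    IsTurn p u w (θ + φ) := by
  obtain ⟨ρ, hρ, h⟩ := h
  obtain ⟨σ, hσ, h'⟩ := h'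
  refine ⟨σ * ρ, by positivity, ?_⟩
  rw [h', h]
  push_cast
  rw [add_mul, Complex.exp_add]
  ring

lemma IsTurn.symm {p u v : ℂ} {θ : ℝ} (h : IsTurn p u v θ) : IsTurn p v u (-θ) := by
  obtain ⟨ρ, hρ, h⟩ := h
  refine ⟨ρ⁻¹, by positivity, ?_⟩
  rw [h]
  have : (ρ : ℂ) ≠ 0 := by exact_mod_cast hρ.ne'
  push_cast
  rw [neg_mul, Complex.exp_neg]
  field_simp [Complex.exp_ne_zero]

lemma IsTurn.eq_two_pi_mul_int {p u : ℂ} {θ : ℝ} (h : IsTurn p u u θ) (hp : u ≠ p) :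
    ∃ m : ℤ, θ = m * (2 * Real.pi) := by
  obtain ⟨ρ, hρ, h⟩ := h
  have hup : u - p ≠ 0 := sub_ne_zero.2 hp
  have h1 : (ρ : ℂ) * Complex.exp (θ * Complex.I) = 1 := by
    have : ((ρ : ℂ) * Complex.exp (θ * Complex.I) - 1) * (u - p) = 0 := by linear_combination -h
    have := (mul_eq_zero.1 this).resolve_right hup
    linear_combination this
  have h2 : ρ = 1 := by
    have := congrArg norm h1
    rw [norm_mul, Complex.norm_exp_ofReal_mul_I, Complex.norm_real, Real.norm_of_nonneg hρ.le] at this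
    simpa using this
  rw [h2, Complex.ofReal_one, one_mul, Complex.exp_eq_one_iff] at h1
  obtain ⟨m, hm⟩ := h1
  refine ⟨m, ?_⟩
  have h3 : (θ : ℂ) = m * (2 * Real.pi) := by
    have : ((θ : ℂ) - m * (2 * Real.pi)) * Complex.I = 0 := by linear_combination hm
    have := (mul_eq_zero.1 this).resolve_right Complex.I_ne_zero
    linear_combination this
  exact_mod_cast h3

lemma isTurn_viewAngle {p u v : ℂ} (hu : u ≠ p) (hv : v ≠ p) :
    IsTurn p u v (viewAngle u v p) := by
  have hu' : u - p ≠ 0 := sub_ne_zero.2 hu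
  have hv' : v - p ≠ 0 := sub_ne_zero.2 hv
  refine ⟨‖(v - p) / (u - p)‖, norm_pos_iff.2 (div_ne_zero hv' hu'), ?_⟩
  rw [viewAngle, Complex.norm_mul_exp_arg_mul_I]
  field_simp

lemma continuousAt_viewAngle {u v p : ℂ} (hp : p ∉ segment ℝ u v) :
    ContinuousAt (viewAngle u v) p := by
  have hu : u - p ≠ 0 := sub_ne_zero.2 fun h => hp (h ▸ left_mem_segment ℝ u v)
  have h1 : (v - p) / (u - p) ∈ Complex.slitPlane := by
    by_contra hn
    rw [Complex.mem_slitPlane_iff] at hn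
    push Not at hn
    obtain ⟨h1, h2⟩ := hn
    set z := (v - p) / (u - p) with hz
    have hz' : z = ((z.re : ℝ) : ℂ) := Complex.ext (by simp) (by simp [h2])
    have h3 : v - p = (z.re : ℂ) * (u - p) := by
      rw [← hz', hz]
      field_simp
    set c := z.re
    refine hp ⟨-c / (1 - c), 1 / (1 - c), div_nonneg (by linarith) (by linarith),
      div_nonneg one_pos.le (by linarith), ?_, ?_⟩
    · have hc : 1 - c ≠ 0 := by linarith
      field_simp
      ring
    · have hc : (1 - c : ℂ) ≠ 0 := by
        have : (1 - c : ℝ) ≠ 0 := by linarith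
        exact_mod_cast this
      simp only [Complex.real_smul]
      push_cast
      field_simp
      linear_combination h3
  refine ContinuousAt.comp (f := fun p => (v - p) / (u - p)) (Complex.continuousAt_arg h1) ?_
  exact ContinuousAt.div (by fun_prop) (by fun_prop) hu

lemma tendsto_viewAngle_cobounded (u v : ℂ) :
    Tendsto (viewAngle u v) (Bornology.cobounded ℂ) (𝓝 0) := by
  have h0 : Tendsto (fun p : ℂ => u - p) (Bornology.cobounded ℂ) (Bornology.cobounded ℂ) := by
    simp [tendsto_const_sub_cobounded u]
  have h1 : Tendsto (fun p : ℂ => (v - p) / (u - p)) (Bornology.cobounded ℂ) (𝓝 1) := by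
    have h2 : Tendsto (fun p : ℂ => 1 + (v - u) * (u - p)⁻¹) (Bornology.cobounded ℂ)
        (𝓝 (1 + (v - u) * 0)) :=
      tendsto_const_nhds.add (tendsto_const_nhds.mul (tendsto_inv₀_cobounded.comp h0))
    rw [mul_zero, add_zero] at h2
    refine h2.congr' ?_
    filter_upwards [Bornology.eventually_ne_cobounded u] with p hp
    have : u - p ≠ 0 := sub_ne_zero.2 hp.symm
    field_simp
    ring
  have h2 : Tendsto Complex.arg (𝓝 1) (𝓝 0) := by
    have := Complex.continuousAt_arg (x := 1) (by simp)
    simpa [ContinuousAt] using this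
  exact h2.comp h1

/-- The angle under which a segment is seen jumps by `2π` across its midpoint, so it does not
agree with a function that is continuous there. -/
lemma viewAngle_jump {a b : ℂ} (hab : a ≠ b) {f : ℂ → ℝ} {q : ℂ} (hq : q = (a + b) / 2)
    (hf : ContinuousAt f q) (h : ∀ᶠ p in 𝓝 q, p ∉ segment ℝ a b → f p = viewAngle b a p) :
    False := by
  have hba : b - a ≠ 0 := sub_ne_zero.2 hab.symm
  -- the two approaches to the midpoint, orthogonally to the segment
  have key : ∀ σ : ℝ, σ ≠ 0 → ∀ t : ℝ, 0 < t → ∀ p : ℂ, p = q + σ * t * Complex.I * (b - a) →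
      p ∉ segment ℝ a b ∧ (a - p) / (b - p) =
        -((1 / 2 + σ * t * Complex.I) / (1 / 2 - σ * t * Complex.I)) := by
    intro σ hσ t ht p hp
    have hne : (1 / 2 - σ * t * Complex.I : ℂ) ≠ 0 := by
      intro h0
      have := congrArg Complex.re h0
      simp at this
    constructor
    · rw [segment_eq_image_lineMap]
      rintro ⟨r, -, hr⟩
      rw [AffineMap.lineMap_apply, vsub_eq_sub, vadd_eq_add, Complex.real_smul, hp, hq] at hr
      have h1 : ((r : ℂ) - 1 / 2 - σ * t * Complex.I) * (b - a) = 0 := by linear_combination hr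
      have h2 := (mul_eq_zero.1 h1).resolve_right hba
      have h3 := congrArg Complex.im h2
      simp at h3
      rcases h3 with h3 | h3
      · exact hσ h3
      · exact ht.ne' h3
    · have h1 : a - p = -((1 / 2 + σ * t * Complex.I) * (b - a)) := by rw [hp, hq]; ring
      have h2 : b - p = (1 / 2 - σ * t * Complex.I) * (b - a) := by rw [hp, hq]; ring
      rw [h1, h2]
      field_simp
  have hlim : ∀ σ : ℝ, Tendsto (fun t : ℝ => q + σ * t * Complex.I * (b - a)) (𝓝[>] 0) (𝓝 q) := by
    intro σ
    have : Continuous fun t : ℝ => q + σ * t * Complex.I * (b - a) := by fun_prop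
    have := this.tendsto 0
    simp only [Complex.ofReal_zero, mul_zero, zero_mul, add_zero] at this
    exact this.mono_left nhdsWithin_le_nhds
  have hz : ∀ σ : ℝ, Tendsto (fun t : ℝ => -((1 / 2 + σ * t * Complex.I) / (1 / 2 - σ * t * Complex.I)))
      (𝓝[>] 0) (𝓝 (-1)) := by
    intro σ
    have : ContinuousAt (fun t : ℝ => -((1 / 2 + σ * t * Complex.I) / (1 / 2 - σ * t * Complex.I))) 0 := by
      refine (ContinuousAt.div (by fun_prop) (by fun_prop) ?_).neg
      simp
    have := this.tendsto
    simp only [Complex.ofReal_zero, mul_zero, zero_mul, add_zero, sub_zero] at this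
    rw [div_self (by norm_num)] at this
    exact this.mono_left nhdsWithin_le_nhds
  have him : ∀ σ t : ℝ, 0 < t → 0 < σ * -(-((1 / 2 + σ * t * Complex.I) /
      (1 / 2 - σ * t * Complex.I))).im ∨ σ = 0 := by
    intro σ t ht
    by_cases hσ : σ = 0
    · exact Or.inr hσ
    left
    have hσ2 := sq_pos_of_ne_zero hσ
    have h1 : ((1 / 2 + σ * t * Complex.I) / (1 / 2 - σ * t * Complex.I) : ℂ).im =
        σ * t / (1 / 4 + (σ * t) ^ 2) := by
      rw [Complex.div_im]
      simp [Complex.normSq_apply]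
      field_simp
      ring
    rw [Complex.neg_im, neg_neg, h1]
    have : σ * (σ * t / (1 / 4 + (σ * t) ^ 2)) = σ ^ 2 * t / (1 / 4 + (σ * t) ^ 2) := by ring
    rw [this]
    positivity
  have hval : ∀ σ : ℝ, σ ≠ 0 → Tendsto (fun t : ℝ => Complex.arg (-((1 / 2 + σ * t * Complex.I) /
      (1 / 2 - σ * t * Complex.I)))) (𝓝[>] 0) (𝓝 (f q)) := by
    intro σ hσ
    refine (hf.tendsto.comp (hlim σ)).congr' ?_
    filter_upwards [(hlim σ).eventually h, self_mem_nhdsWithin] with t ht ht0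
    obtain ⟨h1, h2⟩ := key σ hσ t ht0 _ rfl
    rw [Function.comp_apply, ht h1, viewAngle, h2]
  have hneg : f q = -Real.pi := by
    refine tendsto_nhds_unique (hval 1 one_ne_zero) ?_
    refine (Complex.tendsto_arg_nhdsWithin_im_neg_of_re_neg_of_im_zero (z := -1) (by simp)
      (by simp)).comp ?_
    refine tendsto_nhdsWithin_iff.2 ⟨hz 1, ?_⟩
    filter_upwards [self_mem_nhdsWithin] with t ht
    have := (him 1 t ht).resolve_right one_ne_zero
    rw [one_mul] at this
    exact neg_pos.1 this
  have hpos : f q = Real.pi := by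
    refine tendsto_nhds_unique (hval (-1) (by norm_num)) ?_
    have h1 := Complex.continuousWithinAt_arg_of_re_neg_of_im_zero (z := -1) (by simp) (by simp)
    have h2 : Tendsto Complex.arg (𝓝[{z | 0 ≤ z.im}] (-1)) (𝓝 Real.pi) := by
      have := h1.tendsto
      rwa [Complex.arg_neg_one] at this
    refine h2.comp ?_
    refine tendsto_nhdsWithin_iff.2 ⟨hz (-1), ?_⟩
    filter_upwards [self_mem_nhdsWithin] with t ht
    have := (him (-1) t ht).resolve_right (by norm_num)
    change 0 ≤ Complex.im _
    linarith
  linarith [Real.pi_pos]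

/-- The complement of a segment in the plane is connected. -/
lemma isPreconnected_compl_segment {a b : ℂ} (hab : a ≠ b) : IsPreconnected (segment ℝ a b)ᶜ := by
  have hba : b - a ≠ 0 := sub_ne_zero.2 hab.symm
  have h1 : IsPreconnected (((({z : ℂ | 0 < z.im} ∪ {z : ℂ | z.re < 0}) ∪ {z : ℂ | z.im < 0}) ∪
      {z : ℂ | 1 < z.re}) : Set ℂ) := by
    refine IsPreconnected.union' ⟨⟨2, 1⟩, ?_⟩ (IsPreconnected.union' ⟨⟨-1, -1⟩, ?_⟩
      (IsPreconnected.union' ⟨⟨-1, 1⟩, ?_⟩ ?_ ?_) ?_) ?_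
    · simp
    · simp
    · simp
    · exact (convex_halfSpace_im_gt 0).isPreconnected
    · exact (convex_halfSpace_re_lt 0).isPreconnected
    · exact (convex_halfSpace_im_lt 0).isPreconnected
    · exact (convex_halfSpace_re_gt 1).isPreconnected
  have h2 := h1.image (fun z => a + z * (b - a)) (by fun_prop)
  convert h2 using 1
  ext p
  rw [mem_compl_iff, segment_eq_image_lineMap]
  constructor
  · intro hp
    have hpz : a + (p - a) / (b - a) * (b - a) = p := by
      field_simp
      ring
    refine ⟨(p - a) / (b - a), ?_, hpz⟩
    set z := (p - a) / (b - a)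
    by_contra hn
    simp only [mem_union, mem_ofPred_eq, not_or, not_lt] at hn
    have him : z.im = 0 := le_antisymm hn.1.1.1 hn.1.2
    refine hp ⟨z.re, ⟨hn.1.1.2, hn.2⟩, ?_⟩
    rw [AffineMap.lineMap_apply, vsub_eq_sub, vadd_eq_add, Complex.real_smul,
      show ((z.re : ℝ) : ℂ) = z from Complex.ext (by simp) (by simp [him]), add_comm]
    exact hpz
  · rintro ⟨z, hz, rfl⟩ ⟨r, hr, h⟩
    rw [AffineMap.lineMap_apply, vsub_eq_sub, vadd_eq_add, Complex.real_smul] at h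
    have h3 : ((r : ℂ) - z) * (b - a) = 0 := by linear_combination h
    have h4 := (mul_eq_zero.1 h3).resolve_right hba
    have h5 : z = r := by linear_combination -h4
    subst h5
    simp only [mem_union, mem_ofPred_eq, Complex.ofReal_re, Complex.ofReal_im] at hz
    rcases hz with ((h | h) | h) | h
    · exact lt_irrefl _ h
    · linarith [hr.1]
    · exact lt_irrefl _ h
    · linarith [hr.2]

/-- The total angle under which the part of the polygonal curve `plMap v N` between the
parameters `s` and `t` is seen from `p`. -/
noncomputable def windingAngle (v : ℕ → ℂ) (N : ℕ) (s t : ℝ) (p : ℂ) : ℝ :=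
  ∑ k ∈ Finset.range N, viewAngle (plMap v N (max s (min t k)))
    (plMap v N (max s (min t (k + 1 : ℕ)))) p

section Winding

variable (v : ℕ → ℂ) {N : ℕ} {s t : ℝ}

lemma segment_clamp_subset (hst : s ≤ t) {k : ℕ} (hk : k < N) :
    segment ℝ (plMap v N (max s (min t k))) (plMap v N (max s (min t (k + 1 : ℕ)))) ⊆
      plMap v N '' Icc s t := by
  have hle : max s (min t (k : ℝ)) ≤ max s (min t (k + 1 : ℕ)) := by
    push_cast
    gcongr
    linarith
  have h1 : s ≤ max s (min t (k : ℝ)) := le_max_left _ _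
  have h2 : max s (min t ((k + 1 : ℕ) : ℝ)) ≤ t := max_le hst (min_le_left _ _)
  rcases hle.lt_or_eq with h | h
  · push_cast at h hle h2 ⊢
    have hk1 : (k : ℝ) ≤ max s (min t (k : ℝ)) := by
      by_contra! hlt
      have h3 : min t (k : ℝ) < k := (le_max_right _ _).trans_lt hlt
      have h4 : t < k := by simpa using h3
      rw [min_eq_left h4.le, min_eq_left (by linarith)] at h
      exact lt_irrefl _ h
    have hk2 : max s (min t ((k : ℝ) + 1)) ≤ k + 1 := by
      by_contra! hlt
      have h4 : (k : ℝ) + 1 < s := by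
        rcases lt_max_iff.1 hlt with h4 | h4
        · exact h4
        · simp at h4
      rw [max_eq_left ((min_le_right _ _).trans (by linarith)),
        max_eq_left ((min_le_right _ _).trans (by linarith))] at h
      exact lt_irrefl _ h
    exact (segment_plMap_subset v hk hk1 hle hk2).trans (image_mono (Icc_subset_Icc h1 h2))
  · rw [← h, segment_same]
    rintro _ rfl
    exact ⟨_, ⟨h1, h ▸ h2⟩, rfl⟩

lemma isTurn_windingAngle (hs : 0 ≤ s) (hst : s ≤ t) (ht : t ≤ N) {p : ℂ}
    (hp : p ∉ plMap v N '' Icc s t) :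
    IsTurn p (plMap v N s) (plMap v N t) (windingAngle v N s t p) := by
  have key : ∀ M ≤ N, IsTurn p (plMap v N (max s (min t (0 : ℕ)))) (plMap v N (max s (min t M)))
      (∑ k ∈ Finset.range M, viewAngle (plMap v N (max s (min t k)))
        (plMap v N (max s (min t (k + 1 : ℕ)))) p) := by
    intro M hM
    induction M with
    | zero => exact ⟨1, one_pos, by simp⟩
    | succ M ih =>
      rw [Finset.sum_range_succ]
      have hsub := segment_clamp_subset v hst (Nat.lt_of_succ_le hM)
      refine (ih (by omega)).trans (isTurn_viewAngle ?_ ?_)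
      · rintro rfl
        exact hp (hsub (left_mem_segment ℝ _ _))
      · rintro rfl
        exact hp (hsub (right_mem_segment ℝ _ _))
  have := key N le_rfl
  rwa [Nat.cast_zero, min_eq_right (hs.trans hst), max_eq_left hs, min_eq_left ht,
    max_eq_right hst] at this

lemma continuousAt_windingAngle (hst : s ≤ t) {p : ℂ} (hp : p ∉ plMap v N '' Icc s t) :
    ContinuousAt (windingAngle v N s t) p := by
  unfold windingAngle
  refine tendsto_finsetSum _ fun k hk => ?_
  exact continuousAt_viewAngle fun h => hp (segment_clamp_subset v hst (Finset.mem_range.1 hk) h)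

variable (N s t) in
lemma tendsto_windingAngle_cobounded :
    Tendsto (windingAngle v N s t) (Bornology.cobounded ℂ) (𝓝 0) := by
  have := tendsto_finsetSum (Finset.range N) fun k _ => tendsto_viewAngle_cobounded
    (plMap v N (max s (min t k))) (plMap v N (max s (min t (k + 1 : ℕ))))
  rwa [Finset.sum_const_zero] at this

end Winding

/-- A function with values in `2πℤ` is locally constant at its points of continuity. -/
lemma eventually_eq_of_two_pi_int {f : ℂ → ℝ} {p : ℂ} (hf : ContinuousAt f p)
    (h : ∀ᶠ q in 𝓝 p, ∃ m : ℤ, f q = m * (2 * Real.pi)) : ∀ᶠ q in 𝓝 p, f q = f p := by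
  obtain ⟨m, hm⟩ := h.self_of_nhds
  have hpi := Real.pi_pos
  filter_upwards [h, Metric.tendsto_nhds.1 hf.tendsto (2 * Real.pi) (by positivity)] with q hq hd
  obtain ⟨k, hk⟩ := hq
  rw [Real.dist_eq, hk, hm, ← sub_mul, abs_mul, abs_of_pos (by positivity : 0 < 2 * Real.pi)] at hd
  have h1 : |((k - m : ℤ) : ℝ)| < 1 := by
    push_cast
    by_contra! hc
    nlinarith
  have h2 : |k - m| < 1 := by exact_mod_cast h1
  have h3 : k = m := by
    have := Int.abs_lt_one_iff.1 h2
    omega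
  rw [hk, hm, h3]

/-- A `2πℤ`-valued function tending to `0` at infinity vanishes at some point of each unbounded
set. -/
lemma exists_eq_zero_of_unbounded {f : ℂ → ℝ} (hf : Tendsto f (Bornology.cobounded ℂ) (𝓝 0))
    {U : Set ℂ} (hU : ¬ Bornology.IsBounded U) (h : ∀ p ∈ U, ∃ m : ℤ, f p = m * (2 * Real.pi)) :
    ∃ p ∈ U, f p = 0 := by
  have hpi := Real.pi_pos
  by_contra! hne
  refine hU ?_
  rw [Bornology.isBounded_def]
  filter_upwards [Metric.tendsto_nhds.1 hf (2 * Real.pi) (by positivity)] with p hp hpU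
  obtain ⟨m, hm⟩ := h p hpU
  rw [dist_zero_right, Real.norm_eq_abs, hm, abs_mul,
    abs_of_pos (by positivity : 0 < 2 * Real.pi)] at hp
  have h1 : |(m : ℝ)| < 1 := by
    by_contra! hc
    nlinarith
  have h2 : |m| < 1 := by exact_mod_cast h1
  have h3 := Int.abs_lt_one_iff.1 h2
  exact hne p hpU (by rw [hm, h3]; simp)

/-- Two disjoint chords in the exterior of a simple closed polygonal curve do not have interleaved
endpoints. The chord `[a, b]` cuts the curve into two arcs; let `w₁`, `w₂` be the winding angles of
the two closed curves that each arc forms with the chord. On the chord `[c, d]` their sum vanishes,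
and so `w₂` is constantly `-τ` on the arc through `c` and `w₁` is constantly `τ` on the arc through
`d`. For `τ ≠ 0` the points with `w₁ = w₂ = 0`, for `τ = 0` the points with `w₁ ≠ 0` and
`w₁ + w₂ = 0` form an open set whose boundary lies on `[a, b]`, hence an empty set; the former
contains all points far away, the latter contains points next to `[a, b]`. -/
theorem chords_not_interleaved {v : ℕ → ℂ} {n : ℕ} (hv : ∀ k, v (k + n) = v k)
    (hinj : InjOn (plMap v (2 * n)) (Ico 0 (n : ℝ))) {sa sb sc sd : ℝ} (h0 : 0 ≤ sa)
    (hac : sa < sc) (hcb : sc < sb) (hbd : sb < sd) (hdn : sd < n)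
    (hab : ∀ p ∈ openSegment ℝ (plMap v (2 * n) sa) (plMap v (2 * n) sb), ∃ U : Set ℂ,
      IsPreconnected U ∧ ¬ Bornology.IsBounded U ∧ p ∈ U ∧
        Disjoint U (plMap v (2 * n) '' Icc 0 n))
    (hcd : ∀ p ∈ openSegment ℝ (plMap v (2 * n) sc) (plMap v (2 * n) sd), ∃ U : Set ℂ,
      IsPreconnected U ∧ ¬ Bornology.IsBounded U ∧ p ∈ U ∧
        Disjoint U (plMap v (2 * n) '' Icc 0 n))
    (hdis : Disjoint (openSegment ℝ (plMap v (2 * n) sa) (plMap v (2 * n) sb))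
      (openSegment ℝ (plMap v (2 * n) sc) (plMap v (2 * n) sd))) : False := by
  have hper : ∀ s : ℝ, 0 ≤ s → s < n → plMap v (2 * n) (s + n) = plMap v (2 * n) s := by
    intro s hs hsn
    have hk1 := Nat.floor_le hs
    have hk2 := Nat.lt_floor_add_one s
    have hk3 : ⌊s⌋₊ < n := (Nat.floor_lt hs).2 hsn
    rw [plMap_eq v (by omega) hk1 hk2.le,
      plMap_eq v (k := ⌊s⌋₊ + n) (by omega) (by push_cast; linarith) (by push_cast; linarith),
      hv, add_right_comm, hv]
    push_cast
    congr 2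
    ring
  have hGn : plMap v (2 * n) n = plMap v (2 * n) 0 := by
    have := hper 0 le_rfl (by linarith)
    rwa [zero_add] at this
  have hGc : Continuous (plMap v (2 * n)) := continuous_plMap v _
  have hN : ((2 * n : ℕ) : ℝ) = 2 * n := by push_cast; ring
  set G := plMap v (2 * n) with hG
  set Γ := G '' Icc 0 (n : ℝ) with hΓ
  set a := G sa with ha
  set b := G sb with hb
  set c := G sc with hc
  set d := G sd with hd
  set T : ℝ := sa + n with hT
  -- the curve is injective on every half-open period
  have hred : ∀ s ∈ Ico sa T, ∃ s' ∈ Ico (0 : ℝ) n, G s' = G s ∧ (s' = s ∧ sa ≤ s' ∨ s' = s - n ∧ s' < sa) := by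
    intro s hs
    rcases lt_or_ge s n with h | h
    · exact ⟨s, ⟨h0.trans hs.1, h⟩, rfl, Or.inl ⟨rfl, hs.1⟩⟩
    · refine ⟨s - n, ⟨by linarith, by linarith [hs.2]⟩, ?_, Or.inr ⟨rfl, by linarith [hs.2]⟩⟩
      have := hper (s - n) (by linarith) (by linarith [hs.2])
      rw [← this, sub_add_cancel]
  have hinj' : InjOn G (Ico sa T) := by
    intro s hs t ht hst
    obtain ⟨s', hs', e1, h1⟩ := hred s hs
    obtain ⟨t', ht', e2, h2⟩ := hred t ht
    have := hinj hs' ht' (by rw [e1, e2, hst])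
    rcases h1 with ⟨h1, h1'⟩ | ⟨h1, h1'⟩ <;> rcases h2 with ⟨h2, h2'⟩ | ⟨h2, h2'⟩ <;> linarith
  have hGT : G T = a := hper sa h0 (by linarith)
  have hsubΓ : ∀ s ∈ Icc sa T, G s ∈ Γ := by
    intro s hs
    rcases hs.2.lt_or_eq with h | h
    · obtain ⟨s', hs', e1, -⟩ := hred s ⟨hs.1, h⟩
      exact ⟨s', ⟨hs'.1, hs'.2.le⟩, e1⟩
    · rw [h, hGT]
      exact ⟨sa, ⟨h0, by linarith⟩, rfl⟩
  have hΓsub : ∀ p ∈ Γ, ∃ s ∈ Ico sa T, G s = p := by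
    rintro _ ⟨s, hs, rfl⟩
    rcases hs.2.lt_or_eq with h | h
    · rcases lt_or_ge s sa with h' | h'
      · exact ⟨s + n, ⟨by linarith [hs.1], by linarith⟩, hper s hs.1 h⟩
      · exact ⟨s, ⟨h', by linarith⟩, rfl⟩
    · rcases h0.lt_or_eq with h' | h'
      · exact ⟨n, ⟨by linarith, by linarith⟩, by rw [h]⟩
      · exact ⟨sa, ⟨le_rfl, by linarith⟩, by rw [h, ← h', hGn]⟩
  set C1 := G '' Icc sa sb with hC1
  set C2 := G '' Icc sb T with hC2
  set O1 := G '' Ioo sa sb with hO1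
  set O2 := G '' Ioo sb T with hO2
  have hC1Γ : C1 ⊆ Γ := by
    rintro _ ⟨s, hs, rfl⟩
    exact hsubΓ s ⟨hs.1, by linarith [hs.2]⟩
  have hC2Γ : C2 ⊆ Γ := by
    rintro _ ⟨s, hs, rfl⟩
    exact hsubΓ s ⟨by linarith [hs.1], hs.2⟩
  have hne : a ≠ b := by
    intro h
    have := hinj' ⟨le_rfl, by linarith⟩ ⟨by linarith, by linarith⟩ h
    linarith
  have haΓ : a ∈ Γ := hsubΓ sa ⟨le_rfl, by linarith⟩
  have hbΓ : b ∈ Γ := hsubΓ sb ⟨by linarith, by linarith⟩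
  have habΓ : ∀ p ∈ openSegment ℝ a b, p ∉ Γ := by
    intro p hp hpΓ
    obtain ⟨U, -, -, hpU, hU⟩ := hab p hp
    exact Set.disjoint_left.1 hU hpU hpΓ
  have hcdΓ : ∀ p ∈ openSegment ℝ c d, p ∉ Γ := by
    intro p hp hpΓ
    obtain ⟨U, -, -, hpU, hU⟩ := hcd p hp
    exact Set.disjoint_left.1 hU hpU hpΓ
  set K := segment ℝ a b with hK
  have hKeq : ∀ p, p ∈ K ↔ p ∈ openSegment ℝ a b ∨ p = a ∨ p = b := by
    intro p
    rw [hK, ← insert_endpoints_openSegment]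
    simp only [mem_insert_iff]
    tauto
  have hKΓ : ∀ p ∈ Γ, p ∈ K → p = a ∨ p = b := fun p hp hpK =>
    ((hKeq p).1 hpK).resolve_left fun h => habΓ p h hp
  have hO1K : ∀ p ∈ O1, p ∉ C2 ∧ p ∉ K := by
    rintro _ ⟨s, hs, rfl⟩
    have hs' : s ∈ Ico sa T := ⟨hs.1.le, by linarith [hs.2]⟩
    constructor
    · rintro ⟨t, ht, h⟩
      rcases ht.2.lt_or_eq with h' | h'
      · have := hinj' ⟨by linarith [ht.1], h'⟩ hs' h
        linarith [ht.1, hs.2]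
      · rw [h', hGT] at h
        have := hinj' ⟨le_rfl, by linarith⟩ hs' h
        linarith [hs.1]
    · intro hK'
      rcases hKΓ _ (hsubΓ s ⟨hs'.1, hs'.2.le⟩) hK' with h | h
      · have := hinj' hs' ⟨le_rfl, by linarith⟩ h
        linarith [hs.1]
      · have := hinj' hs' ⟨by linarith, by linarith⟩ h
        linarith [hs.2]
  have hO2K : ∀ p ∈ O2, p ∉ C1 ∧ p ∉ K := by
    rintro _ ⟨s, hs, rfl⟩
    have hs' : s ∈ Ico sa T := ⟨by linarith [hs.1], hs.2⟩
    constructor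
    · rintro ⟨t, ht, h⟩
      have := hinj' ⟨ht.1, by linarith [ht.2]⟩ hs' h
      linarith [ht.2, hs.1]
    · intro hK'
      rcases hKΓ _ (hsubΓ s ⟨hs'.1, hs'.2.le⟩) hK' with h | h
      · have := hinj' hs' ⟨le_rfl, by linarith⟩ h
        linarith [hs.1]
      · have := hinj' hs' ⟨by linarith, by linarith⟩ h
        linarith [hs.1]
  have hsplit : ∀ p ∈ Γ, p ∉ K → p ∈ O1 ∨ p ∈ O2 := by
    intro p hp hpK
    obtain ⟨s, hs, rfl⟩ := hΓsub p hp
    rcases lt_trichotomy s sb with h | h | h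
    · rcases hs.1.lt_or_eq with h' | h'
      · exact Or.inl ⟨s, ⟨h', h⟩, rfl⟩
      · exact absurd ((hKeq _).2 (Or.inr (Or.inl (by rw [← h'])))) hpK
    · exact absurd ((hKeq _).2 (Or.inr (Or.inr (by rw [h])))) hpK
    · exact Or.inr ⟨s, ⟨h, hs.2⟩, rfl⟩
  -- the winding angles
  set f1 : ℂ → ℝ := windingAngle v (2 * n) sa sb with hf1
  set f2 : ℂ → ℝ := windingAngle v (2 * n) sb T with hf2
  set w1 : ℂ → ℝ := fun p => f1 p + viewAngle b a p with hw1
  set w2 : ℂ → ℝ := fun p => f2 p + -viewAngle b a p with hw2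
  set w : ℂ → ℝ := fun p => f1 p + f2 p with hw
  have hsum : ∀ p, w1 p + w2 p = w p := fun p => by simp only [hw1, hw2, hw]; ring
  have hK' : segment ℝ b a = K := segment_symm ℝ b a
  have haK : a ∈ K := left_mem_segment ℝ a b
  have hbK : b ∈ K := right_mem_segment ℝ a b
  have turn1 : ∀ p, p ∉ C1 → IsTurn p a b (f1 p) := fun p hp =>
    isTurn_windingAngle v h0 (by linarith) (by rw [hN]; linarith) hp
  have turn2 : ∀ p, p ∉ C2 → IsTurn p b a (f2 p) := fun p hp => by
    have := isTurn_windingAngle v (N := 2 * n) (s := sb) (t := T) (by linarith) (by linarith)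
      (by rw [hN]; linarith) hp
    rwa [← hG, hGT] at this
  have turnK : ∀ p, p ∉ K → IsTurn p b a (viewAngle b a p) := fun p hp =>
    isTurn_viewAngle (fun h => hp (h ▸ hbK)) (fun h => hp (h ▸ haK))
  have int1 : ∀ p, p ∉ C1 ∪ K → ∃ m : ℤ, w1 p = m * (2 * Real.pi) := fun p hp =>
    ((turn1 p fun h => hp (Or.inl h)).trans (turnK p fun h => hp (Or.inr h))).eq_two_pi_mul_int
      fun h => hp (Or.inr (h ▸ haK))
  have int2 : ∀ p, p ∉ C2 ∪ K → ∃ m : ℤ, w2 p = m * (2 * Real.pi) := fun p hp =>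
    ((turn2 p fun h => hp (Or.inl h)).trans (turnK p fun h => hp (Or.inr h)).symm).eq_two_pi_mul_int
      fun h => hp (Or.inr (h ▸ hbK))
  have int0 : ∀ p, p ∉ Γ → ∃ m : ℤ, w p = m * (2 * Real.pi) := fun p hp =>
    ((turn1 p fun h => hp (hC1Γ h)).trans (turn2 p fun h => hp (hC2Γ h))).eq_two_pi_mul_int
      fun h => hp (h ▸ haΓ)
  have clK : IsClosed K := by
    rw [hK, segment_eq_image_lineMap]
    exact (isCompact_Icc.image AffineMap.lineMap_continuous).isClosed
  have clC1 : IsClosed C1 := (isCompact_Icc.image hGc).isClosed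
  have clC2 : IsClosed C2 := (isCompact_Icc.image hGc).isClosed
  have clΓ : IsClosed Γ := (isCompact_Icc.image hGc).isClosed
  have cont1 : ∀ p, p ∉ C1 → ContinuousAt f1 p := fun p hp =>
    continuousAt_windingAngle v (by linarith) hp
  have cont2 : ∀ p, p ∉ C2 → ContinuousAt f2 p := fun p hp =>
    continuousAt_windingAngle v (by linarith) hp
  have contK : ∀ p, p ∉ K → ContinuousAt (viewAngle b a) p := fun p hp =>
    continuousAt_viewAngle (by rwa [hK'])
  have loc1 : ∀ p, p ∉ C1 ∪ K → ∀ᶠ q in 𝓝 p, w1 q = w1 p := fun p hp => by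
    refine eventually_eq_of_two_pi_int ((cont1 p fun h => hp (Or.inl h)).add
      (contK p fun h => hp (Or.inr h))) ?_
    filter_upwards [(clC1.union clK).isOpen_compl.mem_nhds hp] with q hq using int1 q hq
  have loc2 : ∀ p, p ∉ C2 ∪ K → ∀ᶠ q in 𝓝 p, w2 q = w2 p := fun p hp => by
    refine eventually_eq_of_two_pi_int ((cont2 p fun h => hp (Or.inl h)).add
      (contK p fun h => hp (Or.inr h)).neg) ?_
    filter_upwards [(clC2.union clK).isOpen_compl.mem_nhds hp] with q hq using int2 q hq
  have loc0 : ∀ p, p ∉ Γ → ∀ᶠ q in 𝓝 p, w q = w p := fun p hp => by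
    refine eventually_eq_of_two_pi_int ((cont1 p fun h => hp (hC1Γ h)).add
      (cont2 p fun h => hp (hC2Γ h))) ?_
    filter_upwards [clΓ.isOpen_compl.mem_nhds hp] with q hq using int0 q hq
  have inf1 : Tendsto f1 (Bornology.cobounded ℂ) (𝓝 0) := tendsto_windingAngle_cobounded v _ _ _
  have inf2 : Tendsto f2 (Bornology.cobounded ℂ) (𝓝 0) := tendsto_windingAngle_cobounded v _ _ _
  have infK := tendsto_viewAngle_cobounded b a
  have ext0 : ∀ U : Set ℂ, IsPreconnected U → ¬ Bornology.IsBounded U → Disjoint U Γ →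
      ∀ p ∈ U, w p = 0 := by
    intro U hU hUb hUΓ p hp
    have hUn : ∀ q ∈ U, q ∉ Γ := fun q hq => Set.disjoint_left.1 hUΓ hq
    obtain ⟨q, hq, hq0⟩ := exists_eq_zero_of_unbounded (f := w)
      (by simpa using inf1.add inf2) hUb fun q hq => int0 q (hUn q hq)
    rw [← hq0]
    exact hU.eq_of_eventually_eq (fun q hq => (loc0 q (hUn q hq)).filter_mono nhdsWithin_le_nhds)
      hp hq
  -- the common values along the second chord and along the two arcs
  set z := AffineMap.lineMap c d (1 / 2 : ℝ) with hz
  have hzcd : z ∈ openSegment ℝ c d := by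
    rw [openSegment_eq_image_lineMap]
    exact ⟨1 / 2, by norm_num, rfl⟩
  have hwz : w z = 0 := by
    obtain ⟨U, hU, hUb, hzU, hUΓ⟩ := hcd z hzcd
    exact ext0 U hU hUb hUΓ z hzU
  have hcO1 : c ∈ O1 := ⟨sc, ⟨hac, hcb⟩, rfl⟩
  have hdO2 : d ∈ O2 := ⟨sd, ⟨hbd, by linarith⟩, rfl⟩
  have hcdK : ∀ p ∈ openSegment ℝ c d, p ∉ K := by
    intro p hp hpK
    rcases (hKeq p).1 hpK with h | rfl | rfl
    · exact Set.disjoint_left.1 hdis h hp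
    · exact hcdΓ _ hp haΓ
    · exact hcdΓ _ hp hbΓ
  have hc2 : w2 c = w2 z := by
    have hpre : IsPreconnected (AffineMap.lineMap c d '' Ico (0 : ℝ) 1) :=
      isPreconnected_Ico.image _ AffineMap.lineMap_continuous.continuousOn
    refine hpre.eq_of_eventually_eq (fun p hp => (loc2 p ?_).filter_mono nhdsWithin_le_nhds)
      ⟨0, by simp, by simp⟩ ⟨1 / 2, by norm_num, rfl⟩
    obtain ⟨r, hr, rfl⟩ := hp
    rcases hr.1.lt_or_eq with h | h
    · have hm : (AffineMap.lineMap c d r : ℂ) ∈ openSegment ℝ c d := by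
        rw [openSegment_eq_image_lineMap]
        exact ⟨r, ⟨h, hr.2⟩, rfl⟩
      rintro (h' | h')
      · exact hcdΓ _ hm (hC2Γ h')
      · exact hcdK _ hm h'
    · rw [← h, AffineMap.lineMap_apply_zero]
      exact fun h => h.elim (hO1K c hcO1).1 (hO1K c hcO1).2
  have hd1 : w1 d = w1 z := by
    have hpre : IsPreconnected (AffineMap.lineMap c d '' Ioc (0 : ℝ) 1) :=
      isPreconnected_Ioc.image _ AffineMap.lineMap_continuous.continuousOn
    refine hpre.eq_of_eventually_eq (fun p hp => (loc1 p ?_).filter_mono nhdsWithin_le_nhds)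
      ⟨1, by simp, by simp⟩ ⟨1 / 2, by norm_num, rfl⟩
    obtain ⟨r, hr, rfl⟩ := hp
    rcases hr.2.lt_or_eq with h | h
    · have hm : (AffineMap.lineMap c d r : ℂ) ∈ openSegment ℝ c d := by
        rw [openSegment_eq_image_lineMap]
        exact ⟨r, ⟨hr.1, h⟩, rfl⟩
      rintro (h' | h')
      · exact hcdΓ _ hm (hC1Γ h')
      · exact hcdK _ hm h'
    · rw [h, AffineMap.lineMap_apply_one]
      exact fun h => h.elim (hO2K d hdO2).1 (hO2K d hdO2).2
  have hw2O1 : ∀ q ∈ O1, w2 q = -w1 z := by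
    intro q hq
    have h1 : w2 q = w2 c := (isPreconnected_Ioo.image _ hGc.continuousOn).eq_of_eventually_eq
      (fun p hp => (loc2 p fun h => h.elim (hO1K p hp).1 (hO1K p hp).2).filter_mono
        nhdsWithin_le_nhds) hq hcO1
    rw [h1, hc2]
    linarith [hsum z]
  have hw1O2 : ∀ q ∈ O2, w1 q = w1 z := by
    intro q hq
    have h1 : w1 q = w1 d := (isPreconnected_Ioo.image _ hGc.continuousOn).eq_of_eventually_eq
      (fun p hp => (loc1 p fun h => h.elim (hO2K p hp).1 (hO2K p hp).2).filter_mono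
        nhdsWithin_le_nhds) hq hdO2
    rw [h1, hd1]
  -- an open and closed condition off the curve that excludes the arcs fails everywhere
  have empty : ∀ Q : ℝ → ℝ → Prop, (∀ x, ¬ Q x (-w1 z)) → (∀ y, ¬ Q (w1 z) y) →
      ∀ p, p ∉ Γ → p ∉ K → ¬ Q (w1 p) (w2 p) := by
    intro Q hQ1 hQ2 p hpΓ hpK hQ
    have hcon := (isPreconnected_compl_segment hne).eq_of_eventually_eq
      (f := fun p => (p ∉ Γ ∧ Q (w1 p) (w2 p))) (fun q hq => ?_) hpK (hO1K c hcO1).2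
    · have h1 : p ∉ Γ ∧ Q (w1 p) (w2 p) := ⟨hpΓ, hQ⟩
      rw [hcon] at h1
      exact h1.1 (hsubΓ sc ⟨hac.le, by linarith⟩)
    · refine Filter.Eventually.filter_mono nhdsWithin_le_nhds ?_
      by_cases hqΓ : q ∈ Γ
      · have hF : (q ∉ Γ ∧ Q (w1 q) (w2 q)) = False := by simp [hqΓ]
        rcases hsplit q hqΓ hq with h | h
        · filter_upwards [loc2 q fun h' => h'.elim (hO1K q h).1 (hO1K q h).2] with y hy
          rw [hF, hy, hw2O1 q h]
          simp [hQ1]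
        · filter_upwards [loc1 q fun h' => h'.elim (hO2K q h).1 (hO2K q h).2] with y hy
          rw [hF, hy, hw1O2 q h]
          simp [hQ2]
      · have hq1 : q ∉ C1 ∪ K := fun h => h.elim (fun h => hqΓ (hC1Γ h)) hq
        have hq2 : q ∉ C2 ∪ K := fun h => h.elim (fun h => hqΓ (hC2Γ h)) hq
        filter_upwards [loc1 q hq1, loc2 q hq2, clΓ.isOpen_compl.mem_nhds hqΓ] with y h1 h2 h3
        rw [h1, h2]
        have h3' : y ∉ Γ := h3
        simp [h3', hqΓ]
  by_cases hτ : w1 z = 0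
  · -- next to the midpoint of the first chord the winding angle `w₁` cannot vanish on both sides
    have hE := empty (fun x y => x ≠ 0 ∧ x + y = 0) (fun x h => h.1 (by rw [hτ] at h; linarith [h.2]))
      (fun y h => h.1 hτ)
    have hmem : (a + b) / 2 ∈ openSegment ℝ a b := by
      refine ⟨1 / 2, 1 / 2, by norm_num, by norm_num, by norm_num, ?_⟩
      simp only [Complex.real_smul]
      push_cast
      ring
    have hmΓ := habΓ _ hmem
    have hwm : w ((a + b) / 2) = 0 := by
      obtain ⟨U, hU, hUb, hzU, hUΓ⟩ := hab _ hmem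
      exact ext0 U hU hUb hUΓ _ hzU
    refine viewAngle_jump hne rfl (f := fun p => -f1 p) (cont1 _ fun h => hmΓ (hC1Γ h)).neg ?_
    filter_upwards [loc0 _ hmΓ, clΓ.isOpen_compl.mem_nhds hmΓ] with p hp0 hpΓ hpK
    have h1 := hE p hpΓ hpK
    rw [hsum, hp0, hwm] at h1
    have h2 : w1 p = 0 := by
      by_contra h
      exact h1 ⟨h, rfl⟩
    simp only [hw1] at h2
    linarith
  · -- points far away are not enclosed by any of the closed curves
    have hE := empty (fun x y => x = 0 ∧ y = 0) (fun x h => hτ (by linarith [h.2]))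
      (fun y h => hτ h.1)
    have hbd : Bornology.IsBounded (Γ ∪ K) :=
      ((isCompact_Icc.image hGc).isBounded).union ((by
        rw [hK, segment_eq_image_lineMap]
        exact isCompact_Icc.image AffineMap.lineMap_continuous : IsCompact K).isBounded)
    have hpi := Real.pi_pos
    have e1 : ∀ᶠ p in Bornology.cobounded ℂ, ∀ x : ℝ, x = w1 p ∨ x = w2 p →
        (∃ m : ℤ, x = m * (2 * Real.pi)) → x = 0 := by
      have t1 : Tendsto w1 (Bornology.cobounded ℂ) (𝓝 0) := by simpa using inf1.add infK
      have t2 : Tendsto w2 (Bornology.cobounded ℂ) (𝓝 0) := by simpa using inf2.add infK.neg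
      filter_upwards [Metric.tendsto_nhds.1 t1 (2 * Real.pi) (by positivity),
        Metric.tendsto_nhds.1 t2 (2 * Real.pi) (by positivity)] with p h1 h2 x hx
      rintro ⟨m, hm⟩
      have h3 : |x| < 2 * Real.pi := by
        rcases hx with rfl | rfl
        · simpa [Real.dist_eq] using h1
        · simpa [Real.dist_eq] using h2
      rw [hm, abs_mul, abs_of_pos (by positivity : 0 < 2 * Real.pi)] at h3
      have h4 : |(m : ℝ)| < 1 := by
        by_contra! hc
        nlinarith
      have h5 : |m| < 1 := by exact_mod_cast h4
      rw [hm, Int.abs_lt_one_iff.1 h5]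
      simp
    have e2 : ∀ᶠ p in Bornology.cobounded ℂ, p ∉ Γ ∪ K := Bornology.isBounded_def.1 hbd
    obtain ⟨p, hp1, hp2⟩ := (e1.and e2).exists
    have hpΓ : p ∉ Γ := fun h => hp2 (Or.inl h)
    have hpK : p ∉ K := fun h => hp2 (Or.inr h)
    refine hE p hpΓ hpK ⟨hp1 _ (Or.inl rfl) (int1 p ?_), hp1 _ (Or.inr rfl) (int2 p ?_)⟩
    · exact fun h => h.elim (fun h => hpΓ (hC1Γ h)) hpK
    · exact fun h => h.elim (fun h => hpΓ (hC2Γ h)) hpK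

/-! ### Dilations and polygon regions -/

lemma mem_dilate {A : Set Plane} {r : ℝ} {x : Plane} :
    x ∈ dilate A r ↔ ∃ a ∈ A, dist x a ≤ r := by
  unfold dilate
  rw [Set.mem_add]
  constructor
  · rintro ⟨a, ha, b, hb, rfl⟩
    refine ⟨a, ha, ?_⟩
    rw [mem_closedBall_zero_iff] at hb
    simpa [dist_eq_norm] using hb
  · rintro ⟨a, ha, h⟩
    refine ⟨a, ha, x - a, ?_, by abel⟩
    rwa [mem_closedBall_zero_iff, ← dist_eq_norm]

lemma isCompact_dilate {A : Set Plane} (hA : IsCompact A) (r : ℝ) : IsCompact (dilate A r) :=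
  hA.add (isCompact_closedBall 0 r)

/-- A half-open edge of a polygon, containing its first endpoint. -/
def halfEdge {n : ℕ} (P : Polygon Plane n) (i : Fin n) : Set Plane :=
  P.edgePath ℝ i '' Ico (0 : ℝ) 1

section Polygon

variable {n : ℕ} {P : Polygon Plane n}

lemma halfEdge_subset_edgeSet (i : Fin n) : halfEdge P i ⊆ P.edgeSet ℝ i :=
  image_mono Ico_subset_Icc_self

lemma edgeSet_subset_boundary (i : Fin n) : P.edgeSet ℝ i ⊆ P.boundary ℝ :=
  subset_iUnion (fun i => P.edgeSet ℝ i) i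

lemma vertex_mem_halfEdge (i : Fin n) : P i ∈ halfEdge P i :=
  ⟨0, by simp, by simp [Polygon.edgePath]⟩

lemma edgeSet_eq_segment (i : Fin n) :
    P.edgeSet ℝ i = segment ℝ (P i) (P (finRotate n i)) :=
  (segment_eq_image_lineMap ℝ _ _).symm

lemma edgeSet_subset_halfEdge (i : Fin n) :
    P.edgeSet ℝ i ⊆ halfEdge P i ∪ {P (finRotate n i)} := by
  rintro _ ⟨t, ht, rfl⟩
  rcases ht.2.lt_or_eq with h | rfl
  · exact Or.inl ⟨t, ⟨ht.1, h⟩, rfl⟩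
  · right
    simp

lemma exists_mem_halfEdge {p : Plane} (hp : p ∈ P.boundary ℝ) : ∃ i, p ∈ halfEdge P i := by
  obtain ⟨i, hi⟩ := mem_iUnion.1 hp
  rcases edgeSet_subset_halfEdge i hi with h | h
  · exact ⟨i, h⟩
  · rw [mem_singleton_iff] at h
    exact ⟨finRotate n i, h ▸ vertex_mem_halfEdge _⟩

lemma halfEdge_subset_boundary (i : Fin n) : halfEdge P i ⊆ P.boundary ℝ :=
  (halfEdge_subset_edgeSet i).trans (edgeSet_subset_boundary i)

lemma IsSimplePolygon.eq_of_mem_halfEdge (hP : IsSimplePolygon P) {p : Plane} {i j : Fin n}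
    (hi : p ∈ halfEdge P i) (hj : p ∈ halfEdge P j) : i = j := by
  by_contra hij
  exact Set.disjoint_left.1 (hP.2.2 i j hij) hi hj

/-- In a simple polygon, an edge through a vertex is one of the two edges ending there, and an
edge through an inner point of an edge is this edge. -/
lemma IsSimplePolygon.eq_or_of_mem_edgeSet (hP : IsSimplePolygon P) {p : Plane} {i j : Fin n}
    (hi : p ∈ halfEdge P i) (hj : p ∈ P.edgeSet ℝ j) :
    j = i ∨ (p = P i ∧ finRotate n j = i) := by
  rcases edgeSet_subset_halfEdge j hj with h | h
  · exact Or.inl (hP.eq_of_mem_halfEdge h hi)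
  · rw [mem_singleton_iff] at h
    subst h
    have := hP.eq_of_mem_halfEdge (vertex_mem_halfEdge _) hi
    exact Or.inr ⟨by rw [this], this⟩

lemma isCompact_edgeSet (i : Fin n) : IsCompact (P.edgeSet ℝ i) := by
  rw [Polygon.edgeSet_eq_image_edgePath]
  exact isCompact_Icc.image AffineMap.lineMap_continuous

lemma isCompact_boundary : IsCompact (P.boundary ℝ) :=
  isCompact_iUnion fun i => isCompact_edgeSet i

lemma not_mem_polygonRegion {x : Plane} : x ∉ polygonRegion P ↔ x ∉ P.boundary ℝ ∧
    ¬ Bornology.IsBounded (connectedComponentIn (P.boundary ℝ)ᶜ x) := by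
  unfold polygonRegion
  simp only [mem_union, mem_ofPred_eq, not_or, not_and]
  tauto

/-- A preconnected set off the boundary curve that contains a point outside the polygon region lies
outside the region. -/
lemma disjoint_polygonRegion {s : Set Plane} (hs : IsPreconnected s)
    (hsb : Disjoint s (P.boundary ℝ)) {x : Plane} (hx : x ∈ s) (hxP : x ∉ polygonRegion P) :
    Disjoint s (polygonRegion P) := by
  rw [Set.disjoint_left]
  intro y hy
  rw [not_mem_polygonRegion] at hxP ⊢
  have hsub : s ⊆ (P.boundary ℝ)ᶜ := Set.disjoint_left.1 hsb
  refine ⟨hsub hy, ?_⟩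
  rw [← connectedComponentIn_eq (hs.subset_connectedComponentIn hx hsub hy)]
  exact hxP.2

lemma isClosed_polygonRegion : IsClosed (polygonRegion P) := by
  rw [← isOpen_compl_iff, isOpen_iff_mem_nhds]
  intro x hx
  have hx' := not_mem_polygonRegion.1 hx
  have ho : IsOpen (P.boundary ℝ)ᶜ := isCompact_boundary.isClosed.isOpen_compl
  have h1 : connectedComponentIn (P.boundary ℝ)ᶜ x ∈ 𝓝 x :=
    ho.connectedComponentIn.mem_nhds (mem_connectedComponentIn hx'.1)
  filter_upwards [h1] with y hy
  refine Set.disjoint_left.1 (disjoint_polygonRegion isPreconnected_connectedComponentIn ?_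
    (mem_connectedComponentIn hx'.1) hx) hy
  exact Set.disjoint_left.2 fun z hz => connectedComponentIn_subset _ _ hz

/-- A point from which a ray avoids the boundary curve lies outside the region. -/
lemma not_mem_polygonRegion_of_ray {x u : Plane} (hu : u ≠ 0)
    (h : ∀ t : ℝ, 0 ≤ t → x + t • u ∉ P.boundary ℝ) : x ∉ polygonRegion P := by
  have h0 : x ∉ P.boundary ℝ := by simpa using h 0 le_rfl
  rw [not_mem_polygonRegion]
  refine ⟨h0, fun hb => ?_⟩
  have hpre : IsPreconnected ((fun t : ℝ => x + t • u) '' Ici 0) :=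
    isPreconnected_Ici.image _ (by fun_prop)
  have hsub : (fun t : ℝ => x + t • u) '' Ici 0 ⊆ connectedComponentIn (P.boundary ℝ)ᶜ x := by
    refine hpre.subset_connectedComponentIn ⟨0, by simp, by simp⟩ ?_
    rintro _ ⟨t, ht, rfl⟩
    exact h t ht
  obtain ⟨R, hR⟩ := (hb.subset hsub).subset_closedBall x
  have hu' : 0 < ‖u‖ := norm_pos_iff.2 hu
  have := hR ⟨(|R| + 1) / ‖u‖, by simp only [mem_Ici]; positivity, rfl⟩
  rw [Metric.mem_closedBall, dist_eq_norm, add_sub_cancel_left, norm_smul,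
    Real.norm_of_nonneg (by positivity), div_mul_cancel₀ _ hu'.ne'] at this
  linarith [le_abs_self R]

lemma isCompact_polygonRegion : IsCompact (polygonRegion P) := by
  refine Metric.isCompact_of_isClosed_isBounded isClosed_polygonRegion ?_
  obtain ⟨R, hR⟩ := (isCompact_boundary (P := P)).isBounded.subset_closedBall (0 : Plane)
  refine (Metric.isBounded_closedBall (x := (0 : Plane)) (r := |R|)).subset fun x hx => ?_
  by_contra hxR
  rw [mem_closedBall_zero_iff, not_le] at hxR
  have hx0 : x ≠ 0 := by
    rintro rfl
    rw [norm_zero] at hxR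
    linarith [abs_nonneg R]
  refine not_mem_polygonRegion_of_ray hx0 (fun t ht hb => ?_) hx
  have h1 := mem_closedBall_zero_iff.1 (hR hb)
  rw [show x + t • x = (1 + t) • x by rw [add_smul, one_smul], norm_smul,
    Real.norm_of_nonneg (by linarith)] at h1
  nlinarith [norm_nonneg x, le_abs_self R]

lemma boundary_subset_polygonRegion : P.boundary ℝ ⊆ polygonRegion P := subset_union_left

/-- Seen from outside, the nearest points of the region lie on its boundary curve. -/
lemma ball_disjoint_polygonRegion {x : Plane} (hx : x ∉ polygonRegion P) {r : ℝ} (hr : 0 < r)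
    (h : ∀ p ∈ P.boundary ℝ, r ≤ dist x p) : Disjoint (Metric.ball x r) (polygonRegion P) := by
  refine disjoint_polygonRegion (convex_ball x r).isPreconnected ?_ (Metric.mem_ball_self hr) hx
  rw [Set.disjoint_left]
  intro p hp hpb
  have := h p hpb
  rw [Metric.mem_ball, dist_comm] at hp
  linarith

lemma coe_finRotate_eq (i : Fin n) : (finRotate n i : ℕ) = (i + 1) % n := by
  obtain ⟨m, rfl⟩ : ∃ m, n = m + 1 := ⟨n - 1, by have := i.2; omega⟩
  rw [finRotate_apply, Fin.val_add, Fin.val_one']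
  simp [Nat.add_mod]

end Polygon

/-- Identification of the plane with `ℂ`. -/
noncomputable def toComplex : Plane ≃ₗᵢ[ℝ] ℂ := Complex.orthonormalBasisOneI.repr.symm

/-- Two disjoint chords in the exterior of a simple polygon do not have interleaved endpoints. -/
theorem IsSimplePolygon.chords_not_interleaved {n : ℕ} {P : Polygon Plane n}
    (hP : IsSimplePolygon P) {i j k l : Fin n} (hik : i < k) (hkj : k < j) (hjl : j < l)
    {a b c d : Plane} (ha : a ∈ halfEdge P i) (hb : b ∈ halfEdge P j) (hc : c ∈ halfEdge P k)
    (hd : d ∈ halfEdge P l) (hab : Disjoint (openSegment ℝ a b) (polygonRegion P))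
    (hcd : Disjoint (openSegment ℝ c d) (polygonRegion P))
    (hdis : Disjoint (openSegment ℝ a b) (openSegment ℝ c d)) : False := by
  have hn : 0 < n := by have := hP.1; omega
  set v : ℕ → ℂ := fun m => toComplex (P ⟨m % n, Nat.mod_lt _ hn⟩) with hv
  have hG : ∀ (m : Fin n) (t : ℝ), t ∈ Icc (0 : ℝ) 1 →
      plMap v (2 * n) (m + t) = toComplex (P.edgePath ℝ m t) := by
    intro m t ht
    rw [plMap_eq_lineMap v (k := m) (by have := m.2; omega) (by linarith [ht.1])
      (by linarith [ht.2]), add_sub_cancel_left]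
    have e1 : v m = toComplex (P m) := by
      simp only [hv]
      congr 2
      exact Fin.ext (Nat.mod_eq_of_lt m.2)
    have e2 : v (m + 1) = toComplex (P (finRotate n m)) := by
      simp only [hv]
      congr 2
      exact Fin.ext (coe_finRotate_eq m).symm
    rw [e1, e2, Polygon.edgePath, AffineMap.lineMap_apply, AffineMap.lineMap_apply]
    simp
  have hfl : ∀ s ∈ Ico (0 : ℝ) n, ∃ m : Fin n, ∃ t ∈ Ico (0 : ℝ) 1, s = m + t := by
    intro s hs
    refine ⟨⟨⌊s⌋₊, (Nat.floor_lt hs.1).2 hs.2⟩, s - ⌊s⌋₊, ⟨?_, ?_⟩, by simp⟩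
    · linarith [Nat.floor_le hs.1]
    · linarith [Nat.lt_floor_add_one s]
  have hinj : InjOn (plMap v (2 * n)) (Ico 0 (n : ℝ)) := by
    intro s hs s' hs' h
    obtain ⟨m, t, ht, rfl⟩ := hfl s hs
    obtain ⟨m', t', ht', rfl⟩ := hfl s' hs'
    rw [hG m t ⟨ht.1, ht.2.le⟩, hG m' t' ⟨ht'.1, ht'.2.le⟩] at h
    have h1 := toComplex.injective h
    have h2 : m = m' := hP.eq_of_mem_halfEdge ⟨t, ht, rfl⟩ ⟨t', ht', h1.symm⟩
    subst h2
    have h3 := AffineMap.lineMap_injective ℝ (hP.2.1 m) h1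
    rw [h3]
  have hΓ : plMap v (2 * n) '' Icc 0 n ⊆ toComplex '' P.boundary ℝ := by
    rintro _ ⟨s, hs, rfl⟩
    rcases hs.2.lt_or_eq with h | h
    · obtain ⟨m, t, ht, rfl⟩ := hfl s ⟨hs.1, h⟩
      rw [hG m t ⟨ht.1, ht.2.le⟩]
      exact ⟨_, halfEdge_subset_boundary m ⟨t, ht, rfl⟩, rfl⟩
    · refine ⟨P ⟨0, hn⟩, halfEdge_subset_boundary ⟨0, hn⟩ (vertex_mem_halfEdge _), ?_⟩
      rw [h, plMap_natCast v (by omega)]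
      simp only [hv]
      congr 2
      exact Fin.ext (Nat.mod_self n).symm
  have hchord : ∀ {x y : Plane} {s t : ℝ}, toComplex x = plMap v (2 * n) s →
      toComplex y = plMap v (2 * n) t → Disjoint (openSegment ℝ x y) (polygonRegion P) →
      ∀ p ∈ openSegment ℝ (plMap v (2 * n) s) (plMap v (2 * n) t), ∃ U : Set ℂ,
        IsPreconnected U ∧ ¬ Bornology.IsBounded U ∧ p ∈ U ∧
          Disjoint U (plMap v (2 * n) '' Icc 0 n) := by
    intro x y s t hx hy hxy p hp
    have him := image_openSegment ℝ toComplex.toLinearEquiv.toLinearMap.toAffineMap x y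
    rw [← hx, ← hy] at hp
    have hp' : p ∈ toComplex '' openSegment ℝ x y := by
      have h2 : (toComplex.toLinearEquiv.toLinearMap.toAffineMap : Plane → ℂ) = toComplex := rfl
      rw [h2] at him
      rwa [him]
    obtain ⟨q, hq, rfl⟩ := hp'
    have hqn := not_mem_polygonRegion.1 (Set.disjoint_left.1 hxy hq)
    refine ⟨toComplex '' connectedComponentIn (P.boundary ℝ)ᶜ q,
      isPreconnected_connectedComponentIn.image _ toComplex.continuous.continuousOn, ?_,
      ⟨q, mem_connectedComponentIn hqn.1, rfl⟩, ?_⟩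
    · intro hbd
      refine hqn.2 ?_
      obtain ⟨R, hR⟩ := hbd.subset_closedBall (toComplex q)
      refine (Metric.isBounded_closedBall (x := q) (r := R)).subset fun z hz => ?_
      have := hR ⟨z, hz, rfl⟩
      rwa [Metric.mem_closedBall, toComplex.dist_map] at this
    · rw [Set.disjoint_left]
      rintro _ ⟨z, hz, rfl⟩ hz'
      obtain ⟨z', hz'', h⟩ := hΓ hz'
      have := toComplex.injective h
      subst this
      exact connectedComponentIn_subset _ _ hz hz''
  obtain ⟨ta, hta, rfl⟩ := ha
  obtain ⟨tb, htb, rfl⟩ := hb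
  obtain ⟨tc, htc, rfl⟩ := hc
  obtain ⟨td, htd, rfl⟩ := hd
  have ea := (hG i ta ⟨hta.1, hta.2.le⟩).symm
  have eb := (hG j tb ⟨htb.1, htb.2.le⟩).symm
  have ec := (hG k tc ⟨htc.1, htc.2.le⟩).symm
  have ed := (hG l td ⟨htd.1, htd.2.le⟩).symm
  have hlt : ∀ {m m' : Fin n} {t t' : ℝ}, m < m' → t ∈ Ico (0 : ℝ) 1 → t' ∈ Ico (0 : ℝ) 1 →
      (m : ℝ) + t < m' + t' := by
    intro m m' t t' h ht ht'
    have : (m : ℝ) + 1 ≤ m' := by exact_mod_cast h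
    linarith [ht.2, ht'.1]
  refine _root_.chords_not_interleaved (v := v) (n := n) (fun m => ?_) hinj
    (sa := i + ta) (sb := j + tb) (sc := k + tc) (sd := l + td)
    (by have := hta.1; positivity) (hlt hik hta htc) (hlt hkj htc htb) (hlt hjl htb htd) ?_
    (hchord ea eb hab) (hchord ec ed hcd) ?_
  · simp [hv]
  · have : (l : ℝ) + 1 ≤ n := by exact_mod_cast l.2
    linarith [htd.2]
  · have h2 : (toComplex.toLinearEquiv.toLinearMap.toAffineMap : Plane → ℂ) = toComplex := rfl
    have h3 := image_openSegment ℝ toComplex.toLinearEquiv.toLinearMap.toAffineMap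
    rw [h2] at h3
    rw [← ea, ← eb, ← ec, ← ed, ← h3, ← h3]
    exact (disjoint_image_iff toComplex.injective).2 hdis

/-! ### Coordinates along an edge -/

section EdgeCoordinates

variable (p q : Plane)

/-- The squared length of an edge. -/
noncomputable def sqLen : ℝ := (q 0 - p 0) ^ 2 + (q 1 - p 1) ^ 2

/-- The first coordinate of the unit normal of an edge. -/
noncomputable def normal0 : ℝ := -(q 1 - p 1) / √(sqLen p q)

/-- The second coordinate of the unit normal of an edge. -/
noncomputable def normal1 : ℝ := (q 0 - p 0) / √(sqLen p q)

/-- The coordinate along the line through `p` and `q`, with values `0` at `p` and `1` at `q`. -/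
noncomputable def alongCoord (y : Plane) : ℝ :=
  ((y 0 - p 0) * (q 0 - p 0) + (y 1 - p 1) * (q 1 - p 1)) / sqLen p q

/-- The signed distance to the line through `p` and `q`. -/
noncomputable def offCoord (y : Plane) : ℝ :=
  normal0 p q * (y 0 - p 0) + normal1 p q * (y 1 - p 1)

/-- The point with given coordinates along and off the line through `p` and `q`. -/
noncomputable def offsetPoint (t c : ℝ) : Plane :=
  !₂[p 0 + t * (q 0 - p 0) + c * normal0 p q, p 1 + t * (q 1 - p 1) + c * normal1 p q]

@[simp] lemma offsetPoint_zero (t c : ℝ) :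
    offsetPoint p q t c 0 = p 0 + t * (q 0 - p 0) + c * normal0 p q := rfl

@[simp] lemma offsetPoint_one (t c : ℝ) :
    offsetPoint p q t c 1 = p 1 + t * (q 1 - p 1) + c * normal1 p q := rfl

lemma continuous_alongCoord : Continuous (alongCoord p q) := by
  unfold alongCoord
  fun_prop

lemma continuous_offCoord : Continuous (offCoord p q) := by
  unfold offCoord
  fun_prop

lemma continuous_offsetPoint (t : ℝ) : Continuous (offsetPoint p q t) := by
  unfold offsetPoint
  refine (PiLp.continuous_toLp 2 _).comp (continuous_pi fun i => ?_)
  fin_cases i <;> simp <;> fun_prop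

lemma lineMap_coord_zero (t : ℝ) :
    (AffineMap.lineMap p q t : Plane) 0 = p 0 + t * (q 0 - p 0) := by
  simp [AffineMap.lineMap_apply]
  ring

lemma lineMap_coord_one (t : ℝ) :
    (AffineMap.lineMap p q t : Plane) 1 = p 1 + t * (q 1 - p 1) := by
  simp [AffineMap.lineMap_apply]
  ring

lemma lineMap_offsetPoint (c t : ℝ) :
    AffineMap.lineMap (offsetPoint p q 0 c) (offsetPoint p q 1 c) t = offsetPoint p q t c := by
  rw [Plane.ext_iff', lineMap_coord_zero, lineMap_coord_one]
  simp only [offsetPoint_zero, offsetPoint_one]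
  constructor <;> ring

variable {p q}

lemma sqLen_pos (h : p ≠ q) : 0 < sqLen p q := by
  unfold sqLen
  by_contra! hle
  refine h (Plane.ext_iff'.2 ⟨?_, ?_⟩)
  · nlinarith [sq_nonneg (q 0 - p 0), sq_nonneg (q 1 - p 1)]
  · nlinarith [sq_nonneg (q 0 - p 0), sq_nonneg (q 1 - p 1)]

lemma normal_sq (h : p ≠ q) : normal0 p q ^ 2 + normal1 p q ^ 2 = 1 := by
  have h1 := sqLen_pos h
  rw [normal0, normal1, div_pow, div_pow, Real.sq_sqrt h1.le]
  field_simp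
  unfold sqLen
  ring

lemma normal_orth : normal0 p q * (q 0 - p 0) + normal1 p q * (q 1 - p 1) = 0 := by
  unfold normal0 normal1
  ring

lemma normal_ne (h : p ≠ q) : normal0 p q ≠ 0 ∨ normal1 p q ≠ 0 := by
  by_contra! h0
  have := normal_sq h
  rw [h0.1, h0.2] at this
  norm_num at this

lemma offsetPoint_coords (h : p ≠ q) (y : Plane) :
    offsetPoint p q (alongCoord p q y) (offCoord p q y) = y := by
  have h1 := sqLen_pos h
  have h2 : √(sqLen p q) ^ 2 = sqLen p q := Real.sq_sqrt h1.le
  have h3 : 0 < √(sqLen p q) := Real.sqrt_pos.2 h1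
  rw [Plane.ext_iff', offsetPoint_zero, offsetPoint_one]
  simp only [alongCoord, offCoord, normal0, normal1]
  constructor
  · field_simp
    rw [h2]
    unfold sqLen
    ring
  · field_simp
    rw [h2]
    unfold sqLen
    ring

lemma alongCoord_offsetPoint (h : p ≠ q) (t c : ℝ) : alongCoord p q (offsetPoint p q t c) = t := by
  have h1 := sqLen_pos h
  rw [alongCoord, offsetPoint_zero, offsetPoint_one, div_eq_iff h1.ne']
  unfold sqLen
  linear_combination c * normal_orth (p := p) (q := q)

lemma offCoord_offsetPoint (h : p ≠ q) (t c : ℝ) : offCoord p q (offsetPoint p q t c) = c := by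
  rw [offCoord, offsetPoint_zero, offsetPoint_one]
  linear_combination t * normal_orth (p := p) (q := q) + c * normal_sq h

lemma dist_sq_lineMap (h : p ≠ q) (y : Plane) (u : ℝ) :
    dist y (AffineMap.lineMap p q u) ^ 2 =
      (alongCoord p q y - u) ^ 2 * sqLen p q + offCoord p q y ^ 2 := by
  conv_lhs => rw [← offsetPoint_coords h y]
  rw [Plane.dist_sq, lineMap_coord_zero, lineMap_coord_one, offsetPoint_zero, offsetPoint_one]
  unfold sqLen
  linear_combination (2 * (alongCoord p q y - u) * offCoord p q y) *
    normal_orth (p := p) (q := q) + offCoord p q y ^ 2 * normal_sq h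

lemma abs_offCoord_le_dist (h : p ≠ q) (y : Plane) (u : ℝ) :
    |offCoord p q y| ≤ dist y (AffineMap.lineMap p q u) := by
  refine abs_le_of_sq_le_sq ?_ dist_nonneg
  rw [dist_sq_lineMap h]
  nlinarith [mul_nonneg (sq_nonneg (alongCoord p q y - u)) (sqLen_pos h).le]

lemma dist_lineMap_alongCoord (h : p ≠ q) (y : Plane) :
    dist y (AffineMap.lineMap p q (alongCoord p q y)) = |offCoord p q y| := by
  rw [← pow_left_inj₀ dist_nonneg (abs_nonneg _) two_ne_zero, dist_sq_lineMap h, sq_abs]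
  ring

/-- If `lineMap p q u` is a nearest point of the segment from `p` to `q` then moving from `u`
towards the foot of the perpendicular leaves the segment. -/
lemma alongCoord_of_nearest (h : p ≠ q) {y : Plane} {u r : ℝ} (hu : u ∈ Icc (0 : ℝ) 1)
    (hd : dist y (AffineMap.lineMap p q u) = r)
    (hmin : ∀ w ∈ Icc (0 : ℝ) 1, r ≤ dist y (AffineMap.lineMap p q w)) :
    (alongCoord p q y ≤ u ∨ u = 1) ∧ (u ≤ alongCoord p q y ∨ u = 0) := by
  have hpos := sqLen_pos h
  have key : ∀ w ∈ Icc (0 : ℝ) 1, (alongCoord p q y - u) ^ 2 ≤ (alongCoord p q y - w) ^ 2 := by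
    intro w hw
    have h1 := hmin w hw
    rw [← hd, ← pow_le_pow_iff_left₀ dist_nonneg dist_nonneg two_ne_zero, dist_sq_lineMap h,
      dist_sq_lineMap h] at h1
    nlinarith
  set s := alongCoord p q y
  constructor
  · by_contra! hc
    have h1 : u < 1 := lt_of_le_of_ne hu.2 hc.2
    have := key (min s 1) ⟨le_min (hu.1.trans hc.1.le) zero_le_one, min_le_right _ _⟩
    rcases min_cases s 1 with ⟨h2, h3⟩ | ⟨h2, h3⟩ <;> rw [h2] at this <;> nlinarith [hc.1]
  · by_contra! hc
    have h1 : 0 < u := lt_of_le_of_ne hu.1 (Ne.symm hc.2)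
    have := key (max s 0) ⟨le_max_right _ _, max_le (hc.1.le.trans hu.2) zero_le_one⟩
    rcases max_cases s 0 with ⟨h2, h3⟩ | ⟨h2, h3⟩ <;> rw [h2] at this <;> nlinarith [hc.1]

lemma nearest_unique (h : p ≠ q) {y : Plane} {u w r : ℝ} (hu : u ∈ Icc (0 : ℝ) 1)
    (hw : w ∈ Icc (0 : ℝ) 1) (hdu : dist y (AffineMap.lineMap p q u) = r)
    (hdw : dist y (AffineMap.lineMap p q w) = r)
    (hmin : ∀ w ∈ Icc (0 : ℝ) 1, r ≤ dist y (AffineMap.lineMap p q w)) : u = w := by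
  obtain ⟨h1, h2⟩ := alongCoord_of_nearest h hu hdu hmin
  obtain ⟨h3, h4⟩ := alongCoord_of_nearest h hw hdw hmin
  have hpos := sqLen_pos h
  have h5 : (alongCoord p q y - u) ^ 2 = (alongCoord p q y - w) ^ 2 := by
    have := congrArg (· ^ 2) (hdu.trans hdw.symm)
    simp only [dist_sq_lineMap h] at this
    have h6 : ((alongCoord p q y - u) ^ 2 - (alongCoord p q y - w) ^ 2) * sqLen p q = 0 := by
      linear_combination this
    have := (mul_eq_zero.1 h6).resolve_right hpos.ne'
    linarith
  have h6 := hmin ((u + w) / 2) ⟨by linarith [hu.1, hw.1], by linarith [hu.2, hw.2]⟩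
  rw [← hdu, ← pow_le_pow_iff_left₀ dist_nonneg dist_nonneg two_ne_zero, dist_sq_lineMap h,
    dist_sq_lineMap h] at h6
  have h7 : (alongCoord p q y - u) ^ 2 ≤ (alongCoord p q y - (u + w) / 2) ^ 2 := by nlinarith
  nlinarith [sq_nonneg (u - w)]

end EdgeCoordinates

/-! ### The offset curve of a polygon -/

section Offset

variable {n : ℕ} {P : Polygon Plane n} {r : ℝ}

/-- Seen from outside the polygon region, only the boundary curve matters for the dilation. -/
lemma mem_dilate_iff_of_not_mem {y : Plane} (hy : y ∉ polygonRegion P) (hr : 0 < r) :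
    y ∈ dilate (polygonRegion P) r ↔ ∃ p ∈ P.boundary ℝ, dist y p ≤ r := by
  rw [mem_dilate]
  constructor
  · rintro ⟨a, ha, hd⟩
    by_contra! hc
    have hne : (P.boundary ℝ).Nonempty := by
      by_contra hne
      rw [not_nonempty_iff_eq_empty] at hne
      have hb := ball_disjoint_polygonRegion hy (r := dist y a + 1)
        (by linarith [dist_nonneg (x := y) (y := a)]) (by simp [hne])
      exact Set.disjoint_left.1 hb (Metric.mem_ball'.2 (by linarith)) ha
    obtain ⟨p, hp, hmin⟩ := (isCompact_boundary (P := P)).exists_isMinOn hne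
      (f := fun p => dist y p) (by fun_prop)
    have hb := ball_disjoint_polygonRegion hy (hr.trans (hc p hp)) fun q hq => hmin hq
    exact Set.disjoint_left.1 hb (Metric.mem_ball'.2 (hd.trans_lt (hc p hp))) ha
  · rintro ⟨p, hp, hd⟩
    exact ⟨p, boundary_subset_polygonRegion hp, hd⟩

/-- The points of the boundary curve at distance `r` from `x`. -/
def nearPts (P : Polygon Plane n) (r : ℝ) (x : Plane) : Set Plane :=
  {p | p ∈ P.boundary ℝ ∧ dist x p = r}

/-- Points on the frontier of the dilation are exactly at distance `r` from the region and from its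
boundary curve. -/
lemma frontier_dilate_spec (hr : 0 < r) {x : Plane}
    (hx : x ∈ frontier (dilate (polygonRegion P) r)) :
    x ∉ polygonRegion P ∧ Disjoint (Metric.ball x r) (polygonRegion P) ∧
      (∀ p ∈ P.boundary ℝ, r ≤ dist x p) ∧ (nearPts P r x).Nonempty := by
  have hcl := (isCompact_dilate (isCompact_polygonRegion (P := P)) r).isClosed
  rw [hcl.frontier_eq] at hx
  have h1 : ∀ a ∈ polygonRegion P, r ≤ dist x a := by
    intro a ha
    by_contra! hlt
    refine hx.2 (mem_interior.2 ⟨Metric.ball a r, fun y hy => ?_, Metric.isOpen_ball, hlt⟩)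
    exact mem_dilate.2 ⟨a, ha, (Metric.mem_ball.1 hy).le⟩
  have h2 : x ∉ polygonRegion P := fun h => by
    have := h1 x h
    rw [dist_self] at this
    linarith
  have h3 : ∀ p ∈ P.boundary ℝ, r ≤ dist x p := fun p hp => h1 p (boundary_subset_polygonRegion hp)
  refine ⟨h2, ?_, h3, ?_⟩
  · rw [Set.disjoint_left]
    intro y hy hyA
    rw [Metric.mem_ball'] at hy
    linarith [h1 y hyA]
  · obtain ⟨p, hp, hd⟩ := (mem_dilate_iff_of_not_mem h2 hr).1 hx.1
    exact ⟨p, hp, le_antisymm hd (h3 p hp)⟩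

/-- Near a frontier point with a single nearest point, only the edges through the nearest point
matter for the dilation. -/
lemma eventually_mem_dilate_iff (hr : 0 < r) {x a : Plane}
    (hx : x ∈ frontier (dilate (polygonRegion P) r)) (ha : nearPts P r x = {a}) :
    ∀ᶠ y in 𝓝 x, y ∈ dilate (polygonRegion P) r ↔
      ∃ j, a ∈ P.edgeSet ℝ j ∧ ∃ p ∈ P.edgeSet ℝ j, dist y p ≤ r := by
  obtain ⟨hxA, -, hmin, -⟩ := frontier_dilate_spec hr hx
  have h1 : ∀ j, a ∉ P.edgeSet ℝ j → ∀ᶠ y in 𝓝 x, ¬ ∃ p ∈ P.edgeSet ℝ j, dist y p ≤ r := by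
    intro j hj
    have h2 : x ∉ dilate (P.edgeSet ℝ j) r := by
      rw [mem_dilate]
      rintro ⟨p, hp, hd⟩
      have hpb := edgeSet_subset_boundary j hp
      have : p ∈ nearPts P r x := ⟨hpb, le_antisymm hd (hmin p hpb)⟩
      rw [ha, mem_singleton_iff] at this
      exact hj (this ▸ hp)
    filter_upwards [(isCompact_dilate (isCompact_edgeSet j) r).isClosed.isOpen_compl.mem_nhds h2]
      with y hy
    rwa [mem_compl_iff, mem_dilate] at hy
  have h3 : ∀ᶠ y in 𝓝 x, ∀ j, a ∉ P.edgeSet ℝ j → ¬ ∃ p ∈ P.edgeSet ℝ j, dist y p ≤ r := by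
    rw [eventually_all]
    intro j
    by_cases hj : a ∈ P.edgeSet ℝ j
    · simp [hj]
    · filter_upwards [h1 j hj] with y hy _ using hy
  filter_upwards [h3, isClosed_polygonRegion.isOpen_compl.mem_nhds hxA] with y hy hyA
  rw [mem_dilate_iff_of_not_mem hyA hr]
  constructor
  · rintro ⟨p, hp, hd⟩
    obtain ⟨j, hj⟩ := mem_iUnion.1 hp
    exact ⟨j, by_contra fun h => hy j h ⟨p, hj, hd⟩, p, hj, hd⟩
  · rintro ⟨j, -, p, hp, hd⟩
    exact ⟨p, edgeSet_subset_boundary j hp, hd⟩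

/-- The curves that carry the frontier of the dilation: around each vertex a circle (index `0`),
and on either side of each edge a parallel segment (indices `1` and `2`). -/
noncomputable def offsetCurve (P : Polygon Plane n) (r : ℝ) (f : Fin n × Fin 3) : ℝ → Plane :=
  match f.2 with
  | 0 => circlePoint (P f.1) r
  | 1 => fun t => offsetPoint (P f.1) (P (finRotate n f.1)) t r
  | 2 => fun t => offsetPoint (P f.1) (P (finRotate n f.1)) t (-r)

/-- The right end of the parameter interval of an offset curve; the left end is `0`. -/
noncomputable def offsetEnd (f : Fin n × Fin 3) : ℝ := if f.2 = 0 then 2 * Real.pi else 1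

/-- The set traced by an offset curve. -/
noncomputable def offsetSet (P : Polygon Plane n) (r : ℝ) (f : Fin n × Fin 3) : Set Plane :=
  offsetCurve P r f '' Ioo 0 (offsetEnd f)

lemma isCurve_offsetCurve (hP : IsSimplePolygon P) (hr : 0 < r) (f : Fin n × Fin 3) :
    IsCurve (offsetCurve P r f) 0 (offsetEnd f) := by
  obtain ⟨i, κ⟩ := f
  have key : ∀ c, IsCurve (fun t => offsetPoint (P i) (P (finRotate n i)) t c) 0 1 := by
    intro c
    have hne : offsetPoint (P i) (P (finRotate n i)) 0 c ≠
        offsetPoint (P i) (P (finRotate n i)) 1 c := by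
      intro h
      have := congrArg (alongCoord (P i) (P (finRotate n i))) h
      rw [alongCoord_offsetPoint (hP.2.1 i), alongCoord_offsetPoint (hP.2.1 i)] at this
      norm_num at this
    have := isCurve_lineMap hne
    simpa only [lineMap_offsetPoint] using this
  have hpi : (0 : ℝ) < 2 * Real.pi := by positivity
  fin_cases κ
  · change IsCurve (circlePoint (P i) r) 0 (offsetEnd (i, 0))
    rw [offsetEnd, if_pos rfl]
    exact isCurve_circlePoint hr hpi (by simp)
  · change IsCurve _ 0 (offsetEnd (i, 1))
    rw [offsetEnd, if_neg (show ¬((1 : Fin 3) = 0) by decide)]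
    exact key r
  · change IsCurve _ 0 (offsetEnd (i, 2))
    rw [offsetEnd, if_neg (show ¬((2 : Fin 3) = 0) by decide)]
    exact key (-r)

/-- Two points of a half-open edge cannot both be nearest points. -/
lemma eq_of_mem_nearPts (hP : IsSimplePolygon P) {x a b : Plane}
    (hmin : ∀ p ∈ P.boundary ℝ, r ≤ dist x p) {i : Fin n} (ha : a ∈ halfEdge P i)
    (hb : b ∈ halfEdge P i) (hda : dist x a = r) (hdb : dist x b = r) : a = b := by
  obtain ⟨u, hu, rfl⟩ := ha
  obtain ⟨w, hw, rfl⟩ := hb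
  rw [nearest_unique (hP.2.1 i) ⟨hu.1, hu.2.le⟩ ⟨hw.1, hw.2.le⟩ hda hdb fun w hw =>
    hmin _ (edgeSet_subset_boundary i ⟨w, hw, rfl⟩)]

/-- The position of a point relative to a nearest point: on the circle around a vertex, or
perpendicularly above an inner point of an edge. -/
lemma exists_offset_of_nearest (hP : IsSimplePolygon P) {x a : Plane}
    (hmin : ∀ p ∈ P.boundary ℝ, r ≤ dist x p) {i : Fin n} (ha : a ∈ halfEdge P i)
    (hd : dist x a = r) : a = P i ∨ ∃ t ∈ Ioo (0 : ℝ) 1, a = P.edgePath ℝ i t ∧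
      (x = offsetPoint (P i) (P (finRotate n i)) t r ∨
        x = offsetPoint (P i) (P (finRotate n i)) t (-r)) := by
  obtain ⟨t, ht, rfl⟩ := ha
  have hne := hP.2.1 i
  rcases ht.1.lt_or_eq with h0 | h0
  · right
    refine ⟨t, ⟨h0, ht.2⟩, rfl, ?_⟩
    obtain ⟨h1, h2⟩ := alongCoord_of_nearest hne ⟨ht.1, ht.2.le⟩ hd fun w hw =>
      hmin _ (edgeSet_subset_boundary i ⟨w, hw, rfl⟩)
    have hs : alongCoord (P i) (P (finRotate n i)) x = t :=
      le_antisymm (h1.resolve_right ht.2.ne) (h2.resolve_right h0.ne')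
    have h3 := dist_lineMap_alongCoord hne x
    rw [hs] at h3
    have h4 : |offCoord (P i) (P (finRotate n i)) x| = r := by
      rw [← h3]
      exact hd
    have h5 := offsetPoint_coords hne x
    rw [hs] at h5
    have hr : 0 ≤ r := h4 ▸ abs_nonneg _
    rcases (abs_eq hr).1 h4 with h | h
    · left
      rw [← h, h5]
    · right
      rw [← h, h5]
  · left
    simp [← h0, Polygon.edgePath]

/-- An edge whose first endpoint `p` is strictly nearer than its other points: near `y` the edge is
within reach exactly if this endpoint is. -/
lemma eventually_exists_dist_le_iff {p q : Plane} (h : p ≠ q) {x : Plane}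
    (hx : alongCoord p q x < 0) : ∀ᶠ y in 𝓝 x,
      (∃ z ∈ segment ℝ p q, dist y z ≤ r) ↔ dist y p ≤ r := by
  filter_upwards [(continuous_alongCoord p q).continuousAt.eventually (gt_mem_nhds hx)] with y hy
  constructor
  · rintro ⟨z, hz, hd⟩
    rw [segment_eq_image_lineMap] at hz
    obtain ⟨u, hu, rfl⟩ := hz
    refine le_trans ?_ hd
    rw [← pow_le_pow_iff_left₀ dist_nonneg dist_nonneg two_ne_zero, dist_sq_lineMap h]
    have h0 := dist_sq_lineMap h y 0
    rw [AffineMap.lineMap_apply_zero] at h0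
    rw [h0]
    have := sqLen_pos h
    have h1 : (alongCoord p q y - 0) ^ 2 ≤ (alongCoord p q y - u) ^ 2 := by nlinarith [hu.1]
    nlinarith
  · exact fun hd => ⟨p, left_mem_segment ℝ p q, hd⟩

/-- A frontier point that is a common nearest position for two edges on the same line offset is
impossible: the edges would be opposite sides of a corridor of width `2 * r`, which is covered by
the dilation. -/
lemma not_mem_frontier_of_corridor (hP : IsSimplePolygon P) (hr : 0 < r)
    {i j : Fin n} (hij : i ≠ j) {t t' c c' : ℝ} (ht : t ∈ Ioo (0 : ℝ) 1) (ht' : t' ∈ Ioo (0 : ℝ) 1)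
    (hc : |c| = r) (hc' : |c'| = r) {x y : Plane} (hxy : x ≠ y)
    (hx : x = offsetPoint (P i) (P (finRotate n i)) t c)
    (hx' : x = offsetPoint (P j) (P (finRotate n j)) t' c')
    (hy : offCoord (P i) (P (finRotate n i)) y = c)
    (hy' : offCoord (P j) (P (finRotate n j)) y = c') :
    x ∉ frontier (dilate (polygonRegion P) r) := by
  have hni := hP.2.1 i
  have hnj := hP.2.1 j
  set p := P i
  set q := P (finRotate n i)
  set p' := P j
  set q' := P (finRotate n j)
  set u := normal0 p q
  set v := normal1 p q
  set u' := normal0 p' q'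
  set v' := normal1 p' q'
  have hu : u ^ 2 + v ^ 2 = 1 := normal_sq hni
  have hu' : u' ^ 2 + v' ^ 2 = 1 := normal_sq hnj
  have hoi : ∀ z, offCoord p q z = u * (z 0 - p 0) + v * (z 1 - p 1) := fun z => rfl
  have hoj : ∀ z, offCoord p' q' z = u' * (z 0 - p' 0) + v' * (z 1 - p' 1) := fun z => rfl
  have hxc : offCoord p q x = c := by rw [hx, offCoord_offsetPoint hni]
  have hxc' : offCoord p' q' x = c' := by rw [hx', offCoord_offsetPoint hnj]
  -- the unit normals of the two edges are parallel
  have hpar : u' * v = v' * u := by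
    obtain ⟨s, h0, h1⟩ := exists_smul_of_mem_line (normal_ne hni) (x := x) (y := y)
      (k := c + u * p 0 + v * p 1) (by rw [hoi] at hxc; linear_combination hxc)
      (by rw [hoi] at hy; linear_combination hy)
    have hs : s ≠ 0 := by
      rintro rfl
      exact hxy (Plane.ext_iff'.2 ⟨by rw [h0]; ring, by rw [h1]; ring⟩)
    rw [hoj] at hxc' hy'
    have : s * (u' * v - v' * u) = 0 := by
      rw [h0, h1] at hy'
      linear_combination hxc' - hy'
    linarith [(mul_eq_zero.1 this).resolve_left hs]
  set ν := u * u' + v * v' with hν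
  have hu1 : u' = ν * u := by rw [hν]; linear_combination -u' * hu + v * hpar
  have hv1 : v' = ν * v := by rw [hν]; linear_combination -v' * hu - u * hpar
  have hν2 : ν ^ 2 = 1 := by
    rw [hu1, hv1] at hu'
    linear_combination hu' - ν ^ 2 * hu
  have hfun : ∀ z, offCoord p' q' z = c' + ν * (offCoord p q z - c) := by
    intro z
    rw [← hxc, ← hxc', hoi, hoi, hoj, hoj, hu1, hv1]
    ring
  -- the two feet are different, so the edges lie on different sides
  have hcc : c' = -(ν * c) := by
    have h1 : c' ^ 2 = (ν * c) ^ 2 := by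
      rw [mul_pow, hν2, one_mul, ← sq_abs c', ← sq_abs c, hc, hc']
    rcases sq_eq_sq_iff_eq_or_eq_neg.1 h1 with h | h
    · exfalso
      refine hij (hP.eq_of_mem_halfEdge (p := P.edgePath ℝ i t) ⟨t, ⟨ht.1.le, ht.2⟩, rfl⟩
        ⟨t', ⟨ht'.1.le, ht'.2⟩, ?_⟩)
      have e0 := congrArg (fun z : Plane => z 0) (hx.symm.trans hx')
      have e1 := congrArg (fun z : Plane => z 1) (hx.symm.trans hx')
      simp only [offsetPoint_zero, offsetPoint_one] at e0 e1
      change p 0 + t * (q 0 - p 0) + c * u = p' 0 + t' * (q' 0 - p' 0) + c' * u' at e0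
      change p 1 + t * (q 1 - p 1) + c * v = p' 1 + t' * (q' 1 - p' 1) + c' * v' at e1
      rw [Plane.ext_iff', Polygon.edgePath, Polygon.edgePath, lineMap_coord_zero,
        lineMap_coord_zero, lineMap_coord_one, lineMap_coord_one]
      constructor
      · rw [h, hu1] at e0
        linear_combination -e0 - c * u * hν2
      · rw [h, hv1] at e1
        linear_combination -e1 - c * v * hν2
    · exact h
  have hsx : alongCoord p q x ∈ Ioo (0 : ℝ) 1 := by rwa [hx, alongCoord_offsetPoint hni]
  have hsx' : alongCoord p' q' x ∈ Ioo (0 : ℝ) 1 := by rwa [hx', alongCoord_offsetPoint hnj]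
  intro hfr
  rw [frontier, Set.mem_sdiff] at hfr
  refine hfr.2 (mem_interior_iff_mem_nhds.2 ?_)
  have hclose : ∀ᶠ z in 𝓝 x, |offCoord p q z - c| < r := by
    have h1 : Tendsto (offCoord p q) (𝓝 x) (𝓝 c) := hxc ▸ (continuous_offCoord p q).tendsto x
    simpa [Real.dist_eq] using Metric.tendsto_nhds.1 h1 r hr
  filter_upwards [(continuous_alongCoord p q).continuousAt.eventually (isOpen_Ioo.mem_nhds hsx),
    (continuous_alongCoord p' q').continuousAt.eventually (isOpen_Ioo.mem_nhds hsx'), hclose]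
    with z hz hz' hzc
  have hreach : |offCoord p q z| ≤ r ∨ |offCoord p' q' z| ≤ r := by
    have e2 : |offCoord p' q' z| = |c - (offCoord p q z - c)| := by
      rw [hfun, hcc]
      have : |ν| = 1 := by
        rw [← sq_eq_sq₀ (abs_nonneg _) zero_le_one, sq_abs, hν2]
        norm_num
      rw [show -(ν * c) + ν * (offCoord p q z - c) = -ν * (c - (offCoord p q z - c)) by ring,
        abs_mul, abs_neg, this, one_mul]
    rw [e2]
    set w := offCoord p q z
    rw [abs_lt] at hzc
    rcases (abs_eq hr.le).1 hc with h | h <;> rw [h] at hzc ⊢ <;> rw [abs_le, abs_le]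
    · rcases le_total w r with h' | h'
      · left; constructor <;> linarith
      · right; constructor <;> linarith
    · rcases le_total w (-r) with h' | h'
      · right; constructor <;> linarith
      · left; constructor <;> linarith
  rw [mem_dilate]
  rcases hreach with h | h
  · refine ⟨P.edgePath ℝ i (alongCoord p q z), boundary_subset_polygonRegion
      (halfEdge_subset_boundary i ⟨_, ⟨hz.1.le, hz.2⟩, rfl⟩), ?_⟩
    exact (dist_lineMap_alongCoord hni z).trans_le h
  · refine ⟨P.edgePath ℝ j (alongCoord p' q' z), boundary_subset_polygonRegion
      (halfEdge_subset_boundary j ⟨_, ⟨hz'.1.le, hz'.2⟩, rfl⟩), ?_⟩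
    exact (dist_lineMap_alongCoord hnj z).trans_le h

end Offset

/-! ### Frontier points with several nearest points -/

section Chords

variable {n : ℕ} {P : Polygon Plane n} {r : ℝ}

/-- Twice the signed area of the triangle `a b c`. -/
def orient (a b c : Plane) : ℝ := (b 0 - a 0) * (c 1 - a 1) - (b 1 - a 1) * (c 0 - a 0)

/-- Among the points of a finite set on a circle, each point has a neighbor: all other points lie on
one side of the line through the two. -/
lemma exists_orient_nonneg {x a : Plane} {S : Set Plane} (hS : S.Finite) (hr : 0 < r)
    (hSr : ∀ c ∈ S, dist x c = r) (ha : dist x a = r) (hne : ∃ b ∈ S, b ≠ a) :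
    ∃ b ∈ S, b ≠ a ∧ ∀ c ∈ S, 0 ≤ orient a b c := by
  -- coordinates with origin `a` and axes pointing to the center and along the tangent
  set h : Plane → ℝ := fun c => (c 0 - a 0) * (x 0 - a 0) + (c 1 - a 1) * (x 1 - a 1) with hh
  set k : Plane → ℝ := fun c => (c 1 - a 1) * (x 0 - a 0) - (c 0 - a 0) * (x 1 - a 1) with hk
  rw [Plane.dist_eq_iff hr.le] at ha
  have hpos : ∀ c ∈ S, c ≠ a → 0 < h c := by
    intro c hc hca
    have h1 := hSr c hc
    rw [Plane.dist_eq_iff hr.le] at h1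
    have h2 : 2 * h c = (c 0 - a 0) ^ 2 + (c 1 - a 1) ^ 2 := by
      simp only [hh]
      linear_combination ha - h1
    have h3 : 0 < (c 0 - a 0) ^ 2 + (c 1 - a 1) ^ 2 := by
      by_contra! hle
      refine hca (Plane.ext_iff'.2 ⟨?_, ?_⟩) <;>
        nlinarith [sq_nonneg (c 0 - a 0), sq_nonneg (c 1 - a 1)]
    linarith
  have horient : ∀ b c, r ^ 2 * orient a b c = h b * k c - k b * h c := by
    intro b c
    simp only [hh, hk, orient]
    rw [← ha]
    ring
  have hfin : (S \ {a}).Finite := hS.subset sdiff_subset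
  obtain ⟨b₀, hb₀, hb₀a⟩ := hne
  obtain ⟨b, hb, hmin⟩ := hfin.exists_minimalFor (fun c => k c / h c) _ ⟨b₀, hb₀, hb₀a⟩
  refine ⟨b, hb.1, hb.2, fun c hc => ?_⟩
  have hr2 : 0 < r ^ 2 := by positivity
  by_cases hca : c = a
  · simp [orient, hca]
  have h1 := hpos b hb.1 hb.2
  have h2 := hpos c hc hca
  have h3 : k b / h b ≤ k c / h c := by
    rcases le_total (k b / h b) (k c / h c) with h | h
    · exact h
    · exact hmin ⟨hc, hca⟩ h
  rw [div_le_div_iff₀ h1 h2] at h3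
  have h4 := horient b c
  by_contra! hneg
  nlinarith

/-- The edges `i` and `j` carry two neighboring nearest points of `x`. -/
def IsNeighborPair (P : Polygon Plane n) (r : ℝ) (x : Plane) (i j : Fin n) : Prop :=
  i ≠ j ∧ ∃ a ∈ halfEdge P i, ∃ b ∈ halfEdge P j, dist x a = r ∧ dist x b = r ∧
    ((∀ c ∈ nearPts P r x, 0 ≤ orient a b c) ∨ ∀ c ∈ nearPts P r x, orient a b c ≤ 0)

lemma IsNeighborPair.symm {x : Plane} {i j : Fin n} (h : IsNeighborPair P r x i j) :
    IsNeighborPair P r x j i := by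
  obtain ⟨hij, a, ha, b, hb, hda, hdb, h⟩ := h
  have key : ∀ c, orient b a c = -orient a b c := fun c => by unfold orient; ring
  refine ⟨hij.symm, b, hb, a, ha, hdb, hda, h.symm.imp (fun h c hc => ?_) (fun h c hc => ?_)⟩
  · rw [key]
    linarith [h c hc]
  · rw [key]
    linarith [h c hc]

lemma finite_nearPts (hP : IsSimplePolygon P) {x : Plane}
    (hmin : ∀ p ∈ P.boundary ℝ, r ≤ dist x p) : (nearPts P r x).Finite := by
  have h1 : ∀ p ∈ nearPts P r x, ∃ i, p ∈ halfEdge P i := fun p hp => exists_mem_halfEdge hp.1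
  have : Nonempty (Fin n) := ⟨⟨0, by have := hP.1; omega⟩⟩
  choose! f hf using h1
  refine Set.Finite.of_injOn (f := f) (t := univ) (fun _ _ => mem_univ _) ?_ finite_univ
  intro p hp q hq h
  exact eq_of_mem_nearPts hP hmin (hf p hp) (h ▸ hf q hq) hp.2 hq.2

lemma exists_isNeighborPair (hP : IsSimplePolygon P) (hr : 0 < r) {x : Plane}
    (hmin : ∀ p ∈ P.boundary ℝ, r ≤ dist x p) {i : Fin n} {a : Plane} (ha : a ∈ halfEdge P i)
    (hda : dist x a = r) (hne : ∃ b ∈ nearPts P r x, b ≠ a) :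
    ∃ j, IsNeighborPair P r x i j := by
  obtain ⟨b, hb, hba, h⟩ := exists_orient_nonneg (finite_nearPts hP hmin) hr
    (fun c hc => hc.2) hda hne
  obtain ⟨j, hj⟩ := exists_mem_halfEdge hb.1
  refine ⟨j, ?_, a, ha, b, hj, hda, hb.2, Or.inl h⟩
  rintro rfl
  exact hba (eq_of_mem_nearPts hP hmin hj ha hb.2 hda)

/-- Chords between neighboring nearest points do not cross, because the disks around the points of
the frontier are empty. -/
lemma neighborPairs_noncrossing (hP : IsSimplePolygon P) (hr : 0 < r) {x y : Plane}
    (hx : x ∈ frontier (dilate (polygonRegion P) r))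
    (hy : y ∈ frontier (dilate (polygonRegion P) r)) {i j k l : Fin n}
    (hik : i < k) (hkj : k < j) (hjl : j < l) (hxn : IsNeighborPair P r x i j)
    (hyn : IsNeighborPair P r y k l) : False := by
  obtain ⟨-, a, ha, b, hb, hda, hdb, hor⟩ := hxn
  obtain ⟨-, c, hc, d, hd, hdc, hdd, -⟩ := hyn
  obtain ⟨-, hbx, hminx, -⟩ := frontier_dilate_spec hr hx
  obtain ⟨-, hby, hminy, -⟩ := frontier_dilate_spec hr hy
  have hne : ∀ {p q : Plane} {s t : Fin n}, p ∈ halfEdge P s → q ∈ halfEdge P t → s < t → p ≠ q := by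
    rintro p q s t hp hq hst rfl
    exact hst.ne (hP.eq_of_mem_halfEdge hp hq)
  have hab := hne ha hb (hik.trans hkj)
  have hac := hne ha hc hik
  have hcb := hne hc hb hkj
  have hcd := hne hc hd (hkj.trans hjl)
  have hchord : ∀ {p q z : Plane}, p ≠ q → dist z p = r → dist z q = r →
      Disjoint (Metric.ball z r) (polygonRegion P) →
      Disjoint (openSegment ℝ p q) (polygonRegion P) := by
    intro p q z hpq hp hq hb
    refine hb.mono_left (openSegment_subset_ball_of_ne ?_ ?_ hpq)
    · rw [Metric.mem_closedBall']
      exact hp.le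
    · rw [Metric.mem_closedBall']
      exact hq.le
  refine hP.chords_not_interleaved hik hkj hjl ha hb hc hd (hchord hab hda hdb hbx)
    (hchord hcd hdc hdd hby) ?_
  rw [Set.disjoint_left]
  rintro z hz1 hz2
  rw [openSegment_eq_image_lineMap] at hz1 hz2
  obtain ⟨s, hs, rfl⟩ := hz1
  obtain ⟨t, ht, hzt⟩ := hz2
  have e0 := congrArg (fun p : Plane => p 0) hzt
  have e1 := congrArg (fun p : Plane => p 1) hzt
  simp only [lineMap_coord_zero, lineMap_coord_one] at e0 e1
  have hcΓ := halfEdge_subset_boundary k hc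
  have hdΓ := halfEdge_subset_boundary l hd
  by_cases hxy : x = y
  · -- same disk: `c` and `d` lie on one side of the line `a b`
    subst hxy
    have hlin : (1 - t) * orient a b c + t * orient a b d = 0 := by
      unfold orient
      linear_combination (b 0 - a 0) * e1 - (b 1 - a 1) * e0
    have h0 : orient a b c = 0 := by
      rcases hor with h | h
      · have h1 := h c ⟨hcΓ, hdc⟩
        have h2 := h d ⟨hdΓ, hdd⟩
        nlinarith [ht.1, ht.2, mul_nonneg ht.1.le h2]
      · have h1 := h c ⟨hcΓ, hdc⟩
        have h2 := h d ⟨hdΓ, hdd⟩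
        nlinarith [ht.1, ht.2, mul_nonneg ht.1.le (neg_nonneg.2 h2)]
    have huv : -(b 1 - a 1) ≠ 0 ∨ b 0 - a 0 ≠ 0 := by
      by_contra! h
      exact hab (Plane.ext_iff'.2 ⟨by linarith [h.2], by linarith [h.1]⟩)
    have := line_inter_circle huv (x := a) (y := b) (z := c)
      (k := -(b 1 - a 1) * a 0 + (b 0 - a 0) * a 1) rfl (by ring)
      (by unfold orient at h0; linear_combination h0)
      ((dist_comm _ _).trans hda) ((dist_comm _ _).trans hdb) ((dist_comm _ _).trans hdc)
    rcases this with h | h | h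
    · exact hab h
    · exact hac h
    · exact hcb h.symm
  · -- different disks: the difference of the two powers is an affine function
    set g : Plane → ℝ := fun p => dist x p ^ 2 - dist y p ^ 2 with hg
    have hglin : (1 - s) * g a + s * g b = (1 - t) * g c + t * g d := by
      simp only [hg, Plane.dist_sq]
      linear_combination (-2 * (y 0 - x 0)) * e0 + (-2 * (y 1 - x 1)) * e1
    have hya := hminy a (halfEdge_subset_boundary i ha)
    have hyb := hminy b (halfEdge_subset_boundary j hb)
    have hxc := hminx c hcΓ
    have hxd := hminx d hdΓ
    have ga : g a ≤ 0 := by simp only [hg, hda]; nlinarith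
    have gb : g b ≤ 0 := by simp only [hg, hdb]; nlinarith
    have gc : 0 ≤ g c := by simp only [hg, hdc]; nlinarith
    have gd : 0 ≤ g d := by simp only [hg, hdd]; nlinarith
    have p1 : (1 - s) * g a ≤ 0 := mul_nonpos_of_nonneg_of_nonpos (by linarith [hs.2]) ga
    have p2 : s * g b ≤ 0 := mul_nonpos_of_nonneg_of_nonpos hs.1.le gb
    have p3 : 0 ≤ (1 - t) * g c := mul_nonneg (by linarith [ht.2]) gc
    have p4 : 0 ≤ t * g d := mul_nonneg ht.1.le gd
    have za : g a = 0 := (mul_eq_zero.1 (le_antisymm p1 (by linarith))).resolve_left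
      (by linarith [hs.2])
    have zb : g b = 0 := (mul_eq_zero.1 (le_antisymm p2 (by linarith))).resolve_left hs.1.ne'
    have zc : g c = 0 := (mul_eq_zero.1 (le_antisymm (by linarith) p3)).resolve_left
      (by linarith [ht.2])
    have hdya : dist y a = r := by
      rw [← pow_left_inj₀ dist_nonneg hr.le two_ne_zero]
      simp only [hg, hda] at za
      linarith
    have hdyb : dist y b = r := by
      rw [← pow_left_inj₀ dist_nonneg hr.le two_ne_zero]
      simp only [hg, hdb] at zb
      linarith
    have hdxc : dist x c = r := by
      rw [← pow_left_inj₀ dist_nonneg hr.le two_ne_zero]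
      simp only [hg, hdc] at zc
      linarith
    have := circle_inter_circle hxy (x := a) (y := b) (z := c)
      ((dist_comm _ _).trans hda) ((dist_comm _ _).trans hdb) ((dist_comm _ _).trans hdxc)
      ((dist_comm _ _).trans hdya) ((dist_comm _ _).trans hdyb) ((dist_comm _ _).trans hdc)
    rcases this with h | h | h
    · exact hab h
    · exact hac h
    · exact hcb h.symm

open scoped Classical in
/-- The edges carrying nearest points of `x`. -/
noncomputable def nearEdges (P : Polygon Plane n) (r : ℝ) (x : Plane) : Finset (Fin n) :=
  Finset.univ.filter fun i => ∃ a ∈ halfEdge P i, dist x a = r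

lemma mem_nearEdges {x : Plane} {i : Fin n} :
    i ∈ nearEdges P r x ↔ ∃ a ∈ halfEdge P i, dist x a = r := by
  simp [nearEdges]

/-- Boundedly many frontier points have nearest points on two given edges: each edge puts the point
on one of three curves, and for each of the nine choices of two curves at most two frontier points
lie on both. -/
lemma exists_finset_of_mem_nearEdges (hP : IsSimplePolygon P) (hr : 0 < r) {i j : Fin n}
    (hij : i ≠ j) : ∃ B : Finset Plane, B.card ≤ 18 ∧
      ∀ x ∈ frontier (dilate (polygonRegion P) r), i ∈ nearEdges P r x → j ∈ nearEdges P r x →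
        x ∈ B := by
  classical
  set F := frontier (dilate (polygonRegion P) r) with hF
  -- `x` lies on the circle around the first vertex of an edge, or on one of its parallels
  let K : Fin n → Fin 3 → Plane → Prop := fun i κ x => match κ with
    | 0 => dist x (P i) = r
    | 1 => ∃ t ∈ Ioo (0 : ℝ) 1, x = offsetPoint (P i) (P (finRotate n i)) t r
    | 2 => ∃ t ∈ Ioo (0 : ℝ) 1, x = offsetPoint (P i) (P (finRotate n i)) t (-r)
  have hK : ∀ i, ∀ x ∈ F, i ∈ nearEdges P r x → ∃ κ, K i κ x := by
    intro i x hx hi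
    obtain ⟨a, ha, hd⟩ := mem_nearEdges.1 hi
    obtain ⟨-, -, hmin, -⟩ := frontier_dilate_spec hr hx
    rcases exists_offset_of_nearest hP hmin ha hd with rfl | ⟨t, ht, -, h | h⟩
    · exact ⟨0, hd⟩
    · exact ⟨1, t, ht, h⟩
    · exact ⟨2, t, ht, h⟩
  have hline : ∀ i κ, κ ≠ 0 → ∃ c, |c| = r ∧ ∀ x, K i κ x →
      ∃ t ∈ Ioo (0 : ℝ) 1, x = offsetPoint (P i) (P (finRotate n i)) t c := by
    intro i κ hκ
    fin_cases κ
    · exact absurd rfl hκ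
    · exact ⟨r, abs_of_pos hr, fun x hx => hx⟩
    · exact ⟨-r, by rw [abs_neg, abs_of_pos hr], fun x hx => hx⟩
  have hmix : ∀ i j κ, κ ≠ 0 → ∀ x y z, K i κ x → K i κ y → K i κ z → K j 0 x → K j 0 y →
      K j 0 z → x = y ∨ x = z ∨ y = z := by
    intro i j κ hκ x y z hx hy hz hx' hy' hz'
    obtain ⟨c, -, hc⟩ := hline i κ hκ
    have hni := hP.2.1 i
    have key : ∀ w, K i κ w → normal0 (P i) (P (finRotate n i)) * w 0 +
        normal1 (P i) (P (finRotate n i)) * w 1 = c + normal0 (P i) (P (finRotate n i)) * (P i) 0 +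
        normal1 (P i) (P (finRotate n i)) * (P i) 1 := by
      intro w hw
      obtain ⟨t, -, h⟩ := hc w hw
      have := offCoord_offsetPoint hni t c
      rw [← h] at this
      unfold offCoord at this
      linear_combination this
    exact line_inter_circle (normal_ne hni) (key x hx) (key y hy) (key z hz) hx' hy' hz'
  have hB : ∀ κ κ' : Fin 3, ∃ B : Finset Plane, B.card ≤ 2 ∧
      {x | x ∈ F ∧ K i κ x ∧ K j κ' x} ⊆ B := by
    intro κ κ'
    refine exists_finset_card_le_two ?_
    rintro x ⟨hxF, hx, hx'⟩ y ⟨hyF, hy, hy'⟩ z ⟨hzF, hz, hz'⟩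
    by_cases hκ : κ = 0
    · subst hκ
      by_cases hκ' : κ' = 0
      · subst hκ'
        refine circle_inter_circle (fun h => hij ?_) hx hy hz hx' hy' hz'
        exact hP.eq_of_mem_halfEdge (vertex_mem_halfEdge i) (h ▸ vertex_mem_halfEdge j)
      · exact hmix j i κ' hκ' x y z hx' hy' hz' hx hy hz
    · by_cases hκ' : κ' = 0
      · subst hκ'
        exact hmix i j κ hκ x y z hx hy hz hx' hy' hz'
      · left
        by_contra hxy
        obtain ⟨c, hc, hcK⟩ := hline i κ hκ
        obtain ⟨c', hc', hcK'⟩ := hline j κ' hκ'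
        obtain ⟨t, ht, hxt⟩ := hcK x hx
        obtain ⟨t', ht', hxt'⟩ := hcK' x hx'
        obtain ⟨s, -, hys⟩ := hcK y hy
        obtain ⟨s', -, hys'⟩ := hcK' y hy'
        refine not_mem_frontier_of_corridor hP hr hij ht ht' hc hc' hxy hxt hxt' ?_ ?_ hxF
        · rw [hys, offCoord_offsetPoint (hP.2.1 i)]
        · rw [hys', offCoord_offsetPoint (hP.2.1 j)]
  choose B hB1 hB2 using hB
  refine ⟨Finset.univ.biUnion fun κ => Finset.univ.biUnion fun κ' => B κ κ', ?_, ?_⟩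
  · refine (Finset.card_biUnion_le_card_mul _ _ (3 * 2) fun κ _ => ?_).trans (by simp)
    exact (Finset.card_biUnion_le_card_mul _ _ 2 fun κ' _ => hB1 κ κ').trans (by simp)
  · intro x hx hi hj
    obtain ⟨κ, hκ⟩ := hK i x hx hi
    obtain ⟨κ', hκ'⟩ := hK j x hx hj
    simp only [Finset.mem_biUnion, Finset.mem_univ, true_and]
    exact ⟨κ, κ', hB2 κ κ' ⟨hx, hκ, hκ'⟩⟩

/-- The frontier of a dilated polygon with `n` vertices has `O(n)` points with at least two nearest
points, even when each of them is counted with the number of its nearest points: the chords between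
neighboring nearest points form a noncrossing family of pairs of edges, and each pair occurs
boundedly often. -/
lemma exists_finset_multiple_nearPts (hP : IsSimplePolygon P) (hr : 0 < r) :
    ∃ V : Finset Plane, V.card ≤ 72 * n ∧ ∑ x ∈ V, (nearEdges P r x).card ≤ 72 * n ∧
      ∀ x ∈ frontier (dilate (polygonRegion P) r),
        (∃ a ∈ nearPts P r x, ∃ b ∈ nearPts P r x, b ≠ a) → x ∈ V := by
  classical
  set F := frontier (dilate (polygonRegion P) r) with hF
  have hB := fun i j (h : i ≠ j) => exists_finset_of_mem_nearEdges hP hr h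
  choose! B hB1 hB2 using hB
  set E : Finset (Fin n × Fin n) :=
    Finset.univ.filter fun e => ∃ x ∈ F, IsNeighborPair P r x e.1 e.2 with hE
  have memE : ∀ e, e ∈ E ↔ ∃ x ∈ F, IsNeighborPair P r x e.1 e.2 := fun e => by simp [hE]
  set E1 := E.filter fun e => e.1 < e.2 with hE1
  have hE1card : E1.card ≤ 2 * n := by
    have hinj : Function.Injective (fun e : Fin n × Fin n => ((e.1 : ℕ), (e.2 : ℕ))) := by
      intro e e' h
      simp only [Prod.mk.injEq] at h
      exact Prod.ext (Fin.ext h.1) (Fin.ext h.2)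
    rw [← Finset.card_image_of_injective E1 hinj]
    refine card_le_of_noncrossing _ ?_ ?_
    · intro e he
      obtain ⟨e', he', rfl⟩ := Finset.mem_image.1 he
      exact ⟨(Finset.mem_filter.1 he').2, e'.2.2⟩
    · rintro e he f hf ⟨h1, h2, h3⟩
      obtain ⟨e', he', rfl⟩ := Finset.mem_image.1 he
      obtain ⟨f', hf', rfl⟩ := Finset.mem_image.1 hf
      obtain ⟨x, hx, hxe⟩ := (memE e').1 (Finset.mem_filter.1 he').1
      obtain ⟨y, hy, hyf⟩ := (memE f').1 (Finset.mem_filter.1 hf').1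
      exact neighborPairs_noncrossing hP hr hx hy h1 h2 h3 hxe hyf
  have hEcard : E.card ≤ 4 * n := by
    have h1 : E ⊆ E1 ∪ E1.image Prod.swap := by
      intro e he
      obtain ⟨x, hx, hxe⟩ := (memE e).1 he
      rw [Finset.mem_union]
      rcases lt_or_gt_of_ne hxe.1 with h | h
      · exact Or.inl (Finset.mem_filter.2 ⟨he, h⟩)
      · refine Or.inr (Finset.mem_image.2 ⟨e.swap, Finset.mem_filter.2 ⟨(memE _).2 ?_, h⟩, ?_⟩)
        · exact ⟨x, hx, hxe.symm⟩
        · simp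
    have h2 := (Finset.card_le_card h1).trans (Finset.card_union_le _ _)
    have h3 : (E1.image Prod.swap).card ≤ E1.card := Finset.card_image_le
    omega
  have hBE : ∀ e ∈ E, (B e.1 e.2).card ≤ 18 := by
    intro e he
    obtain ⟨x, -, hxe⟩ := (memE e).1 he
    exact hB1 e.1 e.2 hxe.1
  set V : Finset Plane := (E.biUnion fun e => B e.1 e.2).filter fun x => x ∈ F ∧
    ∃ a ∈ nearPts P r x, ∃ b ∈ nearPts P r x, b ≠ a with hV
  have hpair : ∀ x ∈ F, (∃ a ∈ nearPts P r x, ∃ b ∈ nearPts P r x, b ≠ a) →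
      ∀ i ∈ nearEdges P r x, ∃ j, (i, j) ∈ E ∧ x ∈ B i j := by
    rintro x hx ⟨a, ha, b, hb, hba⟩ i hi
    obtain ⟨p, hp, hdp⟩ := mem_nearEdges.1 hi
    obtain ⟨-, -, hmin, -⟩ := frontier_dilate_spec hr hx
    have hne : ∃ q ∈ nearPts P r x, q ≠ p := by
      by_cases h : a = p
      · exact ⟨b, hb, fun h' => hba (h'.trans h.symm)⟩
      · exact ⟨a, ha, h⟩
    obtain ⟨j, hj⟩ := exists_isNeighborPair hP hr hmin hp hdp hne
    refine ⟨j, (memE _).2 ⟨x, hx, hj⟩, hB2 i j hj.1 x hx hi (mem_nearEdges.2 ?_)⟩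
    obtain ⟨-, -, -, q, hq, -, hdq, -⟩ := hj
    exact ⟨q, hq, hdq⟩
  refine ⟨V, ?_, ?_, ?_⟩
  · calc V.card ≤ (E.biUnion fun e => B e.1 e.2).card := Finset.card_filter_le _ _
      _ ≤ E.card * 18 := Finset.card_biUnion_le_card_mul _ _ _ hBE
      _ ≤ 72 * n := by omega
  · calc ∑ x ∈ V, (nearEdges P r x).card
        ≤ ∑ x ∈ V, (E.filter fun e => x ∈ B e.1 e.2).card := by
          refine Finset.sum_le_sum fun x hx => ?_
          obtain ⟨-, hxF, hx2⟩ := Finset.mem_filter.1 hx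
          refine (Finset.card_le_card (t := (E.filter fun e => x ∈ B e.1 e.2).image Prod.fst)
            fun i hi => ?_).trans Finset.card_image_le
          obtain ⟨j, hj, hxB⟩ := hpair x hxF hx2 i hi
          exact Finset.mem_image.2 ⟨(i, j), Finset.mem_filter.2 ⟨hj, hxB⟩, rfl⟩
      _ = ∑ e ∈ E, (V.filter fun x => x ∈ B e.1 e.2).card :=
          Finset.sum_card_bipartiteAbove_eq_sum_card_bipartiteBelow _
      _ ≤ ∑ e ∈ E, 18 := by
          refine Finset.sum_le_sum fun e he => (Finset.card_le_card fun x hx => ?_).trans (hBE e he)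
          exact (Finset.mem_filter.1 hx).2
      _ ≤ 72 * n := by
          rw [Finset.sum_const, smul_eq_mul]
          omega
  · rintro x hx h
    obtain ⟨a, ha, b, hb, hba⟩ := h
    obtain ⟨i, hi⟩ := exists_mem_halfEdge ha.1
    obtain ⟨j, hj, hxB⟩ := hpair x hx ⟨a, ha, b, hb, hba⟩ i (mem_nearEdges.2 ⟨a, hi, ha.2⟩)
    exact Finset.mem_filter.2 ⟨Finset.mem_biUnion.2 ⟨(i, j), hj, hxB⟩, hx, a, ha, b, hb, hba⟩

end Chords

/-! ### The frontier of a dilated polygon -/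

section FrontierDilate

variable {n : ℕ} {P : Polygon Plane n} {r : ℝ}

lemma offsetPoint_swap (p q : Plane) (t c : ℝ) :
    offsetPoint p q t c = offsetPoint q p (1 - t) (-c) := by
  have h : sqLen q p = sqLen p q := by
    unfold sqLen
    ring
  rw [Plane.ext_iff']
  simp only [offsetPoint_zero, offsetPoint_one, normal0, normal1, h]
  constructor <;> ring

/-- A point of a compact set is a frontier point if it is a limit of outside points, approached
along a continuous curve. -/
lemma mem_frontier_of_tendsto {X : Set Plane} {x : Plane} (hx : x ∈ X) {g : ℝ → Plane}
    (hg : Tendsto g (𝓝[>] 0) (𝓝 x)) (h : ∀ᶠ η in 𝓝[>] 0, g η ∉ X) : x ∈ frontier X := by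
  refine ⟨subset_closure hx, fun hi => ?_⟩
  have h1 : ∀ᶠ η in 𝓝[>] (0 : ℝ), g η ∈ X := hg.eventually (mem_interior_iff_mem_nhds.1 hi)
  obtain ⟨η, h2, h3⟩ := (h.and h1).exists
  exact h2 h3

/-- On the parallel of an edge, being on the frontier of the dilation is an open condition as long
as the nearest point is unique. -/
lemma eventually_offsetPoint_mem_frontier (hP : IsSimplePolygon P) (hr : 0 < r) {i : Fin n}
    {t c : ℝ} (ht : t ∈ Ioo (0 : ℝ) 1) (hc : |c| = r)
    (hx : offsetPoint (P i) (P (finRotate n i)) t c ∈ frontier (dilate (polygonRegion P) r))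
    (hnear : nearPts P r (offsetPoint (P i) (P (finRotate n i)) t c) = {P.edgePath ℝ i t}) :
    ∀ᶠ s in 𝓝 t, offsetPoint (P i) (P (finRotate n i)) s c ∈
      frontier (dilate (polygonRegion P) r) := by
  have hne := hP.2.1 i
  set p := P i
  set q := P (finRotate n i)
  have hcont : ∀ c, Continuous fun s => offsetPoint p q s c := fun c => by
    have : Continuous fun s : ℝ =>
        (AffineMap.lineMap (offsetPoint p q 0 c) (offsetPoint p q 1 c) s : Plane) :=
      AffineMap.lineMap_continuous
    simpa only [lineMap_offsetPoint] using this
  have hE := (hcont c).continuousAt.eventually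
    (eventually_mem_dilate_iff hr hx hnear).eventually_nhds
  have hedge : ∀ j, P.edgePath ℝ i t ∈ P.edgeSet ℝ j → j = i := by
    intro j hj
    rcases hP.eq_or_of_mem_edgeSet (i := i) ⟨t, ⟨ht.1.le, ht.2⟩, rfl⟩ hj with h | ⟨h, -⟩
    · exact h
    · rw [Polygon.edgePath, AffineMap.lineMap_eq_left_iff] at h
      exact (h.elim hne ht.1.ne').elim
  filter_upwards [hE, isOpen_Ioo.mem_nhds ht] with s hs hsI
  have hd : ∀ s, dist (offsetPoint p q s c) (AffineMap.lineMap p q s) = r := by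
    intro s
    have := dist_lineMap_alongCoord hne (offsetPoint p q s c)
    rwa [alongCoord_offsetPoint hne, offCoord_offsetPoint hne, hc] at this
  refine mem_frontier_of_tendsto (g := fun η => offsetPoint p q s (c * (1 + η))) ?_ ?_ ?_
  · exact mem_dilate.2 ⟨P.edgePath ℝ i s, boundary_subset_polygonRegion
      (halfEdge_subset_boundary i ⟨s, ⟨hsI.1.le, hsI.2⟩, rfl⟩), (hd s).le⟩
  · have : Continuous fun η : ℝ => offsetPoint p q s (c * (1 + η)) :=
      (continuous_offsetPoint p q s).comp (by fun_prop)
    have h := (this.tendsto 0).mono_left (nhdsWithin_le_nhds (s := Ioi 0))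
    simpa using h
  · have h : Tendsto (fun η : ℝ => offsetPoint p q s (c * (1 + η))) (𝓝[>] 0)
        (𝓝 (offsetPoint p q s c)) := by
      have : Continuous fun η : ℝ => offsetPoint p q s (c * (1 + η)) :=
        (continuous_offsetPoint p q s).comp (by fun_prop)
      have h := (this.tendsto 0).mono_left (nhdsWithin_le_nhds (s := Ioi 0))
      simpa using h
    filter_upwards [h.eventually hs, self_mem_nhdsWithin] with η hη hpos
    rw [hη]
    rintro ⟨j, hj, z, hz, hdz⟩
    obtain rfl := hedge j hj
    obtain ⟨w, -, rfl⟩ := hz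
    have h1 := (abs_offCoord_le_dist hne (offsetPoint p q s (c * (1 + η))) w).trans hdz
    rw [offCoord_offsetPoint hne, abs_mul, hc, abs_of_pos (by linarith [mem_Ioi.1 hpos])] at h1
    have : 0 < r * η := mul_pos hr hpos
    linarith

/-- Around a frontier point whose only nearest point is a vertex, and that is not perpendicularly
above the vertex with respect to one of its edges, the dilation is a disk. -/
lemma eventually_mem_dilate_iff_dist_le (hP : IsSimplePolygon P) (hr : 0 < r) {x : Plane} {i : Fin n}
    (hx : x ∈ frontier (dilate (polygonRegion P) r)) (hnear : nearPts P r x = {P i})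
    (hnext : alongCoord (P i) (P (finRotate n i)) x ≠ 0)
    (hprev : ∀ j, finRotate n j = i → alongCoord (P i) (P j) x ≠ 0) :
    ∀ᶠ y in 𝓝 x, y ∈ dilate (polygonRegion P) r ↔ dist y (P i) ≤ r := by
  obtain ⟨-, -, hmin, -⟩ := frontier_dilate_spec hr hx
  have hxi : dist x (P i) = r := (hnear ▸ mem_singleton (P i) : P i ∈ nearPts P r x).2
  have h1 : ∀ j, P i ∈ P.edgeSet ℝ j → ∀ᶠ y in 𝓝 x,
      (∃ z ∈ P.edgeSet ℝ j, dist y z ≤ r) ↔ dist y (P i) ≤ r := by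
    intro j hj
    have h2 : ∃ q, q ≠ P i ∧ alongCoord (P i) q x ≠ 0 ∧ P.edgeSet ℝ j = segment ℝ (P i) q := by
      rcases hP.eq_or_of_mem_edgeSet (vertex_mem_halfEdge i) hj with rfl | ⟨-, h⟩
      · exact ⟨_, (hP.2.1 j).symm, hnext, edgeSet_eq_segment j⟩
      · subst h
        exact ⟨P j, hP.2.1 j, hprev j rfl, by rw [edgeSet_eq_segment, segment_symm]⟩
    obtain ⟨q, hq, hq0, hseg⟩ := h2
    have h3 : alongCoord (P i) q x ≤ 0 := by
      refine (alongCoord_of_nearest hq.symm (u := 0) (r := r) (by simp) (by simpa using hxi)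
        fun w hw => hmin _ (edgeSet_subset_boundary j ?_)).1.resolve_right (by norm_num)
      rw [hseg, segment_eq_image_lineMap]
      exact ⟨w, hw, rfl⟩
    rw [hseg]
    exact eventually_exists_dist_le_iff hq.symm (lt_of_le_of_ne h3 hq0)
  have h2 : ∀ᶠ y in 𝓝 x, ∀ j, P i ∈ P.edgeSet ℝ j →
      ((∃ z ∈ P.edgeSet ℝ j, dist y z ≤ r) ↔ dist y (P i) ≤ r) := by
    rw [eventually_all]
    intro j
    by_cases hj : P i ∈ P.edgeSet ℝ j
    · filter_upwards [h1 j hj] with y hy _ using hy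
    · simp [hj]
  filter_upwards [eventually_mem_dilate_iff hr hx hnear, h2] with y hy hy'
  rw [hy]
  constructor
  · rintro ⟨j, hj, hz⟩
    exact (hy' j hj).1 hz
  · intro hd
    have := halfEdge_subset_edgeSet i (vertex_mem_halfEdge (P := P) i)
    exact ⟨i, this, (hy' i this).2 hd⟩

lemma dist_circlePoint (c : Plane) {r : ℝ} (hr : 0 ≤ r) (θ : ℝ) : dist (circlePoint c r θ) c = r :=
  Metric.mem_sphere.1 (circlePoint_mem_sphere c hr θ)

/-- Where the dilation is locally a disk, its frontier is locally a circle. -/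
lemma eventually_circlePoint_mem_frontier {X : Set Plane} (hr : 0 < r) {c : Plane} {θ : ℝ}
    (h : ∀ᶠ y in 𝓝 (circlePoint c r θ), y ∈ X ↔ dist y c ≤ r) :
    ∀ᶠ s in 𝓝 θ, circlePoint c r s ∈ frontier X := by
  have h1 := (continuous_circlePoint c r).continuousAt.eventually h.eventually_nhds
  filter_upwards [h1] with s hs
  have hg : Tendsto (fun η : ℝ => circlePoint c (r * (1 + η)) s) (𝓝[>] 0)
      (𝓝 (circlePoint c r s)) := by
    have : Continuous fun η : ℝ => circlePoint c (r * (1 + η)) s := by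
      unfold circlePoint
      refine continuous_const.add ((PiLp.continuous_toLp 2 _).comp (continuous_pi fun i => ?_))
      fin_cases i <;> simp <;> fun_prop
    have h := (this.tendsto 0).mono_left (nhdsWithin_le_nhds (s := Ioi 0))
    simpa using h
  refine mem_frontier_of_tendsto ?_ hg ?_
  · rw [hs.self_of_nhds, dist_circlePoint c hr.le]
  · filter_upwards [hg.eventually hs, self_mem_nhdsWithin] with η hη hpos
    have hpos : 0 < η := hpos
    rw [hη, dist_circlePoint c (by positivity)]
    have : 0 < r * η := mul_pos hr hpos
    linarith


/-- The endpoints of the five offset curves belonging to an edge. -/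
noncomputable def offsetVertices (P : Polygon Plane n) (r : ℝ) (i : Fin n) : List Plane :=
  [circlePoint (P i) r 0,
    offsetPoint (P i) (P (finRotate n i)) 0 r, offsetPoint (P i) (P (finRotate n i)) 0 (-r),
    offsetPoint (P i) (P (finRotate n i)) 1 r, offsetPoint (P i) (P (finRotate n i)) 1 (-r)]

/-- A point at distance `r` from `p` that is perpendicularly above `p`. -/
lemma eq_offsetPoint_of_alongCoord_eq_zero {p q x : Plane} (h : p ≠ q) (hd : dist x p = r)
    (hx : alongCoord p q x = 0) : x = offsetPoint p q 0 r ∨ x = offsetPoint p q 0 (-r) := by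
  have h1 := dist_lineMap_alongCoord h x
  rw [hx, AffineMap.lineMap_apply_zero, hd] at h1
  have h2 := offsetPoint_coords h x
  rw [hx] at h2
  rcases (abs_eq (h1 ▸ abs_nonneg _)).1 h1.symm with h3 | h3
  · left; rw [← h3, h2]
  · right; rw [← h3, h2]

open scoped Classical in
/-- The frontier of the dilation of a simple polygon by a positive radius has linear complexity. -/
theorem exists_featureDecomposition_frontier_dilate (hP : IsSimplePolygon P) (hr : 0 < r) :
    ∃ D : FeatureDecomposition (frontier (dilate (polygonRegion P) r)), D.size ≤ 527 * n := by
  set F := frontier (dilate (polygonRegion P) r) with hF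
  obtain ⟨V, hV1, hV2, hV3⟩ := exists_finset_multiple_nearPts hP hr
  set W : Finset Plane := Finset.univ.biUnion fun i : Fin n => (offsetVertices P r i).toFinset
    with hW
  have hWcard : W.card ≤ 5 * n := by
    refine (Finset.card_biUnion_le_card_mul _ _ 5 fun i _ => ?_).trans ?_
    · exact (List.toFinset_card_le _).trans (by simp [offsetVertices])
    · simp [mul_comm]
  have memW : ∀ i, ∀ x ∈ offsetVertices P r i, x ∈ W := fun i x hx =>
    Finset.mem_biUnion.2 ⟨i, Finset.mem_univ i, List.mem_toFinset.2 hx⟩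
  set S : Finset Plane := (V ∪ W).filter (· ∈ F) with hS
  have hScard : S.card ≤ 77 * n := by
    have h1 : S.card ≤ (V ∪ W).card := Finset.card_filter_le _ _
    have h2 := Finset.card_union_le V W
    omega
  have memS : ∀ x ∈ F, x ∉ S → x ∉ V ∧ x ∉ W := by
    intro x hx h
    by_contra hc
    refine h (Finset.mem_filter.2 ⟨Finset.mem_union.2 ?_, hx⟩)
    tauto
  -- away from the vertices of the subdivision the nearest point is unique
  have huniq : ∀ x ∈ F, x ∉ V → ∀ a ∈ nearPts P r x, nearPts P r x = {a} := by
    intro x hx hxV a ha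
    refine eq_singleton_iff_unique_mem.2 ⟨ha, fun b hb => ?_⟩
    by_contra hba
    exact hxV (hV3 x hx ⟨a, ha, b, hb, hba⟩)
  have hfoot : ∀ i t c, |c| = r →
      dist (offsetPoint (P i) (P (finRotate n i)) t c) (P.edgePath ℝ i t) = r := by
    intro i t c hc
    have := dist_lineMap_alongCoord (hP.2.1 i) (offsetPoint (P i) (P (finRotate n i)) t c)
    rwa [alongCoord_offsetPoint (hP.2.1 i), offCoord_offsetPoint (hP.2.1 i), hc] at this
  -- a point of an offset curve determines a nearest point
  have hcase : ∀ f, ∀ x ∈ offsetSet P r f, (f.2 = 0 ∧ dist x (P f.1) = r) ∨ (f.2 ≠ 0 ∧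
      ∃ t ∈ Ioo (0 : ℝ) 1, dist x (P.edgePath ℝ f.1 t) = r ∧
        x = offsetPoint (P f.1) (P (finRotate n f.1)) t (if f.2 = 1 then r else -r)) := by
    rintro ⟨i, κ⟩ x hx
    fin_cases κ
    · obtain ⟨θ, -, rfl⟩ := hx
      exact Or.inl ⟨rfl, dist_circlePoint _ hr.le θ⟩
    · obtain ⟨t, ht, rfl⟩ := hx
      have h0 : offsetEnd ((i, 1) : Fin n × Fin 3) = 1 := if_neg (by simp)
      exact Or.inr ⟨by simp, t, h0 ▸ ht, hfoot i t r (abs_of_pos hr), by simp [offsetCurve]⟩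
    · obtain ⟨t, ht, rfl⟩ := hx
      have h0 : offsetEnd ((i, 2) : Fin n × Fin 3) = 1 := if_neg (by simp)
      exact Or.inr ⟨by simp, t, h0 ▸ ht, hfoot i t (-r) (by rw [abs_neg, abs_of_pos hr]),
        by simp [offsetCurve]⟩
  have hnearest : ∀ f, ∀ x ∈ offsetSet P r f, ∃ a ∈ halfEdge P f.1, dist x a = r := by
    intro f x hx
    rcases hcase f x hx with ⟨-, h⟩ | ⟨-, t, ht, h, -⟩
    · exact ⟨_, vertex_mem_halfEdge f.1, h⟩
    · exact ⟨_, ⟨t, ⟨ht.1.le, ht.2⟩, rfl⟩, h⟩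
  have hsame : ∀ x ∈ F, x ∉ V → ∀ i j, ∀ a ∈ halfEdge P i, ∀ b ∈ halfEdge P j, dist x a = r →
      dist x b = r → a = b ∧ i = j := by
    intro x hx hxV i j a ha b hb hda hdb
    have h1 := huniq x hx hxV a ⟨halfEdge_subset_boundary i ha, hda⟩
    have h2 : b ∈ nearPts P r x := ⟨halfEdge_subset_boundary j hb, hdb⟩
    rw [h1, mem_singleton_iff] at h2
    subst h2
    exact ⟨rfl, hP.eq_of_mem_halfEdge ha hb⟩
  have hSclosed : IsClosed (S : Set Plane) := S.finite_toSet.isClosed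
  have hcurve := fun f => isCurve_offsetCurve hP hr f
  have hopF : ∀ f, ∀ t ∈ Ioo 0 (offsetEnd f), offsetCurve P r f t ∉ S →
      offsetCurve P r f t ∈ F → ∀ᶠ s in 𝓝 t, offsetCurve P r f s ∈ F := by
    rintro ⟨i, κ⟩ t ht htS htF
    obtain ⟨htV, htW⟩ := memS _ htF htS
    have key : ∀ c, |c| = r → t ∈ Ioo (0 : ℝ) 1 →
        offsetPoint (P i) (P (finRotate n i)) t c ∈ F →
        offsetPoint (P i) (P (finRotate n i)) t c ∉ V →
        ∀ᶠ s in 𝓝 t, offsetPoint (P i) (P (finRotate n i)) s c ∈ F := fun c hc ht hF hV =>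
      eventually_offsetPoint_mem_frontier hP hr ht hc hF (huniq _ hF hV _
        ⟨halfEdge_subset_boundary i ⟨t, ⟨ht.1.le, ht.2⟩, rfl⟩, hfoot i t c hc⟩)
    have h1 : offsetEnd ((i, 1) : Fin n × Fin 3) = 1 := if_neg (by simp)
    have h2 : offsetEnd ((i, 2) : Fin n × Fin 3) = 1 := if_neg (by simp)
    fin_cases κ
    · refine eventually_circlePoint_mem_frontier hr (eventually_mem_dilate_iff_dist_le hP hr htF
        (huniq _ htF htV _ ⟨halfEdge_subset_boundary i (vertex_mem_halfEdge i),
          dist_circlePoint _ hr.le t⟩) (fun h0 => ?_) (fun j hj h0 => ?_))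
      -- otherwise the point would be an endpoint of an offset curve
      · refine htW (memW i _ ?_)
        change circlePoint (P i) r t ∈ _
        rcases eq_offsetPoint_of_alongCoord_eq_zero (hP.2.1 i) (dist_circlePoint _ hr.le t) h0
          with h | h <;> rw [h] <;> simp [offsetVertices]
      · change finRotate n j = i at hj
        refine htW (memW j _ ?_)
        change circlePoint (P i) r t ∈ _
        have hne : P i ≠ P j := by
          rw [← hj]
          exact (hP.2.1 j).symm
        rcases eq_offsetPoint_of_alongCoord_eq_zero hne (dist_circlePoint _ hr.le t) h0
          with h | h <;> rw [h, offsetPoint_swap] <;> subst hj <;> simp [offsetVertices]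
    · exact key r (abs_of_pos hr) (h1 ▸ ht) htF htV
    · exact key (-r) (by rw [abs_neg, abs_of_pos hr]) (h2 ▸ ht) htF htV
  obtain ⟨D, hD⟩ := exists_featureDecomposition (Finset.univ : Finset (Fin n × Fin 3))
    (γ := offsetCurve P r) (a := fun _ => 0) (b := offsetEnd) (fun f _ => hcurve f)
    (F := F) isClosed_frontier S (fun x hx => (Finset.mem_filter.1 hx).2)
    (G := fun f => (offsetSet P r f ∩ F) \ S) (fun f _ => sdiff_subset.trans inter_subset_left)
    (fun f _ => sdiff_subset.trans inter_subset_right) (fun f _ x hx => hx.2)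
    (fun f _ t ht htS htG => by
      filter_upwards [hopF f t ht htS htG.1.2, isOpen_Ioo.mem_nhds ht,
        (hcurve f).cont.continuousAt.eventually (hSclosed.isOpen_compl.mem_nhds htS)]
        with s h1 h2 h3
      exact ⟨⟨⟨s, h2, rfl⟩, h1⟩, h3⟩)
    (fun f _ t ht htS htG => by
      have h1 : offsetCurve P r f t ∉ F := fun h => htG ⟨⟨⟨t, ht, rfl⟩, h⟩, htS⟩
      filter_upwards [(hcurve f).cont.continuousAt.eventually
        (isClosed_frontier.isOpen_compl.mem_nhds h1)] with s hs h
      exact hs h.1.2)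
    (fun f _ g _ hfg => by
      rw [Set.disjoint_left]
      rintro x ⟨⟨hxf, hxF⟩, hxS⟩ ⟨⟨hxg, -⟩, -⟩
      obtain ⟨hxV, -⟩ := memS x hxF hxS
      have hvert : ∀ i, ∀ t ∈ Ioo (0 : ℝ) 1, P i ≠ P.edgePath ℝ i t := by
        intro i t ht h
        rw [eq_comm, Polygon.edgePath, AffineMap.lineMap_eq_left_iff] at h
        exact h.elim (hP.2.1 i) ht.1.ne'
      refine hfg ?_
      obtain ⟨i, κ⟩ := f
      obtain ⟨j, κ'⟩ := g
      obtain ⟨a, ha, hda⟩ := hnearest _ x hxf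
      obtain ⟨b, hb, hdb⟩ := hnearest _ x hxg
      obtain ⟨-, h⟩ := hsame x hxF hxV _ _ a ha b hb hda hdb
      dsimp only at h
      subst h
      refine Prod.ext rfl ?_
      dsimp only
      rcases hcase _ x hxf with ⟨h1, h2⟩ | ⟨h1, t, ht, h2, h3⟩ <;>
        rcases hcase _ x hxg with ⟨h1', h2'⟩ | ⟨h1', t', ht', h2', h3'⟩ <;> dsimp only at *
      · rw [h1, h1']
      · exact absurd (hsame x hxF hxV i i _ (vertex_mem_halfEdge i) _
          ⟨t', ⟨ht'.1.le, ht'.2⟩, rfl⟩ h2 h2').1 (hvert i t' ht')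
      · exact absurd (hsame x hxF hxV i i _ (vertex_mem_halfEdge i) _
          ⟨t, ⟨ht.1.le, ht.2⟩, rfl⟩ h2' h2).1 (hvert i t ht)
      · have h4 := congrArg (offCoord (P i) (P (finRotate n i))) (h3.symm.trans h3')
        rw [offCoord_offsetPoint (hP.2.1 i), offCoord_offsetPoint (hP.2.1 i)] at h4
        fin_cases κ <;> fin_cases κ' <;> simp at h1 h1' h4 ⊢ <;> linarith)
    (fun x hx => by
      by_cases hxS : x ∈ S
      · exact Or.inl hxS
      right
      obtain ⟨-, hxW⟩ := memS x hx hxS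
      obtain ⟨-, -, hmin, a, ha⟩ := frontier_dilate_spec hr hx
      obtain ⟨i, hi⟩ := exists_mem_halfEdge ha.1
      have h1 : offsetEnd ((i, 1) : Fin n × Fin 3) = 1 := if_neg (by simp)
      have h2 : offsetEnd ((i, 2) : Fin n × Fin 3) = 1 := if_neg (by simp)
      rcases exists_offset_of_nearest hP hmin hi ha.2 with rfl | ⟨t, ht, -, h | h⟩
      · obtain ⟨θ, hθ, rfl⟩ := exists_circlePoint_eq hr (Metric.mem_sphere.2 ha.2) 0
        have h0 : 0 < θ := by
          refine lt_of_le_of_ne hθ.1 ?_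
          rintro rfl
          exact hxW (memW i _ (by simp [offsetVertices]))
        refine ⟨(i, 0), Finset.mem_univ _, ⟨⟨θ, ⟨h0, ?_⟩, rfl⟩, hx⟩, hxS⟩
        simpa [offsetEnd] using hθ.2
      · exact ⟨(i, 1), Finset.mem_univ _, ⟨⟨t, by rwa [h1], h.symm⟩, hx⟩, hxS⟩
      · exact ⟨(i, 2), Finset.mem_univ _, ⟨⟨t, by rwa [h2], h.symm⟩, hx⟩, hxS⟩)
    (by
      rintro ⟨i, κ⟩ -
      have hin : ∀ x ∈ offsetVertices P r i, x ∈ F → x ∈ S := fun x hx hxF =>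
        Finset.mem_filter.2 ⟨Finset.mem_union_right _ (memW i x hx), hxF⟩
      have h0 : offsetEnd ((i, 0) : Fin n × Fin 3) = 2 * Real.pi := if_pos rfl
      have h1 : offsetEnd ((i, 1) : Fin n × Fin 3) = 1 := if_neg (by simp)
      have h2 : offsetEnd ((i, 2) : Fin n × Fin 3) = 1 := if_neg (by simp)
      fin_cases κ
      · refine ⟨hin _ (by simp [offsetVertices, offsetCurve]), hin _ ?_⟩
        have : circlePoint (P i) r (2 * Real.pi) = circlePoint (P i) r 0 := by simp [circlePoint]
        simp [offsetVertices, offsetCurve, h0, this]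
      · exact ⟨hin _ (by simp [offsetVertices, offsetCurve]),
          hin _ (by simp [offsetVertices, offsetCurve, h1])⟩
      · exact ⟨hin _ (by simp [offsetVertices, offsetCurve]),
          hin _ (by simp [offsetVertices, offsetCurve, h2])⟩)
  refine ⟨D, hD.trans ?_⟩
  rw [Finset.sum_add_distrib]
  have hinc : ∑ f : Fin n × Fin 3, (S.filter fun x => x ∈ offsetCurve P r f '' Ioo 0 (offsetEnd f)).card
      ≤ 3 * ∑ x ∈ S, (nearEdges P r x).card := by
    rw [Finset.mul_sum]
    refine (Finset.sum_card_bipartiteAbove_eq_sum_card_bipartiteBelow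
      (fun x f => x ∈ offsetCurve P r f '' Ioo 0 (offsetEnd f))).symm.trans_le ?_
    refine Finset.sum_le_sum fun x hx => ?_
    have : (Finset.univ.filter fun f => x ∈ offsetCurve P r f '' Ioo 0 (offsetEnd f)) ⊆
        nearEdges P r x ×ˢ (Finset.univ : Finset (Fin 3)) := by
      intro f hf
      rw [Finset.mem_product]
      exact ⟨mem_nearEdges.2 (hnearest f x (Finset.mem_filter.1 hf).2), Finset.mem_univ _⟩
    refine (Finset.card_le_card this).trans ?_
    rw [Finset.card_product, mul_comm]
    simp
  have hsum : ∑ x ∈ S, (nearEdges P r x).card ≤ 149 * n := by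
    rw [← Finset.sum_filter_add_sum_filter_not S (· ∈ V)]
    have h1 : ∑ x ∈ S.filter (· ∈ V), (nearEdges P r x).card ≤ 72 * n :=
      (Finset.sum_le_sum_of_subset fun x hx => (Finset.mem_filter.1 hx).2).trans hV2
    have h2 : ∑ x ∈ S.filter (· ∉ V), (nearEdges P r x).card ≤ S.card := by
      calc _ ≤ ∑ x ∈ S.filter (· ∉ V), 1 := by
            refine Finset.sum_le_sum fun x hx => Finset.card_le_one.2 fun i hi j hj => ?_
            obtain ⟨hxS, hxV⟩ := Finset.mem_filter.1 hx
            obtain ⟨a, ha, hda⟩ := mem_nearEdges.1 hi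
            obtain ⟨b, hb, hdb⟩ := mem_nearEdges.1 hj
            exact (hsame x (Finset.mem_filter.1 hxS).2 hxV i j a ha b hb hda hdb).2
        _ ≤ S.card := by simpa using Finset.card_filter_le _ _
    omega
  have hthree : ∑ _f : Fin n × Fin 3, 1 = 3 * n := by simp [mul_comm]
  omega

end FrontierDilate

/-! ### The frontier of a polygon region and the upper bound -/

section FrontierRegion

variable {n : ℕ} {P : Polygon Plane n}

lemma frontier_polygonRegion_subset : frontier (polygonRegion P) ⊆ P.boundary ℝ := by
  intro x hx
  by_contra hxb
  rw [isClosed_polygonRegion.frontier_eq] at hx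
  obtain ⟨ε, hε, hball⟩ := Metric.isOpen_iff.1
    (isCompact_boundary (P := P)).isClosed.isOpen_compl x hxb
  refine hx.2 (mem_interior.2 ⟨Metric.ball x ε, fun y hy => ?_, Metric.isOpen_ball,
    Metric.mem_ball_self hε⟩)
  by_contra hyP
  exact Set.disjoint_left.1 (disjoint_polygonRegion (convex_ball x ε).isPreconnected
    (Set.disjoint_left.2 hball) hy hyP) (Metric.mem_ball_self hε) hx.1

/-- The inner points of an edge near a frontier point are frontier points as well: the half-disk on
the side of the edge from which the frontier point is approached lies outside the region. -/
lemma eventually_edgePath_mem_frontier (hP : IsSimplePolygon P) {i : Fin n} {t : ℝ}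
    (ht : t ∈ Ioo (0 : ℝ) 1) (hx : P.edgePath ℝ i t ∈ frontier (polygonRegion P)) :
    ∀ᶠ s in 𝓝 t, P.edgePath ℝ i s ∈ frontier (polygonRegion P) := by
  have hne := hP.2.1 i
  set p := P i
  set q := P (finRotate n i)
  have hedge : ∀ s, P.edgePath ℝ i s = offsetPoint p q s 0 := by
    intro s
    rw [Polygon.edgePath, Plane.ext_iff', lineMap_coord_zero, lineMap_coord_one]
    simp [p, q]
  set x := P.edgePath ℝ i t with hxdef
  have hother : ∀ᶠ y in 𝓝 x, ∀ j, j ≠ i → y ∉ P.edgeSet ℝ j := by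
    rw [eventually_all]
    intro j
    by_cases hj : j = i
    · simp [hj]
    · have : x ∉ P.edgeSet ℝ j := by
        intro h
        rcases hP.eq_or_of_mem_edgeSet (i := i) ⟨t, ⟨ht.1.le, ht.2⟩, rfl⟩ h with h | ⟨h, -⟩
        · exact hj h
        · rw [Polygon.edgePath, AffineMap.lineMap_eq_left_iff] at h
          exact h.elim hne ht.1.ne'
      filter_upwards [(isCompact_edgeSet j).isClosed.isOpen_compl.mem_nhds this] with y hy _ using hy
  have halong : ∀ᶠ y in 𝓝 x, alongCoord p q y ∈ Ioo (0 : ℝ) 1 := by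
    refine (continuous_alongCoord p q).continuousAt.eventually (isOpen_Ioo.mem_nhds ?_)
    rwa [hxdef, hedge, alongCoord_offsetPoint hne]
  obtain ⟨ε, hε, hball⟩ := Metric.eventually_nhds_iff_ball.1 (hother.and halong)
  -- within the disk, the boundary curve is the line through the edge
  have hline : ∀ y ∈ Metric.ball x ε, y ∈ P.boundary ℝ ↔ offCoord p q y = 0 := by
    intro y hy
    obtain ⟨h1, h2⟩ := hball y hy
    constructor
    · intro hyb
      obtain ⟨j, hj⟩ := mem_iUnion.1 hyb
      have hji : j = i := by
        by_contra h
        exact h1 j h hj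
      subst hji
      obtain ⟨s, -, rfl⟩ := hj
      change offCoord p q (P.edgePath ℝ j s) = 0
      rw [hedge, offCoord_offsetPoint hne]
    · intro h0
      have h3 := offsetPoint_coords hne y
      rw [h0, ← hedge] at h3
      rw [← h3]
      exact edgeSet_subset_boundary i ⟨_, Ioo_subset_Icc_self h2, rfl⟩
  obtain ⟨y, hyball, hyP⟩ : ∃ y ∈ Metric.ball x ε, y ∉ polygonRegion P := by
    rw [frontier_eq_closure_inter_closure] at hx
    obtain ⟨y, hy, hd⟩ := Metric.mem_closure_iff.1 hx.2 ε hε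
    exact ⟨y, Metric.mem_ball'.2 hd, hy⟩
  set c := offCoord p q y with hc
  have hc0 : c ≠ 0 := fun h =>
    hyP (boundary_subset_polygonRegion ((hline y hyball).2 h))
  set H : Set Plane := Metric.ball x ε ∩ {z | 0 < c * offCoord p q z} with hH
  have hHconv : Convex ℝ H := by
    refine (convex_ball x ε).inter ?_
    intro z hz w hw a b ha hb hab
    simp only [mem_ofPred_eq] at hz hw ⊢
    have : offCoord p q (a • z + b • w) = a * offCoord p q z + b * offCoord p q w := by
      simp only [offCoord, PiLp.add_apply, PiLp.smul_apply, smul_eq_mul]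
      linear_combination (normal0 p q * p 0 + normal1 p q * p 1) * hab
    rw [this]
    rcases ha.eq_or_lt with rfl | ha
    · rw [zero_add] at hab
      subst hab
      linarith
    · nlinarith [mul_pos ha hz, mul_nonneg hb hw.le]
  have hHdis : Disjoint H (polygonRegion P) := by
    refine disjoint_polygonRegion hHconv.isPreconnected (Set.disjoint_left.2 ?_)
      (x := y) ⟨hyball, ?_⟩ hyP
    · rintro z ⟨hz, hz'⟩ hzb
      rw [mem_ofPred_eq, (hline z hz).1 hzb, mul_zero] at hz'
      exact lt_irrefl _ hz'
    · exact mul_self_pos.2 hc0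
  have hcont : Continuous fun s => P.edgePath ℝ i s := AffineMap.lineMap_continuous
  filter_upwards [hcont.continuousAt.eventually (Metric.isOpen_ball.mem_nhds
    (Metric.mem_ball_self hε)), isOpen_Ioo.mem_nhds ht] with s hs hs01
  have hg : Tendsto (fun η : ℝ => offsetPoint p q s (c * η)) (𝓝[>] 0) (𝓝 (P.edgePath ℝ i s)) := by
    have : Continuous fun η : ℝ => offsetPoint p q s (c * η) :=
      (continuous_offsetPoint p q s).comp (by fun_prop)
    have h := (this.tendsto 0).mono_left (nhdsWithin_le_nhds (s := Ioi 0))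
    rw [hedge]
    simpa using h
  refine mem_frontier_of_tendsto (boundary_subset_polygonRegion
    (edgeSet_subset_boundary i ⟨s, Ioo_subset_Icc_self hs01, rfl⟩)) hg ?_
  filter_upwards [hg.eventually (Metric.isOpen_ball.mem_nhds hs), self_mem_nhdsWithin] with η h1 h2
  refine Set.disjoint_left.1 hHdis ⟨h1, ?_⟩
  rw [mem_ofPred_eq, offCoord_offsetPoint hne]
  have h2 : 0 < η := h2
  have := mul_self_pos.2 hc0
  nlinarith

open scoped Classical in
lemma exists_featureDecomposition_frontier_polygonRegion (hP : IsSimplePolygon P) :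
    ∃ D : FeatureDecomposition (frontier (polygonRegion P)), D.size ≤ 2 * n := by
  set F := frontier (polygonRegion P) with hF
  set S : Finset Plane := (Finset.univ.image fun i => P i).filter (· ∈ F) with hS
  have hvS : ∀ i, P i ∈ F → P i ∈ S := fun i h =>
    Finset.mem_filter.2 ⟨Finset.mem_image_of_mem _ (Finset.mem_univ i), h⟩
  -- vertices do not lie on open edges
  have hvert : ∀ i j, ∀ t ∈ Ioo (0 : ℝ) 1, P j ≠ P.edgePath ℝ i t := by
    intro i j t ht h
    have h1 : P j ∈ halfEdge P i := h ▸ ⟨t, ⟨ht.1.le, ht.2⟩, rfl⟩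
    obtain rfl := hP.eq_of_mem_halfEdge (vertex_mem_halfEdge j) h1
    rw [eq_comm, Polygon.edgePath, AffineMap.lineMap_eq_left_iff] at h
    exact h.elim (hP.2.1 j) ht.1.ne'
  have hnotS : ∀ i, ∀ t ∈ Ioo (0 : ℝ) 1, P.edgePath ℝ i t ∉ S := by
    intro i t ht h
    obtain ⟨j, -, hj⟩ := Finset.mem_image.1 (Finset.mem_filter.1 h).1
    exact hvert i j t ht hj
  have hcurve : ∀ i, IsCurve (fun t => P.edgePath ℝ i t) 0 1 := fun i => isCurve_lineMap (hP.2.1 i)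
  obtain ⟨D, hD⟩ := exists_featureDecomposition (Finset.univ : Finset (Fin n))
    (γ := fun i t => P.edgePath ℝ i t) (a := fun _ => 0) (b := fun _ => 1)
    (fun i _ => hcurve i) (F := F) isClosed_frontier S (fun x hx => (Finset.mem_filter.1 hx).2)
    (G := fun i => P.edgePath ℝ i '' Ioo 0 1 ∩ F) (fun i _ => inter_subset_left)
    (fun i _ => inter_subset_right)
    (by
      rintro i - _ ⟨⟨t, ht, rfl⟩, -⟩
      exact hnotS i t ht)
    (fun i _ t ht _ htG => by
      filter_upwards [eventually_edgePath_mem_frontier hP ht htG.2, isOpen_Ioo.mem_nhds ht]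
        with s h1 h2
      exact ⟨⟨s, h2, rfl⟩, h1⟩)
    (fun i _ t ht _ htG => by
      have h1 : P.edgePath ℝ i t ∉ F := fun h => htG ⟨⟨t, ht, rfl⟩, h⟩
      filter_upwards [(hcurve i).cont.continuousAt.eventually
        (isClosed_frontier.isOpen_compl.mem_nhds h1)] with s hs h
      exact hs h.2)
    (fun i _ j _ hij => (hP.2.2 i j hij).mono
      (inter_subset_left.trans (image_mono Ioo_subset_Ico_self))
      (inter_subset_left.trans (image_mono Ioo_subset_Ico_self)))
    (fun x hx => by
      obtain ⟨i, t, ht, rfl⟩ := exists_mem_halfEdge (frontier_polygonRegion_subset hx)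
      rcases ht.1.eq_or_lt with rfl | h0
      · left
        have : P.edgePath ℝ i 0 = P i := by simp [Polygon.edgePath]
        rw [this] at hx ⊢
        exact hvS i hx
      · exact Or.inr ⟨i, Finset.mem_univ i, ⟨t, ⟨h0, ht.2⟩, rfl⟩, hx⟩)
    (fun i _ => by
      have h0 : P.edgePath ℝ i 0 = P i := by simp [Polygon.edgePath]
      have h1 : P.edgePath ℝ i 1 = P (finRotate n i) := by
        rw [Polygon.edgePath, AffineMap.lineMap_apply_one]
      simp only [h0, h1]
      exact ⟨hvS _, hvS _⟩)
  refine ⟨D, hD.trans ?_⟩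
  have h1 : S.card ≤ n :=
    (Finset.card_filter_le _ _).trans (Finset.card_image_le.trans (by simp))
  have h2 : ∑ i : Fin n, ((S.filter fun x => x ∈ (fun t => P.edgePath ℝ i t) '' Ioo 0 1).card + 1)
      = n := by
    have : ∀ i : Fin n, (S.filter fun x => x ∈ (fun t => P.edgePath ℝ i t) '' Ioo 0 1) = ∅ := by
      intro i
      refine Finset.filter_eq_empty_iff.2 ?_
      rintro _ hx ⟨t, ht, rfl⟩
      exact hnotS i t ht hx
    simp_rw [this]
    simp
  omega

lemma dilate_zero (A : Set Plane) : dilate A 0 = A := by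
  ext x
  simp [mem_dilate]

lemma exists_featureDecomposition_dilate (hP : IsSimplePolygon P) {r : ℝ} (hr : 0 ≤ r) :
    ∃ D : FeatureDecomposition (frontier (dilate (polygonRegion P) r)), D.size ≤ 527 * n := by
  rcases hr.eq_or_lt with rfl | hr
  · obtain ⟨D, hD⟩ := exists_featureDecomposition_frontier_polygonRegion hP
    rw [dilate_zero]
    exact ⟨D, by omega⟩
  · exact exists_featureDecomposition_frontier_dilate hP hr

/-- The upper bound on the complexity of the frontier of `S_α(A, B)`. -/
theorem exists_featureDecomposition_middleSet {m : ℕ} {Q : Polygon Plane m}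
    (hP : IsSimplePolygon P) (hQ : IsSimplePolygon Q) {α : ℝ} (hα : α ∈ Icc (0 : ℝ) 1) :
    ∃ D : FeatureDecomposition (frontier (middleSet (polygonRegion P) (polygonRegion Q) α)),
      D.size ≤ 6 * 528 ^ 2 * (n * m) := by
  obtain ⟨D, hD⟩ := exists_featureDecomposition_dilate hP hα.1
  obtain ⟨D', hD'⟩ := exists_featureDecomposition_dilate hQ (sub_nonneg.2 hα.2)
  obtain ⟨E, hE⟩ := exists_featureDecomposition_inter
    (isCompact_dilate (isCompact_polygonRegion (P := P)) α).isClosed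
    (isCompact_dilate (isCompact_polygonRegion (P := Q)) (1 - α)).isClosed D D'
  refine ⟨E, hE.trans ?_⟩
  have h1 : D.size + 1 ≤ 528 * n := by have := hP.1; omega
  have h2 : D'.size + 1 ≤ 528 * m := by have := hQ.1; omega
  calc 6 * ((D.size + 1) * (D'.size + 1)) ≤ 6 * ((528 * n) * (528 * m)) := by gcongr
    _ = 6 * 528 ^ 2 * (n * m) := by ring

end FrontierRegion

/-! ### Linear images of polygons -/

section Map

variable {n : ℕ} (L : Plane ≃L[ℝ] Plane) (P : Polygon Plane n)

/-- The image of a polygon under a linear automorphism of the plane. -/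
def mapPolygon : Polygon Plane n := ⟨fun i => L (P i)⟩

lemma edgePath_mapPolygon (i : Fin n) (t : ℝ) :
    (mapPolygon L P).edgePath ℝ i t = L (P.edgePath ℝ i t) := by
  simp [Polygon.edgePath, mapPolygon, AffineMap.lineMap_apply]

lemma image_edgePath_mapPolygon (i : Fin n) (s : Set ℝ) :
    (mapPolygon L P).edgePath ℝ i '' s = L '' (P.edgePath ℝ i '' s) := by
  rw [image_image]
  exact image_congr fun t _ => edgePath_mapPolygon L P i t

variable {P} in
lemma IsSimplePolygon.map (hP : IsSimplePolygon P) : IsSimplePolygon (mapPolygon L P) := by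
  refine ⟨hP.1, fun i h => hP.2.1 i (L.injective h), fun i j hij => ?_⟩
  rw [image_edgePath_mapPolygon, image_edgePath_mapPolygon]
  exact (disjoint_image_iff L.injective).2 (hP.2.2 i j hij)

lemma boundary_mapPolygon : (mapPolygon L P).boundary ℝ = L '' P.boundary ℝ := by
  unfold Polygon.boundary
  rw [image_iUnion]
  refine iUnion_congr fun i => ?_
  rw [Polygon.edgeSet_eq_image_edgePath, Polygon.edgeSet_eq_image_edgePath,
    image_edgePath_mapPolygon]

lemma polygonRegion_mapPolygon : polygonRegion (mapPolygon L P) = L '' polygonRegion P := by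
  ext x
  obtain ⟨x, rfl⟩ := L.surjective x
  rw [L.injective.mem_set_image, ← not_iff_not, not_mem_polygonRegion, not_mem_polygonRegion,
    boundary_mapPolygon, L.injective.mem_set_image]
  refine and_congr_right fun hx => not_congr ?_
  have h1 := L.toHomeomorph.image_connectedComponentIn (s := (P.boundary ℝ)ᶜ) (x := x) hx
  have h2 : L.toHomeomorph '' (P.boundary ℝ)ᶜ = (L '' P.boundary ℝ)ᶜ :=
    image_compl_eq L.bijective
  rw [h2] at h1
  change L '' _ = connectedComponentIn _ (L x) at h1
  rw [← h1]
  constructor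
  · intro h
    have := L.symm.lipschitz.isBounded_image h
    rwa [← image_comp, L.symm_comp_self, image_id] at this
  · exact fun h => L.lipschitz.isBounded_image h

end Map

/-! ### Polygons under the graph of a function -/

section Mountain

/-- The polygon with vertices `(x₀ + δ * k, f k)` for `k < n`. -/
noncomputable def mountain (n : ℕ) (x₀ δ : ℝ) (f : ℕ → ℝ) : Polygon Plane n :=
  ⟨fun k => !₂[x₀ + δ * k, f k]⟩

/-- The piecewise linear function through the upper vertices of a mountain polygon. -/
noncomputable def skyline (n : ℕ) (x₀ δ : ℝ) (f : ℕ → ℝ) (x : ℝ) : ℝ :=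
  plMap f (n - 1) ((x - x₀) / δ)

variable {n : ℕ} {x₀ δ : ℝ} {f : ℕ → ℝ}

lemma continuous_skyline : Continuous (skyline n x₀ δ f) :=
  (continuous_plMap f (n - 1)).comp (by fun_prop)

lemma skyline_eq (hδ : 0 < δ) {k : ℕ} (hk : k + 1 < n) {t : ℝ} (ht : t ∈ Icc (0 : ℝ) 1) :
    skyline n x₀ δ f (x₀ + δ * (k + t)) = f k + t * (f (k + 1) - f k) := by
  have h : (x₀ + δ * (k + t) - x₀) / δ = k + t := by
    field_simp
    ring
  rw [skyline, h, plMap_eq f (by omega : k < n - 1) (by linarith [ht.1]) (by linarith [ht.2]),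
    smul_eq_mul]
  ring

lemma skyline_natCast (hδ : 0 < δ) {k : ℕ} (hk : k < n) :
    skyline n x₀ δ f (x₀ + δ * k) = f k := by
  have h : (x₀ + δ * k - x₀) / δ = k := by
    field_simp
    ring
  rw [skyline, h, plMap_natCast f (by omega)]

lemma exists_nat_of_mem_Ico {x : ℝ} (hδ : 0 < δ) {N : ℕ} (hx : x ∈ Ico x₀ (x₀ + δ * N)) :
    ∃ k : ℕ, k < N ∧ ∃ t ∈ Ico (0 : ℝ) 1, x = x₀ + δ * (k + t) := by
  have h0 : 0 ≤ (x - x₀) / δ := div_nonneg (by linarith [hx.1]) hδ.le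
  have h1 : (x - x₀) / δ < N := by
    rw [div_lt_iff₀ hδ]
    linarith [hx.2]
  refine ⟨⌊(x - x₀) / δ⌋₊, (Nat.floor_lt h0).2 h1, (x - x₀) / δ - ⌊(x - x₀) / δ⌋₊,
    ⟨by linarith [Nat.floor_le h0], by linarith [Nat.lt_floor_add_one ((x - x₀) / δ)]⟩, ?_⟩
  field_simp
  ring

/-- The conditions on the heights of a mountain polygon: they are positive, except that the first
and the last one are zero. -/
structure IsHeights (n : ℕ) (f : ℕ → ℝ) : Prop where
  three_le : 3 ≤ n
  zero : f 0 = 0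
  last : f (n - 1) = 0
  pos : ∀ k, 0 < k → k < n - 1 → 0 < f k

lemma IsHeights.nonneg (hf : IsHeights n f) {k : ℕ} (hk : k < n) : 0 ≤ f k := by
  rcases Nat.eq_zero_or_pos k with rfl | h
  · exact hf.zero.ge
  · rcases Nat.lt_or_ge k (n - 1) with h' | h'
    · exact (hf.pos k h h').le
    · obtain rfl : k = n - 1 := by omega
      exact hf.last.ge

lemma IsHeights.skyline_nonneg (hf : IsHeights n f) (hδ : 0 < δ) {x : ℝ}
    (hx : x ∈ Icc x₀ (x₀ + δ * (n - 1 : ℕ))) : 0 ≤ skyline n x₀ δ f x := by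
  rcases hx.2.lt_or_eq with h | rfl
  · obtain ⟨k, hk, t, ht, rfl⟩ := exists_nat_of_mem_Ico hδ ⟨hx.1, h⟩
    rw [skyline_eq hδ (by omega) ⟨ht.1, ht.2.le⟩]
    nlinarith [hf.nonneg (show k < n by omega), hf.nonneg (show k + 1 < n by omega), ht.1, ht.2]
  · rw [skyline_natCast hδ (by have := hf.three_le; omega), hf.last]

lemma skyline_le (hδ : 0 < δ) {x M : ℝ} (hM : ∀ k < n, f k ≤ M) (hn : 0 < n)
    (hx : x ∈ Icc x₀ (x₀ + δ * (n - 1 : ℕ))) : skyline n x₀ δ f x ≤ M := by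
  rcases hx.2.lt_or_eq with h | rfl
  · obtain ⟨k, hk, t, ht, rfl⟩ := exists_nat_of_mem_Ico hδ ⟨hx.1, h⟩
    rw [skyline_eq hδ (by omega) ⟨ht.1, ht.2.le⟩]
    nlinarith [hM k (by omega), hM (k + 1) (by omega), ht.1, ht.2]
  · rw [skyline_natCast hδ (by omega)]
    exact hM _ (by omega)

lemma IsHeights.skyline_pos (hf : IsHeights n f) (hδ : 0 < δ) {x : ℝ}
    (hx : x ∈ Ioo x₀ (x₀ + δ * (n - 1 : ℕ))) : 0 < skyline n x₀ δ f x := by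
  obtain ⟨k, hk, t, ht, rfl⟩ := exists_nat_of_mem_Ico hδ ⟨hx.1.le, hx.2⟩
  rw [skyline_eq hδ (by omega) ⟨ht.1, ht.2.le⟩]
  rcases Nat.eq_zero_or_pos k with rfl | h
  · have h1 := hf.pos 1 one_pos (by have := hf.three_le; omega)
    have h2 : 0 < t := by
      have := hx.1
      simp only [Nat.cast_zero, zero_add, lt_add_iff_pos_right] at this
      exact (mul_pos_iff_of_pos_left hδ).1 this
    rw [hf.zero]
    simp only [zero_add, sub_zero]
    positivity
  · have h1 := hf.pos k h hk
    have h2 := hf.nonneg (show k + 1 < n by omega)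
    nlinarith [mul_pos (sub_pos.2 ht.2) h1, mul_nonneg ht.1 h2]

lemma edgePath_mountain_of_lt {i : Fin n} (hi : (i : ℕ) + 1 < n) (t : ℝ) :
    (mountain n x₀ δ f).edgePath ℝ i t = !₂[x₀ + δ * (i + t), f i + t * (f (i + 1) - f i)] := by
  have h : (finRotate n i : ℕ) = i + 1 := by rw [coe_finRotate_eq, Nat.mod_eq_of_lt hi]
  rw [Polygon.edgePath, Plane.ext_iff', lineMap_coord_zero, lineMap_coord_one]
  simp only [mountain, h]
  simp
  ring

lemma edgePath_mountain_last (hf : IsHeights n f) {i : Fin n} (hi : (i : ℕ) + 1 = n) (t : ℝ) :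
    (mountain n x₀ δ f).edgePath ℝ i t = !₂[x₀ + δ * ((1 - t) * (n - 1 : ℕ)), 0] := by
  have h : (finRotate n i : ℕ) = 0 := by rw [coe_finRotate_eq, hi, Nat.mod_self]
  have h' : (i : ℕ) = n - 1 := by omega
  rw [Polygon.edgePath, Plane.ext_iff', lineMap_coord_zero, lineMap_coord_one]
  simp only [mountain, h, h']
  simp [hf.zero, hf.last]
  ring

lemma isSimplePolygon_mountain (hf : IsHeights n f) (hδ : 0 < δ) :
    IsSimplePolygon (mountain n x₀ δ f) := by
  have hn := hf.three_le
  have hn1 : (0 : ℝ) < (n - 1 : ℕ) := by exact_mod_cast (by omega : 0 < n - 1)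
  refine ⟨hn, fun i h => ?_, ?_⟩
  · have h0 := congrArg (fun p : Plane => p 0) h
    simp only [mountain] at h0
    simp [hδ.ne'] at h0
    have h1 := coe_finRotate_eq i
    rw [finRotate_apply, ← h0] at h1
    rcases Nat.lt_or_ge ((i : ℕ) + 1) n with h2 | h2
    · rw [Nat.mod_eq_of_lt h2] at h1
      omega
    · have h3 : (i : ℕ) + 1 = n := by omega
      rw [h3, Nat.mod_self] at h1
      omega
  · -- an upper edge meets the base only in the first vertex, which the base does not contain
    have hbase : ∀ i j : Fin n, (i : ℕ) + 1 < n → (j : ℕ) + 1 = n →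
        Disjoint ((mountain n x₀ δ f).edgePath ℝ i '' Ico (0 : ℝ) 1)
          ((mountain n x₀ δ f).edgePath ℝ j '' Ico (0 : ℝ) 1) := by
      intro i j hi hj
      rw [Set.disjoint_left]
      rintro _ ⟨t, ht, rfl⟩ ⟨s, hs, h⟩
      rw [edgePath_mountain_last hf hj, edgePath_mountain_of_lt hi, Plane.ext_iff'] at h
      simp only [Matrix.cons_val_zero, Matrix.cons_val_one] at h
      have h1 : 0 < (i : ℝ) + t := by
        have : 0 < (1 - s) * ((n - 1 : ℕ) : ℝ) := mul_pos (by linarith [hs.2]) hn1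
        nlinarith [h.1]
      have h2 : (i : ℝ) + t < (n - 1 : ℕ) := by
        have : (i : ℝ) + 1 ≤ (n - 1 : ℕ) := by exact_mod_cast (by omega : (i : ℕ) + 1 ≤ n - 1)
        linarith [ht.2]
      have h3 := hf.skyline_pos (x₀ := x₀) hδ (x := x₀ + δ * (i + t))
        ⟨by nlinarith, by nlinarith⟩
      rw [skyline_eq hδ hi ⟨ht.1, ht.2.le⟩] at h3
      linarith [h.2]
    intro i j hij
    have hij' : (i : ℕ) ≠ j := fun h => hij (Fin.ext h)
    by_cases hi : (i : ℕ) + 1 < n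
    · by_cases hj : (j : ℕ) + 1 < n
      · rw [Set.disjoint_left]
        rintro _ ⟨t, ht, rfl⟩ ⟨s, hs, h⟩
        rw [edgePath_mountain_of_lt hi, edgePath_mountain_of_lt hj, Plane.ext_iff'] at h
        have h0 := h.1
        simp only [Matrix.cons_val_zero] at h0
        have h1 : (j : ℝ) + s = i + t := by
          have := mul_left_cancel₀ hδ.ne' (add_left_cancel h0)
          exact this
        rcases lt_or_gt_of_ne hij' with h2 | h2
        · have : (i : ℝ) + 1 ≤ j := by exact_mod_cast h2
          linarith [ht.2, hs.1]
        · have : (j : ℝ) + 1 ≤ i := by exact_mod_cast h2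
          linarith [hs.2, ht.1]
      · exact hbase i j hi (by omega)
    · exact (hbase j i (by omega) (by omega)).symm

lemma boundary_mountain (hf : IsHeights n f) (hδ : 0 < δ) :
    (mountain n x₀ δ f).boundary ℝ = {p | p 0 ∈ Icc x₀ (x₀ + δ * (n - 1 : ℕ)) ∧
      (p 1 = skyline n x₀ δ f (p 0) ∨ p 1 = 0)} := by
  have hn := hf.three_le
  have hn1 : (0 : ℝ) < (n - 1 : ℕ) := by exact_mod_cast (by omega : 0 < n - 1)
  ext p
  constructor
  · intro hp
    obtain ⟨i, t, ht, rfl⟩ := mem_iUnion.1 hp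
    change (mountain n x₀ δ f).edgePath ℝ i t ∈ _
    by_cases hi : (i : ℕ) + 1 < n
    · rw [edgePath_mountain_of_lt hi]
      have : (i : ℝ) + 1 ≤ (n - 1 : ℕ) := by exact_mod_cast (by omega : (i : ℕ) + 1 ≤ n - 1)
      refine ⟨⟨?_, ?_⟩, Or.inl ?_⟩
      · have : 0 ≤ δ * (i + t) := by have := ht.1; positivity
        simpa using this
      · have : δ * (i + t) ≤ δ * (n - 1 : ℕ) := by
          gcongr
          linarith [ht.2]
        simpa using this
      · simp [skyline_eq hδ hi ht]
    · rw [edgePath_mountain_last hf (by omega)]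
      refine ⟨⟨?_, ?_⟩, Or.inr (by simp)⟩
      · have : 0 ≤ δ * ((1 - t) * (n - 1 : ℕ)) := by
          have : 0 ≤ 1 - t := by linarith [ht.2]
          positivity
        simpa using this
      · have : δ * ((1 - t) * (n - 1 : ℕ)) ≤ δ * (n - 1 : ℕ) := by
          gcongr
          nlinarith [ht.1]
        simpa using this
  · rintro ⟨hp, h⟩
    rcases h with h | h
    · refine mem_iUnion.2 ?_
      rcases hp.2.lt_or_eq with hlt | heq
      · obtain ⟨k, hk, t, ht, hx⟩ := exists_nat_of_mem_Ico hδ ⟨hp.1, hlt⟩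
        refine ⟨⟨k, by omega⟩, t, ⟨ht.1, ht.2.le⟩, ?_⟩
        change (mountain n x₀ δ f).edgePath ℝ _ t = p
        rw [edgePath_mountain_of_lt (by simp; omega), Plane.ext_iff', h, hx,
          skyline_eq hδ (by omega) ⟨ht.1, ht.2.le⟩]
        simp
      · refine ⟨⟨n - 1, by omega⟩, 0, ⟨le_rfl, zero_le_one⟩, ?_⟩
        change (mountain n x₀ δ f).edgePath ℝ _ 0 = p
        rw [edgePath_mountain_last hf (by simp; omega), Plane.ext_iff', h, heq,
          skyline_natCast hδ (by omega), hf.last]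
        simp
    · refine mem_iUnion.2 ⟨⟨n - 1, by omega⟩, 1 - (p 0 - x₀) / (δ * (n - 1 : ℕ)), ⟨?_, ?_⟩, ?_⟩
      · rw [sub_nonneg, div_le_one (by positivity)]
        linarith [hp.2]
      · have : 0 ≤ (p 0 - x₀) / (δ * (n - 1 : ℕ)) := div_nonneg (by linarith [hp.1]) (by positivity)
        linarith
      · change (mountain n x₀ δ f).edgePath ℝ _ _ = p
        rw [edgePath_mountain_last hf (by simp; omega), Plane.ext_iff', h]
        refine ⟨?_, by simp⟩
        simp only [Matrix.cons_val_zero, sub_sub_cancel]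
        field_simp
        ring

/-- The region bounded by a mountain polygon is the region between the base and the skyline. -/
lemma polygonRegion_mountain (hf : IsHeights n f) (hδ : 0 < δ) :
    polygonRegion (mountain n x₀ δ f) = {p | p 0 ∈ Icc x₀ (x₀ + δ * (n - 1 : ℕ)) ∧
      p 1 ∈ Icc 0 (skyline n x₀ δ f (p 0))} := by
  set R : Set Plane := {p | p 0 ∈ Icc x₀ (x₀ + δ * (n - 1 : ℕ)) ∧
    p 1 ∈ Icc 0 (skyline n x₀ δ f (p 0))} with hR
  have hsub : (mountain n x₀ δ f).boundary ℝ ⊆ R := by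
    rw [boundary_mountain hf hδ]
    rintro p ⟨hp, h | h⟩
    · exact ⟨hp, h ▸ hf.skyline_nonneg hδ hp, h.le⟩
    · exact ⟨hp, h.ge, h.le.trans (hf.skyline_nonneg hδ hp)⟩
  have hc0 : Continuous fun p : Plane => p 0 := by fun_prop
  have hc1 : Continuous fun p : Plane => p 1 := by fun_prop
  have hcs : Continuous fun p : Plane => skyline n x₀ δ f (p 0) := continuous_skyline.comp hc0
  have hRcl : IsClosed R := by
    refine ((isClosed_Icc.preimage hc0).inter ?_)
    exact (isClosed_le continuous_const hc1).inter (isClosed_le hc1 hcs)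
  apply Subset.antisymm
  · -- every point outside `R` is the end of a ray that avoids `R`
    intro p hp
    by_contra hpR
    have key : ∀ u : Plane, u ≠ 0 → (∀ t : ℝ, 0 ≤ t → p + t • u ∉ R) → False := fun u hu h =>
      not_mem_polygonRegion_of_ray hu (fun t ht h' => h t ht (hsub h')) hp
    have hv0 : ∀ u : Plane, ∀ t : ℝ, (p + t • u) 0 = p 0 + t * u 0 := fun u t => by simp
    have hv1 : ∀ u : Plane, ∀ t : ℝ, (p + t • u) 1 = p 1 + t * u 1 := fun u t => by simp
    have hne : ∀ a b : ℝ, (a ≠ 0 ∨ b ≠ 0) → (!₂[a, b] : Plane) ≠ 0 := by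
      intro a b hab h
      rw [Plane.ext_iff'] at h
      simp at h
      tauto
    by_cases h1 : p 0 < x₀
    · refine key !₂[-1, 0] (hne _ _ (by norm_num)) fun t ht h => ?_
      have := h.1.1
      rw [hv0] at this
      simp at this
      linarith
    by_cases h2 : x₀ + δ * (n - 1 : ℕ) < p 0
    · refine key !₂[1, 0] (hne _ _ (by norm_num)) fun t ht h => ?_
      have := h.1.2
      rw [hv0] at this
      simp at this
      linarith
    by_cases h3 : p 1 < 0
    · refine key !₂[0, -1] (hne _ _ (by norm_num)) fun t ht h => ?_
      have := h.2.1
      rw [hv1] at this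
      simp at this
      linarith
    · refine key !₂[0, 1] (hne _ _ (by norm_num)) fun t ht h => hpR ?_
      have h4 := h.2.2
      rw [hv1, hv0] at h4
      simp at h4
      push Not at h1 h2 h3
      exact ⟨⟨h1, h2⟩, h3, by linarith⟩
  · -- the complement of the boundary curve is the union of the open sets `R \ Γ` and `Rᶜ`
    intro p hp
    by_cases hpb : p ∈ (mountain n x₀ δ f).boundary ℝ
    · exact Or.inl hpb
    refine Or.inr ⟨hpb, ?_⟩
    set U : Set Plane := {p | p 0 ∈ Ioo x₀ (x₀ + δ * (n - 1 : ℕ)) ∧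
      p 1 ∈ Ioo 0 (skyline n x₀ δ f (p 0))} with hU
    have hUR : U ⊆ R := fun q hq => ⟨Ioo_subset_Icc_self hq.1, Ioo_subset_Icc_self hq.2⟩
    have hUo : IsOpen U := by
      refine (isOpen_Ioo.preimage hc0).inter ?_
      exact (isOpen_lt continuous_const hc1).inter (isOpen_lt hc1 hcs)
    have hcover : ∀ q ∈ R, q ∉ (mountain n x₀ δ f).boundary ℝ → q ∈ U := by
      intro q hq hqb
      rw [boundary_mountain hf hδ, mem_ofPred_eq, not_and, not_or] at hqb
      obtain ⟨h1, h2⟩ := hqb hq.1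
      have h3 : 0 < q 1 := lt_of_le_of_ne hq.2.1 (Ne.symm h2)
      have h4 : q 1 < skyline n x₀ δ f (q 0) := lt_of_le_of_ne hq.2.2 h1
      refine ⟨⟨lt_of_le_of_ne hq.1.1 fun h => ?_, lt_of_le_of_ne hq.1.2 fun h => ?_⟩, h3, h4⟩
      · have h5 := skyline_natCast (x₀ := x₀) (f := f) hδ (show 0 < n by have := hf.three_le; omega)
        simp only [Nat.cast_zero, mul_zero, add_zero, hf.zero] at h5
        rw [← h, h5] at h4
        linarith
      · have h5 := skyline_natCast (x₀ := x₀) (f := f) hδ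
          (show n - 1 < n by have := hf.three_le; omega)
        rw [hf.last] at h5
        rw [h, h5] at h4
        linarith
    have hRbdd : Bornology.IsBounded R := by
      have hn := hf.three_le
      obtain ⟨M, hM⟩ := ((isCompact_Icc (a := x₀) (b := x₀ + δ * (n - 1 : ℕ))).image
        (continuous_skyline (n := n) (x₀ := x₀) (δ := δ) (f := f))).bddAbove
      refine (Metric.isBounded_iff_subset_closedBall !₂[x₀, 0]).2
        ⟨√((δ * (n - 1 : ℕ)) ^ 2 + M ^ 2), fun q hq => ?_⟩
      rw [Metric.mem_closedBall, Plane.dist_le_iff (Real.sqrt_nonneg _), Real.sq_sqrt (by positivity)]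
      have h1 := hM ⟨q 0, hq.1, rfl⟩
      have h2 := hq.2.1
      have h3 := hq.2.2
      have h4 := hq.1.1
      have h5 := hq.1.2
      simp
      gcongr
      · linarith
      · linarith
    refine hRbdd.subset (Subset.trans ?_ hUR)
    refine isPreconnected_connectedComponentIn.subset_left_of_subset_union hUo hRcl.isOpen_compl
      (Set.disjoint_left.2 fun q hq h => h (hUR hq)) (fun q hq => ?_)
      ⟨p, mem_connectedComponentIn hpb, hcover p hp hpb⟩
    by_cases hqR : q ∈ R
    · exact Or.inl (hcover q hqR (connectedComponentIn_subset _ _ hq))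
    · exact Or.inr hqR

end Mountain

/-! ### Counting features -/

section Counting

variable {F : Set Plane} (L : Plane ≃L[ℝ] Plane) (D : FeatureDecomposition (L '' F))

open scoped Classical in
/-- The vertices, as singletons, and edges of a subdivision. -/
noncomputable def FeatureDecomposition.features {X : Set Plane} (D : FeatureDecomposition X) :
    Finset (Set Plane) := D.vertices.image (fun v => {v}) ∪ D.edges

namespace FeatureDecomposition

variable {X : Set Plane} (E : FeatureDecomposition X)

lemma card_features_le : E.features.card ≤ E.size := by
  classical
  refine (Finset.card_union_le _ _).trans (le_trans ?_ E.card_vertices_add_card_edges_le)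
  gcongr
  exact Finset.card_image_le

lemma eq_singleton_or_isEdge {s : Set Plane} (hs : s ∈ E.features) :
    (∃ v, s = {v}) ∨ ∃ p q, IsEdge s p q := by
  classical
  rcases Finset.mem_union.1 hs with h | h
  · obtain ⟨v, -, rfl⟩ := Finset.mem_image.1 h
    exact Or.inl ⟨v, rfl⟩
  · obtain ⟨p, -, q, -, h⟩ := E.edge_spec h
    exact Or.inr ⟨p, q, h⟩

lemma subset_of_mem_features {s : Set Plane} (hs : s ∈ E.features) : s ⊆ X := by
  classical
  rcases Finset.mem_union.1 hs with h | h
  · obtain ⟨v, hv, rfl⟩ := Finset.mem_image.1 h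
    exact singleton_subset_iff.2 (E.mem_iff.2 (Or.inl hv))
  · exact E.edge_subset h

lemma exists_mem_features {x : Plane} (hx : x ∈ X) : ∃ s ∈ E.features, x ∈ s := by
  classical
  rcases E.mem_iff.1 hx with h | ⟨e, he, hxe⟩
  · exact ⟨{x}, Finset.mem_union_left _ (Finset.mem_image_of_mem _ h), rfl⟩
  · exact ⟨e, Finset.mem_union_right _ he, hxe⟩

end FeatureDecomposition

lemma inter_frontier_nonempty_of_isPreconnected {X : Type*} [TopologicalSpace X] {s O : Set X}
    (hs : IsPreconnected s) (h1 : (s ∩ O).Nonempty) (h2 : (s ∩ Oᶜ).Nonempty) :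
    (s ∩ frontier O).Nonempty := by
  by_contra hne
  have hfr : ∀ x ∈ s, x ∉ frontier O := fun x hx h => hne ⟨x, hx, h⟩
  have h3 : ∀ x ∈ s, x ∈ closure O → x ∈ interior O := fun x hx h => by
    by_contra hi
    exact hfr x hx ⟨h, hi⟩
  obtain ⟨x, hx, hxO⟩ := h1
  obtain ⟨y, hy, hyO⟩ := h2
  obtain ⟨z, -, hz, hz'⟩ := hs (interior O) (closure O)ᶜ isOpen_interior
    isClosed_closure.isOpen_compl
    (fun z hz => or_iff_not_imp_right.2 fun h => h3 z hz (not_not.1 h))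
    ⟨x, hx, h3 x hx (subset_closure hxO)⟩ ⟨y, hy, fun h => hyO (interior_subset (h3 y hy h))⟩
  exact hz' (interior_subset_closure hz)

/-- A set that meets disjoint cells, but not their frontiers, has at least as many features as
there are cells, because features are connected. -/
lemma card_le_size_of_cells {ι : Type*} {I : Finset ι} {O : ι → Set Plane}
    (hdis : ∀ i ∈ I, ∀ j ∈ I, i ≠ j → Disjoint (O i) (O j))
    (hfr : ∀ i ∈ I, Disjoint F (frontier (O i))) (hne : ∀ i ∈ I, (F ∩ O i).Nonempty) :
    I.card ≤ D.size := by
  have key : ∀ i ∈ I, ∃ s ∈ D.features, s.Nonempty ∧ s ⊆ L '' O i := by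
    intro i hi
    obtain ⟨x, hxF, hxO⟩ := hne i hi
    obtain ⟨s, hs, hxs⟩ := D.exists_mem_features (mem_image_of_mem L hxF)
    refine ⟨s, hs, ⟨_, hxs⟩, ?_⟩
    by_contra hsub
    obtain ⟨y, hys, hyO⟩ := not_subset.1 hsub
    have hconn : IsPreconnected s := by
      rcases D.eq_singleton_or_isEdge hs with ⟨v, rfl⟩ | ⟨p, q, h⟩
      · exact isPreconnected_singleton
      · obtain ⟨γ, a, b, hγ, rfl, -, -⟩ := h.exists_curve
        exact isPreconnected_Ioo.image _ hγ.cont.continuousOn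
    obtain ⟨z, hzs, hzfr⟩ := inter_frontier_nonempty_of_isPreconnected hconn ⟨_, hxs, mem_image_of_mem L hxO⟩
      ⟨y, hys, hyO⟩
    have hfrL : frontier (L '' O i) = L '' frontier (O i) :=
      (L.toHomeomorph.image_frontier (O i)).symm
    rw [hfrL] at hzfr
    exact Set.disjoint_left.1 ((disjoint_image_iff L.injective).2 (hfr i hi))
      (D.subset_of_mem_features hs hzs) hzfr
  choose! s hs hsne hsO using key
  refine (Finset.card_le_card_of_injOn s hs ?_).trans D.card_features_le
  intro i hi j hj hij
  by_contra hne
  obtain ⟨x, hx⟩ := hsne i hi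
  exact Set.disjoint_left.1 ((disjoint_image_iff L.injective).2 (hdis i hi j hj hne))
    (hsO i hi hx) (hsO j hj (hij ▸ hx))

/-- Near each of the points `x i`, the segment `p q` leaves the subdivided set. A feature through
such a point does not coincide with the segment locally, so it contains at most two of them. -/
lemma card_le_two_mul_size_of_openSegment {ι : Type*} {I : Finset ι} {p q : Plane} (hpq : p ≠ q)
    {x : ι → Plane} (hinj : InjOn x I) (hx : ∀ i ∈ I, x i ∈ F)
    (hxs : ∀ i ∈ I, x i ∈ openSegment ℝ p q)
    (hcl : ∀ i ∈ I, x i ∈ closure (openSegment ℝ p q \ F)) : I.card ≤ 2 * D.size := by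
  classical
  have hseg : L '' openSegment ℝ p q = openSegment ℝ (L p) (L q) :=
    image_openSegment ℝ (L : Plane →ₗ[ℝ] Plane).toAffineMap p q
  have hline : IsEdge (L '' openSegment ℝ p q) (L p) (L q) :=
    Or.inl ⟨L.injective.ne hpq, hseg⟩
  have hinjL : InjOn (fun i => L (x i)) I := fun i hi j hj h => hinj hi hj (L.injective h)
  have key : ∀ s ∈ D.features, (I.filter fun i => L (x i) ∈ s).card ≤ 2 := by
    intro s hs
    have : ∃ B : Finset Plane, B.card ≤ 2 ∧ ∀ i ∈ I, L (x i) ∈ s → L (x i) ∈ B := by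
      rcases D.eq_singleton_or_isEdge hs with ⟨v, rfl⟩ | ⟨a, b, h⟩
      · exact ⟨{v}, by simp, fun i _ hi => by simpa using hi⟩
      · obtain ⟨B, hB, hB'⟩ := h.inter hline
        refine ⟨B, hB, fun i hi his => ?_⟩
        by_contra hiB
        have h1 := (hB' _ his (mem_image_of_mem L (hxs i hi)) hiB).2
        have h2 : L (x i) ∈ closure (L '' (openSegment ℝ p q \ F)) :=
          image_closure_subset_closure_image L.continuous (mem_image_of_mem L (hcl i hi))
        rw [image_sdiff L.injective] at h2
        obtain ⟨U, hU, hUs⟩ := mem_nhdsWithin_iff_exists_mem_nhds_inter.1 h1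
        obtain ⟨y, hyU, hyL, hyF⟩ := mem_closure_iff_nhds.1 h2 U hU
        exact hyF (D.subset_of_mem_features hs (hUs ⟨hyU, hyL⟩))
    obtain ⟨B, hB, hB'⟩ := this
    refine (Finset.card_le_card_of_injOn (fun i => L (x i)) (t := B) (fun i hi => ?_) ?_).trans hB
    · obtain ⟨hi, his⟩ := Finset.mem_filter.1 hi
      exact hB' i hi his
    · exact hinjL.mono fun i hi => (Finset.mem_filter.1 hi).1
  calc I.card ≤ (D.features.biUnion fun s => I.filter fun i => L (x i) ∈ s).card := by
        refine Finset.card_le_card fun i hi => ?_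
        obtain ⟨s, hs, his⟩ := D.exists_mem_features (mem_image_of_mem L (hx i hi))
        exact Finset.mem_biUnion.2 ⟨s, hs, Finset.mem_filter.2 ⟨hi, his⟩⟩
    _ ≤ D.features.card * 2 := Finset.card_biUnion_le_card_mul _ _ _ key
    _ ≤ 2 * D.size := by
        have := D.card_features_le
        omega

end Counting

/-! ### Rescaling to Hausdorff distance one -/

section Scaling

/-- The homothety with center `0` and a given nonzero factor. -/
noncomputable def scaling {c : ℝ} (hc : c ≠ 0) : Plane ≃L[ℝ] Plane :=
  ContinuousLinearEquiv.smulLeft (Units.mk0 c hc)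

lemma scaling_apply {c : ℝ} (hc : c ≠ 0) (x : Plane) : scaling hc x = c • x := rfl

lemma dist_scaling {c : ℝ} (hc : 0 < c) (x y : Plane) :
    dist (scaling hc.ne' x) (scaling hc.ne' y) = c * dist x y := by
  rw [scaling_apply, scaling_apply, dist_smul₀, Real.norm_of_nonneg hc.le]

lemma dilate_image_scaling {c : ℝ} (hc : 0 < c) (A : Set Plane) (r : ℝ) :
    dilate (scaling hc.ne' '' A) (c * r) = scaling hc.ne' '' dilate A r := by
  ext x
  obtain ⟨x, rfl⟩ := (scaling hc.ne').surjective x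
  rw [(scaling hc.ne').injective.mem_set_image, mem_dilate, mem_dilate, exists_mem_image]
  simp only [dist_scaling hc, mul_le_mul_iff_right₀ hc]

variable {A B : Set Plane}

lemma exists_dist_le_hausdorffDist (hA : IsCompact A) (hB : IsCompact B) (hAn : A.Nonempty)
    (hBn : B.Nonempty) {x : Plane} (hx : x ∈ A) : ∃ y ∈ B, dist x y ≤ Metric.hausdorffDist A B := by
  obtain ⟨y, hy, h⟩ := hB.exists_infDist_eq_dist hBn x
  refine ⟨y, hy, h ▸ Metric.infDist_le_hausdorffDist_of_mem hx ?_⟩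
  exact Metric.hausdorffEDist_ne_top_of_nonempty_of_bounded hAn hBn hA.isBounded hB.isBounded

lemma hausdorffDist_image_scaling (hA : IsCompact A) (hB : IsCompact B) (hAn : A.Nonempty)
    (hBn : B.Nonempty) {c : ℝ} (hc : 0 < c) :
    Metric.hausdorffDist (scaling hc.ne' '' A) (scaling hc.ne' '' B) =
      c * Metric.hausdorffDist A B := by
  set S := scaling hc.ne'
  have hSA := hA.image S.continuous
  have hSB := hB.image S.continuous
  have h1 : ∀ {A B : Set Plane}, IsCompact A → IsCompact B → A.Nonempty → B.Nonempty →
      ∀ x ∈ S '' A, ∃ y ∈ S '' B, dist x y ≤ c * Metric.hausdorffDist A B := by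
    rintro A B hA hB hAn hBn _ ⟨x, hx, rfl⟩
    obtain ⟨y, hy, h⟩ := exists_dist_le_hausdorffDist hA hB hAn hBn hx
    refine ⟨S y, mem_image_of_mem S hy, ?_⟩
    rw [dist_scaling hc]
    gcongr
  have h2 : ∀ {A B : Set Plane}, IsCompact A → IsCompact B → A.Nonempty → B.Nonempty →
      ∀ x ∈ A, ∃ y ∈ B, dist x y ≤ Metric.hausdorffDist (S '' A) (S '' B) / c := by
    intro A B hA hB hAn hBn x hx
    obtain ⟨_, ⟨y, hy, rfl⟩, h⟩ := exists_dist_le_hausdorffDist (hA.image S.continuous)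
      (hB.image S.continuous) (hAn.image S) (hBn.image S) (mem_image_of_mem S hx)
    refine ⟨y, hy, ?_⟩
    rw [dist_scaling hc] at h
    rw [le_div_iff₀ hc]
    linarith
  apply le_antisymm
  · refine Metric.hausdorffDist_le_of_mem_dist (mul_nonneg hc.le Metric.hausdorffDist_nonneg)
      (h1 hA hB hAn hBn) ?_
    rw [Metric.hausdorffDist_comm]
    exact h1 hB hA hBn hAn
  · rw [mul_comm, ← le_div_iff₀ hc]
    refine Metric.hausdorffDist_le_of_mem_dist (div_nonneg Metric.hausdorffDist_nonneg hc.le)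
      (h2 hA hB hAn hBn) ?_
    rw [Metric.hausdorffDist_comm]
    exact h2 hB hA hBn hAn

lemma nonempty_polygonRegion {n : ℕ} {P : Polygon Plane n} (hP : IsSimplePolygon P) :
    (polygonRegion P).Nonempty :=
  ⟨P ⟨0, by have := hP.1; omega⟩, boundary_subset_polygonRegion
    (halfEdge_subset_boundary _ (vertex_mem_halfEdge _))⟩

/-- Two different polygons can be rescaled to Hausdorff distance one. -/
lemma exists_polygons_hausdorffDist_eq_one {n m : ℕ} {P : Polygon Plane n} {Q : Polygon Plane m}
    (hP : IsSimplePolygon P) (hQ : IsSimplePolygon Q) {h : ℝ}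
    (hh : h = Metric.hausdorffDist (polygonRegion P) (polygonRegion Q))
    (hne : polygonRegion P ≠ polygonRegion Q) {K : ℝ}
    (hK : 0 < h → ∀ (L : Plane ≃L[ℝ] Plane) (D : FeatureDecomposition (L '' frontier
      (dilate (polygonRegion P) (h / 2) ∩ dilate (polygonRegion Q) (h / 2)))), K ≤ D.size) :
    ∃ (P' : Polygon Plane n) (Q' : Polygon Plane m), IsSimplePolygon P' ∧ IsSimplePolygon Q' ∧
      Metric.hausdorffDist (polygonRegion P') (polygonRegion Q') = 1 ∧
      ∀ D : FeatureDecomposition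
        (frontier (middleSet (polygonRegion P') (polygonRegion Q') (1 / 2))), K ≤ D.size := by
  have hPc := isCompact_polygonRegion (P := P)
  have hQc := isCompact_polygonRegion (P := Q)
  have hpos : 0 < h := by
    rw [hh]
    refine lt_of_le_of_ne Metric.hausdorffDist_nonneg fun h0 => hne ?_
    exact (hPc.isClosed.hausdorffDist_zero_iff_eq hQc.isClosed
      (Metric.hausdorffEDist_ne_top_of_nonempty_of_bounded (nonempty_polygonRegion hP)
        (nonempty_polygonRegion hQ) hPc.isBounded hQc.isBounded)).1 h0.symm
  have hc : 0 < h⁻¹ := inv_pos.2 hpos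
  refine ⟨mapPolygon (scaling hc.ne') P, mapPolygon (scaling hc.ne') Q, hP.map _, hQ.map _, ?_, ?_⟩
  · rw [polygonRegion_mapPolygon, polygonRegion_mapPolygon, hausdorffDist_image_scaling hPc hQc
      (nonempty_polygonRegion hP) (nonempty_polygonRegion hQ), ← hh, inv_mul_cancel₀ hpos.ne']
    exact hc
  · have h1 : middleSet (polygonRegion (mapPolygon (scaling hc.ne') P))
        (polygonRegion (mapPolygon (scaling hc.ne') Q)) (1 / 2) = scaling hc.ne' ''
        (dilate (polygonRegion P) (h / 2) ∩ dilate (polygonRegion Q) (h / 2)) := by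
      rw [middleSet, polygonRegion_mapPolygon, polygonRegion_mapPolygon,
        image_inter (scaling hc.ne').injective, ← dilate_image_scaling hc,
        ← dilate_image_scaling hc]
      have : h⁻¹ * (h / 2) = 1 / 2 := by field_simp
      rw [this]
      norm_num
    have h2 : frontier (middleSet (polygonRegion (mapPolygon (scaling hc.ne') P))
        (polygonRegion (mapPolygon (scaling hc.ne') Q)) (1 / 2)) = scaling hc.ne' '' frontier
        (dilate (polygonRegion P) (h / 2) ∩ dilate (polygonRegion Q) (h / 2)) := by
      rw [h1]
      exact ((scaling hc.ne').toHomeomorph.image_frontier _).symm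
    rw [h2]
    exact hK hpos _

end Scaling

/-! ### Zigzag polygons -/

section Zigzag

/-- The heights of a zigzag polygon: `0` at both ends, and in between high tips at odd positions
and low notches at even positions. -/
noncomputable def zigzag (n : ℕ) (T : ℝ) (k : ℕ) : ℝ :=
  if k = 0 ∨ n - 1 ≤ k then 0 else if Odd k then T else 1 / 8

variable {n : ℕ} {T : ℝ} {x₀ δ : ℝ}

lemma zigzag_of_odd {k : ℕ} (hk : Odd k) (hkn : k < n - 1) : zigzag n T k = T := by
  have : ¬ (k = 0 ∨ n - 1 ≤ k) := by
    have := hk.pos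
    omega
  rw [zigzag, if_neg this, if_pos hk]

lemma zigzag_le_of_even {k : ℕ} (hk : Even k) : zigzag n T k ≤ 1 / 8 := by
  unfold zigzag
  split_ifs with h h'
  · norm_num
  · exact absurd hk (Nat.not_even_iff_odd.2 h')
  · exact le_rfl

lemma zigzag_le (hT : 1 / 8 ≤ T) (k : ℕ) : zigzag n T k ≤ T := by
  unfold zigzag
  split_ifs <;> linarith

lemma isHeights_zigzag (hn : 3 ≤ n) (hT : 1 / 8 ≤ T) : IsHeights n (zigzag n T) where
  three_le := hn
  zero := by simp [zigzag]
  last := by simp [zigzag]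
  pos k h0 h1 := by
    have : ¬ (k = 0 ∨ n - 1 ≤ k) := by omega
    rw [zigzag, if_neg this]
    split_ifs <;> linarith

/-- Near a notch, the skyline of a zigzag polygon is low. -/
lemma skyline_zigzag_le (hn : 3 ≤ n) (hT : 1 / 8 ≤ T) (hδ : 0 < δ) {e : ℕ} (he : Even e) {x : ℝ}
    (hx : x ∈ Icc x₀ (x₀ + δ * (n - 1 : ℕ))) {u : ℝ} (hu : u ≤ 1) (hxu : |x - (x₀ + δ * e)| ≤ δ * u) :
    skyline n x₀ δ (zigzag n T) x ≤ 1 / 8 + T * u := by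
  have hu0 : 0 ≤ u := by
    by_contra! h
    have := (abs_nonneg _).trans hxu
    nlinarith
  rcases hx.2.lt_or_eq with h | rfl
  · obtain ⟨k, hk, t, ht, rfl⟩ := exists_nat_of_mem_Ico hδ ⟨hx.1, h⟩
    have hd : |(k : ℝ) + t - e| ≤ u := by
      rw [show x₀ + δ * (k + t) - (x₀ + δ * e) = δ * (k + t - e) by ring, abs_mul,
        abs_of_pos hδ] at hxu
      exact le_of_mul_le_mul_left hxu hδ
    rw [abs_le] at hd
    rw [skyline_eq hδ (by omega) ⟨ht.1, ht.2.le⟩]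
    set f := zigzag n T
    have hfe : f e ≤ 1 / 8 := zigzag_le_of_even he
    have hfT : ∀ k, f k ≤ T := zigzag_le hT
    have h1 : k ≤ e + 1 := by
      have : (k : ℝ) < e + 2 := by linarith [hd.2, ht.1]
      have : k < e + 2 := by exact_mod_cast this
      omega
    have h2 : e ≤ k + 1 := by
      have : (e : ℝ) < k + 2 := by linarith [hd.1, ht.2]
      have : e < k + 2 := by exact_mod_cast this
      omega
    obtain ht0 := ht.1
    obtain ht1 := ht.2
    rcases (by omega : k = e ∨ k + 1 = e ∨ k = e + 1) with rfl | rfl | rfl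
    · have h3 := hfT (k + 1)
      nlinarith [mul_le_mul_of_nonneg_left h3 ht0, mul_nonneg ht0 (sub_nonneg.2 hfe)]
    · have h3 := hfT k
      push_cast at hd
      nlinarith [mul_le_mul_of_nonneg_left h3 (sub_nonneg.2 ht1.le), mul_nonneg (sub_nonneg.2 ht1.le) (sub_nonneg.2 hfe)]
    · push_cast at hd
      have h3 : t = 0 := by linarith
      have h4 : u = 1 := by linarith
      rw [h3, h4]
      linarith [hfT (e + 1)]
  · rw [skyline_natCast hδ (by omega), (isHeights_zigzag hn hT).last]
    nlinarith

end Zigzag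

section Coordinates

lemma abs_sub_coord_le_dist (p q : Plane) : |p 0 - q 0| ≤ dist p q ∧ |p 1 - q 1| ≤ dist p q := by
  have h := Plane.dist_sq p q
  constructor <;> refine abs_le_of_sq_le_sq ?_ dist_nonneg <;>
    nlinarith [sq_nonneg (p 0 - q 0), sq_nonneg (p 1 - q 1)]

/-- The reflection that exchanges the two coordinates. -/
noncomputable def swapCoords : Plane ≃L[ℝ] Plane :=
  (LinearIsometryEquiv.piLpCongrLeft 2 ℝ ℝ (Equiv.swap (0 : Fin 2) 1)).toContinuousLinearEquiv

lemma swapCoords_zero (p : Plane) : swapCoords p 0 = p 1 := by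
  simp [swapCoords, LinearIsometryEquiv.piLpCongrLeft_apply]

lemma swapCoords_one (p : Plane) : swapCoords p 1 = p 0 := by
  simp [swapCoords, LinearIsometryEquiv.piLpCongrLeft_apply]

lemma swapCoords_swapCoords (p : Plane) : swapCoords (swapCoords p) = p := by
  rw [Plane.ext_iff', swapCoords_zero, swapCoords_one, swapCoords_one, swapCoords_zero]
  exact ⟨rfl, rfl⟩

lemma mem_image_swapCoords {R : Set Plane} {p : Plane} :
    p ∈ swapCoords '' R ↔ swapCoords p ∈ R := by
  constructor
  · rintro ⟨q, hq, rfl⟩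
    rwa [swapCoords_swapCoords]
  · exact fun hp => ⟨_, hp, swapCoords_swapCoords p⟩

lemma dist_swapCoords (p q : Plane) : dist (swapCoords p) (swapCoords q) = dist p q :=
  (LinearIsometryEquiv.piLpCongrLeft 2 ℝ ℝ (Equiv.swap (0 : Fin 2) 1)).dist_map p q

end Coordinates

/-! ### Two crossing combs -/

section Combs

variable {n : ℕ} {T : ℝ}

/-- A comb with teeth of height `T` at odd positions. -/
noncomputable def comb (n : ℕ) (T : ℝ) : Polygon Plane n := mountain n 0 1 (zigzag n T)

lemma isSimplePolygon_comb (hn : 3 ≤ n) (hT : 1 / 8 ≤ T) : IsSimplePolygon (comb n T) :=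
  isSimplePolygon_mountain (isHeights_zigzag hn hT) one_pos

lemma mem_polygonRegion_comb (hn : 3 ≤ n) (hT : 1 / 8 ≤ T) {p : Plane} :
    p ∈ polygonRegion (comb n T) ↔ p 0 ∈ Icc (0 : ℝ) (n - 1 : ℕ) ∧
      p 1 ∈ Icc 0 (skyline n 0 1 (zigzag n T) (p 0)) := by
  rw [comb, polygonRegion_mountain (isHeights_zigzag hn hT) one_pos, mem_ofPred_eq]
  simp

/-- The teeth of a comb. -/
lemma mem_comb_of_odd (hn : 3 ≤ n) (hT : 1 / 8 ≤ T) {k : ℕ} (hk : Odd k) (hkn : k + 2 ≤ n) {y : ℝ}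
    (hy : y ∈ Icc 0 T) : !₂[(k : ℝ), y] ∈ polygonRegion (comb n T) := by
  rw [mem_polygonRegion_comb hn hT]
  have h := skyline_natCast (x₀ := 0) (f := zigzag n T) one_pos (show k < n by omega)
  rw [zero_add, one_mul, zigzag_of_odd hk (by omega)] at h
  refine ⟨⟨by simp, ?_⟩, ?_⟩
  · simpa using (by exact_mod_cast (by omega : k ≤ n - 1) : (k : ℝ) ≤ (n - 1 : ℕ))
  · simpa [h] using hy

lemma exists_odd_near (hn : 3 ≤ n) {x : ℝ} (hx : x ∈ Icc (0 : ℝ) (n - 3 / 2)) :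
    ∃ k : ℕ, Odd k ∧ k + 2 ≤ n ∧ |x - k| ≤ 3 / 2 := by
  set j := ⌊x / 2⌋₊
  have h1 : (j : ℝ) ≤ x / 2 := Nat.floor_le (by linarith [hx.1])
  have h2 : x / 2 < j + 1 := Nat.lt_floor_add_one _
  by_cases h : 2 * j + 3 ≤ n
  · refine ⟨2 * j + 1, ⟨j, rfl⟩, h, ?_⟩
    push_cast
    rw [abs_le]
    constructor <;> linarith
  · have h3 : (n : ℝ) ≤ 2 * j + 2 := by exact_mod_cast (by omega : n ≤ 2 * j + 2)
    have h4 : 2 * j + 1 < n := by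
      have : (2 * j + 1 : ℝ) < n := by linarith [hx.2]
      exact_mod_cast this
    obtain ⟨i, hi⟩ : ∃ i, j = i + 1 := ⟨j - 1, by omega⟩
    refine ⟨2 * i + 1, ⟨i, rfl⟩, by omega, ?_⟩
    rw [hi] at h1 h2 h3
    push_cast at h1 h2 h3 ⊢
    rw [abs_le]
    constructor <;> linarith [hx.2]

/-- Points of a slightly enlarged box around the comb are near the comb. -/
lemma exists_comb_dist_le (hn : 3 ≤ n) (hT : 1 / 8 ≤ T) {p : Plane}
    (h0 : p 0 ∈ Icc (0 : ℝ) (n - 3 / 2)) (h1 : p 1 ∈ Icc 0 (T + 1 / 2)) :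
    ∃ q ∈ polygonRegion (comb n T), dist p q ≤ 7 / 4 := by
  obtain ⟨k, hk, hkn, hd⟩ := exists_odd_near hn h0
  refine ⟨!₂[(k : ℝ), min (p 1) T], mem_comb_of_odd hn hT hk hkn
    ⟨le_min h1.1 (by linarith), min_le_right _ _⟩, ?_⟩
  rw [Plane.dist_le_iff (by norm_num)]
  simp only [Matrix.cons_val_zero, Matrix.cons_val_one]
  have h2 : |p 1 - min (p 1) T| ≤ 1 / 2 := by
    rcases min_cases (p 1) T with ⟨h, -⟩ | ⟨h, h'⟩
    · simp [h]
    · rw [h, abs_le]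
      constructor <;> linarith [h1.2]
  have h3 := sq_le_sq' (abs_le.1 hd).1 (abs_le.1 hd).2
  have h4 := sq_le_sq' (abs_le.1 h2).1 (abs_le.1 h2).2
  norm_num at h3 h4 ⊢
  linarith

/-- High points above a notch are far from the comb. -/
lemma comb_dist_gt (hn : 3 ≤ n) (hT : 1 / 8 ≤ T) {e : ℕ} (he : Even e) {p : Plane}
    (h0 : p 0 = e) (h1 : 7 / 8 * (T + 3 / 2) ≤ p 1) {q : Plane}
    (hq : q ∈ polygonRegion (comb n T)) : 7 / 8 < dist p q := by
  by_contra! hd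
  obtain ⟨hd0, hd1⟩ := abs_sub_coord_le_dist p q
  obtain ⟨hq0, hq1⟩ := (mem_polygonRegion_comb hn hT).1 hq
  have h2 := skyline_zigzag_le (x₀ := 0) hn hT one_pos he (x := q 0) (u := 7 / 8)
    (by simpa using hq0) (by norm_num) (by
      rw [zero_add, one_mul, one_mul, ← h0, abs_sub_comm]
      exact hd0.trans hd)
  have h3 := (abs_le.1 (hd1.trans hd)).2
  linarith [hq1.2]

/-- If both polygons have many vertices, two crossing combs have many isolated crossings. -/
lemma exists_polygons_of_combs {n m : ℕ} (hn : 80 ≤ n) (hm : 80 ≤ m) :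
    ∃ (P : Polygon Plane n) (Q : Polygon Plane m), IsSimplePolygon P ∧ IsSimplePolygon Q ∧
      Metric.hausdorffDist (polygonRegion P) (polygonRegion Q) = 1 ∧
      ∀ D : FeatureDecomposition
        (frontier (middleSet (polygonRegion P) (polygonRegion Q) (1 / 2))),
          1 / 1024 * ((n : ℝ) * (m : ℝ)) ≤ D.size := by
  have hn' : (80 : ℝ) ≤ n := by exact_mod_cast hn
  have hm' : (80 : ℝ) ≤ m := by exact_mod_cast hm
  have hTn : (1 / 8 : ℝ) ≤ n - 3 / 2 := by linarith
  have hTm : (1 / 8 : ℝ) ≤ m - 3 / 2 := by linarith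
  have hn3 : 3 ≤ n := by omega
  have hm3 : 3 ≤ m := by omega
  have hn1 : ((n - 1 : ℕ) : ℝ) = n - 1 := by
    rw [Nat.cast_sub (by omega)]
    simp
  have hm1 : ((m - 1 : ℕ) : ℝ) = m - 1 := by
    rw [Nat.cast_sub (by omega)]
    simp
  set P := mapPolygon swapCoords (comb n (m - 3 / 2)) with hPdef
  set Q := comb m (n - 3 / 2) with hQdef
  have hP : IsSimplePolygon P := (isSimplePolygon_comb hn3 hTm).map _
  have hQ : IsSimplePolygon Q := isSimplePolygon_comb hm3 hTn
  have hPmem : ∀ p, p ∈ polygonRegion P ↔ swapCoords p ∈ polygonRegion (comb n (m - 3 / 2)) := by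
    intro p
    rw [hPdef, polygonRegion_mapPolygon, mem_image_swapCoords]
  -- a comb lies in the box covered by the teeth of the other comb
  have hbox : ∀ {n : ℕ} {T : ℝ}, 3 ≤ n → 1 / 8 ≤ T → ∀ p ∈ polygonRegion (comb n T),
      p 0 ∈ Icc (0 : ℝ) (n - 1 : ℕ) ∧ p 1 ∈ Icc 0 T := by
    intro n T hn hT p hp
    obtain ⟨h0, h1⟩ := (mem_polygonRegion_comb hn hT).1 hp
    refine ⟨h0, h1.1, h1.2.trans (skyline_le one_pos (fun k _ => zigzag_le hT k) (by omega) ?_)⟩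
    simpa using h0
  -- below, dilations by half the Hausdorff distance, hence by at most `7 / 8`, do not fill the gaps
  -- of width `2` between the teeth
  have hdist : Metric.hausdorffDist (polygonRegion P) (polygonRegion Q) ≤ 7 / 4 := by
    refine Metric.hausdorffDist_le_of_mem_dist (by norm_num) (fun p hp => ?_) (fun p hp => ?_)
    · obtain ⟨h0, h1⟩ := hbox hn3 hTm _ ((hPmem p).1 hp)
      rw [swapCoords_zero, hn1] at h0
      rw [swapCoords_one] at h1
      exact exists_comb_dist_le hm3 hTn h1 ⟨h0.1, by linarith [h0.2]⟩
    · obtain ⟨h0, h1⟩ := hbox hm3 hTn _ hp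
      rw [hm1] at h0
      obtain ⟨q, hq, hd⟩ := exists_comb_dist_le hn3 hTm (p := swapCoords p)
        (by rwa [swapCoords_zero]) (by rw [swapCoords_one]; exact ⟨h0.1, by linarith [h0.2]⟩)
      refine ⟨swapCoords q, ?_, ?_⟩
      · rwa [hPmem, swapCoords_swapCoords]
      · rwa [← dist_swapCoords, swapCoords_swapCoords]
  have hne : polygonRegion P ≠ polygonRegion Q := by
    intro h
    have h1 : (!₂[0, (n - 1 : ℝ)] : Plane) ∈ polygonRegion P := by
      rw [hPmem, mem_polygonRegion_comb hn3 hTm, swapCoords_zero, swapCoords_one]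
      have h2 : (n - 1 : ℝ) ∈ Icc (0 : ℝ) (n - 1 : ℕ) := ⟨by linarith, hn1.ge⟩
      refine ⟨by simpa using h2, by simp, ?_⟩
      simpa using (isHeights_zigzag hn3 hTm).skyline_nonneg (x₀ := 0) one_pos
        (x := n - 1) (by simpa using h2)
    rw [h] at h1
    have := (hbox hm3 hTn _ h1).2.2
    simp at this
    linarith
  refine exists_polygons_hausdorffDist_eq_one hP hQ rfl hne fun hpos => ?_
  set h := Metric.hausdorffDist (polygonRegion P) (polygonRegion Q)
  set S := dilate (polygonRegion P) (h / 2) ∩ dilate (polygonRegion Q) (h / 2) with hS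
  have hScl : IsClosed S := ((isCompact_dilate isCompact_polygonRegion _).isClosed).inter
    (isCompact_dilate isCompact_polygonRegion _).isClosed
  have hPQS : ∀ p, p ∈ polygonRegion P → p ∈ polygonRegion Q → p ∈ S := fun p hp hq =>
    ⟨mem_dilate.2 ⟨p, hp, by rw [dist_self]; linarith⟩,
      mem_dilate.2 ⟨p, hq, by rw [dist_self]; linarith⟩⟩
  intro L D
  -- the lines through the notches
  have hcol : ∀ (e : ℕ) (p : Plane), Even e → p 0 = e → 7 / 8 * (n : ℝ) ≤ p 1 → p ∉ S := by
    rintro e p he h0 h1 ⟨-, hp⟩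
    obtain ⟨q, hq, hd⟩ := mem_dilate.1 hp
    have := comb_dist_gt hm3 hTn he h0 (by linarith) hq
    linarith
  have hrow : ∀ (e : ℕ) (p : Plane), Even e → p 1 = e → 7 / 8 * (m : ℝ) ≤ p 0 → p ∉ S := by
    rintro e p he h0 h1 ⟨hp, -⟩
    obtain ⟨q, hq, hd⟩ := mem_dilate.1 hp
    have := comb_dist_gt hn3 hTm he (p := swapCoords p) (by rwa [swapCoords_zero])
      (by rw [swapCoords_one]; linarith) ((hPmem q).1 hq)
    rw [dist_swapCoords] at this
    linarith
  -- a cell reaches from one notch line to the next in both directions and contains one crossing of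
  -- teeth; the index ranges come from `7 / 8 * m ≤ 2 * j.1` and `7 / 8 * n ≤ 2 * j.2`
  set O : ℕ × ℕ → Set Plane := fun j => {p | p 0 ∈ Ioo (2 * j.1 : ℝ) (2 * j.1 + 2) ∧
    p 1 ∈ Ioo (2 * j.2 : ℝ) (2 * j.2 + 2)} with hO
  set K : ℕ × ℕ → Set Plane := fun j => {p | p 0 ∈ Icc (2 * j.1 : ℝ) (2 * j.1 + 2) ∧
    p 1 ∈ Icc (2 * j.2 : ℝ) (2 * j.2 + 2)} with hK
  set I : Finset (ℕ × ℕ) := Finset.Icc ((7 * m + 15) / 16) ((m - 3) / 2) ×ˢ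
    Finset.Icc ((7 * n + 15) / 16) ((n - 3) / 2) with hI
  have memI : ∀ j ∈ I, 7 / 8 * (m : ℝ) ≤ 2 * j.1 ∧ 7 / 8 * (n : ℝ) ≤ 2 * j.2 ∧
      2 * j.1 + 3 ≤ m ∧ 2 * j.2 + 3 ≤ n := by
    intro j hj
    rw [hI, Finset.mem_product, Finset.mem_Icc, Finset.mem_Icc] at hj
    have h1 : (7 * m : ℝ) ≤ 16 * j.1 := by exact_mod_cast (by omega : 7 * m ≤ 16 * j.1)
    have h2 : (7 * n : ℝ) ≤ 16 * j.2 := by exact_mod_cast (by omega : 7 * n ≤ 16 * j.2)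
    exact ⟨by linarith, by linarith, by omega, by omega⟩
  have hc0 : Continuous fun p : Plane => p 0 := by fun_prop
  have hc1 : Continuous fun p : Plane => p 1 := by fun_prop
  have hOo : ∀ j, IsOpen (O j) := fun j => (isOpen_Ioo.preimage hc0).inter (isOpen_Ioo.preimage hc1)
  have hKcl : ∀ j, IsClosed (K j) := fun j =>
    (isClosed_Icc.preimage hc0).inter (isClosed_Icc.preimage hc1)
  have hOK : ∀ j, O j ⊆ K j := fun j p hp => ⟨Ioo_subset_Icc_self hp.1, Ioo_subset_Icc_self hp.2⟩
  have hedge : ∀ j ∈ I, ∀ p ∈ K j, p ∉ O j → p ∉ S := by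
    intro j hj p hp hpO
    obtain ⟨h1, h2, -, -⟩ := memI j hj
    obtain ⟨⟨ha, hb⟩, hc, hd⟩ := hp
    rcases ha.eq_or_lt with h | ha
    · exact hcol (2 * j.1) p (even_two_mul _) (by push_cast; exact h.symm) (by linarith)
    rcases hb.eq_or_lt with h | hb
    · exact hcol (2 * (j.1 + 1)) p (even_two_mul _) (by push_cast; linarith) (by linarith)
    rcases hc.eq_or_lt with h | hc
    · exact hrow (2 * j.2) p (even_two_mul _) (by push_cast; exact h.symm) (by linarith)
    rcases hd.eq_or_lt with h | hd
    · exact hrow (2 * (j.2 + 1)) p (even_two_mul _) (by push_cast; linarith) (by linarith)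
    · exact absurd ⟨⟨ha, hb⟩, hc, hd⟩ hpO
  have hcard := card_le_size_of_cells L D (I := I) (O := O) (by
      intro i _ j _ hij
      rw [Set.disjoint_left]
      rintro p ⟨⟨a1, a2⟩, a3, a4⟩ ⟨⟨b1, b2⟩, b3, b4⟩
      refine hij (Prod.ext ?_ ?_)
      · have h1 : (i.1 : ℝ) < j.1 + 1 := by linarith
        have h2 : (j.1 : ℝ) < i.1 + 1 := by linarith
        have h1 : i.1 < j.1 + 1 := by exact_mod_cast h1
        have h2 : j.1 < i.1 + 1 := by exact_mod_cast h2
        omega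
      · have h1 : (i.2 : ℝ) < j.2 + 1 := by linarith
        have h2 : (j.2 : ℝ) < i.2 + 1 := by linarith
        have h1 : i.2 < j.2 + 1 := by exact_mod_cast h1
        have h2 : j.2 < i.2 + 1 := by exact_mod_cast h2
        omega)
    (by
      intro j hj
      rw [Set.disjoint_left]
      intro p hp hpO
      rw [(hOo j).frontier_eq] at hpO
      exact hedge j hj p (closure_minimal (hOK j) (hKcl j) hpO.1) hpO.2
        (hScl.frontier_subset hp))
    (by
      intro j hj
      obtain ⟨h1, h2, h3, h4⟩ := memI j hj
      have h3' : (2 * j.1 + 3 : ℝ) ≤ m := by exact_mod_cast h3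
      have h4' : (2 * j.2 + 3 : ℝ) ≤ n := by exact_mod_cast h4
      have hconv : Convex ℝ (K j) := by
        intro p hp q hq a b ha hb hab
        obtain ⟨⟨a1, a2⟩, a3, a4⟩ := hp
        obtain ⟨⟨b1, b2⟩, b3, b4⟩ := hq
        obtain rfl : b = 1 - a := by linarith
        refine ⟨⟨?_, ?_⟩, ?_, ?_⟩ <;>
          simp only [PiLp.add_apply, PiLp.smul_apply, smul_eq_mul] <;> nlinarith
      -- the crossing of two teeth, and a corner of the cell
      obtain ⟨z, hzK, hzF⟩ := inter_frontier_nonempty_of_isPreconnected hconv.isPreconnected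
        (O := S) ⟨!₂[2 * (j.1 : ℝ) + 1, 2 * (j.2 : ℝ) + 1], by
          simp only [hK, mem_ofPred_eq, Matrix.cons_val_zero, Matrix.cons_val_one, mem_Icc]
          refine ⟨⟨?_, ?_⟩, ?_, ?_⟩ <;> linarith, by
          have hj1 : (0 : ℝ) ≤ j.1 := by positivity
          have hj2 : (0 : ℝ) ≤ j.2 := by positivity
          refine hPQS _ ?_ ?_
          · have := mem_comb_of_odd hn3 hTm (k := 2 * j.2 + 1) ⟨j.2, rfl⟩ (by omega)
              (y := 2 * j.1 + 1) ⟨by linarith, by linarith⟩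
            rw [hPmem]
            convert this using 1
            rw [Plane.ext_iff', swapCoords_zero, swapCoords_one]
            simp
          · have := mem_comb_of_odd hm3 hTn (k := 2 * j.1 + 1) ⟨j.1, rfl⟩ (by omega)
              (y := 2 * j.2 + 1) ⟨by linarith, by linarith⟩
            push_cast at this
            exact this⟩
        ⟨!₂[2 * (j.1 : ℝ), 2 * (j.2 : ℝ)], by
          simp only [hK, mem_ofPred_eq, Matrix.cons_val_zero, Matrix.cons_val_one, mem_Icc]
          refine ⟨⟨?_, ?_⟩, ?_, ?_⟩ <;> linarith,
          hcol (2 * j.1) _ (even_two_mul _) (by simp) (by simpa using h2)⟩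
      refine ⟨z, hzF, ?_⟩
      by_contra hzO
      exact hedge j hj z hzK hzO (hScl.frontier_subset hzF))
  have hcount : ∀ k : ℕ, 80 ≤ k → (k : ℝ) / 32 ≤
      ((Finset.Icc ((7 * k + 15) / 16) ((k - 3) / 2)).card : ℝ) := by
    intro k hk
    rw [Nat.card_Icc, div_le_iff₀ (by norm_num)]
    exact_mod_cast (by omega : k ≤ ((k - 3) / 2 + 1 - (7 * k + 15) / 16) * 32)
  have h1 : (I.card : ℝ) ≤ D.size := by exact_mod_cast hcard
  rw [hI, Finset.card_product] at h1
  push_cast at h1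
  have h2 := mul_le_mul (hcount m hm) (hcount n hn) (by positivity) (by positivity)
  calc 1 / 1024 * ((n : ℝ) * m) = m / 32 * (n / 32) := by ring
    _ ≤ _ := h2
    _ ≤ _ := h1

end Combs

/-! ### A thin strip across a saw -/

section Saw

lemma exists_toLp_mem_openSegment {a b t y : ℝ} (ht : t ∈ Ioo a b) :
    !₂[t, y] ∈ openSegment ℝ (!₂[a, y] : Plane) !₂[b, y] := by
  have hab : 0 < b - a := by linarith [ht.1, ht.2]
  rw [openSegment_eq_image_lineMap]
  refine ⟨(t - a) / (b - a), ⟨div_pos (by linarith [ht.1]) hab, ?_⟩, ?_⟩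
  · rw [div_lt_one hab]
    linarith [ht.2]
  · rw [Plane.ext_iff', lineMap_coord_zero, lineMap_coord_one]
    simp
    field_simp
    ring

/-- If the first polygon has few vertices, then a thin horizontal strip and a saw below it already
give many features: the axis of the strip alternates between the teeth and the gaps of the saw. -/
lemma exists_polygons_of_saw {n m : ℕ} (hn : 3 ≤ n) (hn' : n ≤ 80) (hm : 3 ≤ m) :
    ∃ (P : Polygon Plane n) (Q : Polygon Plane m), IsSimplePolygon P ∧ IsSimplePolygon Q ∧
      Metric.hausdorffDist (polygonRegion P) (polygonRegion Q) = 1 ∧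
      ∀ D : FeatureDecomposition
        (frontier (middleSet (polygonRegion P) (polygonRegion Q) (1 / 2))),
          1 / 1024 * ((n : ℝ) * (m : ℝ)) ≤ D.size := by
  have hn1 : (2 : ℝ) ≤ (n - 1 : ℕ) := by exact_mod_cast (by omega : 2 ≤ n - 1)
  have hm1 : (2 : ℝ) ≤ (m - 1 : ℕ) := by exact_mod_cast (by omega : 2 ≤ m - 1)
  set W : ℝ := 4 * (m - 1 : ℕ) with hW
  set f : ℕ → ℝ := fun k => if k = 0 ∨ n - 1 ≤ k then 0 else W with hf
  set δ : ℝ := 1 / (5 * (n - 1 : ℕ)) with hδdef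
  have hδ : 0 < δ := by positivity
  have hδn : δ * (n - 1 : ℕ) = 1 / 5 := by
    rw [hδdef]
    field_simp
  have hδ10 : δ ≤ 1 / 10 := by nlinarith
  have hfh : IsHeights n f :=
    { three_le := hn
      zero := by simp [hf]
      last := if_pos (Or.inr le_rfl)
      pos := fun k h0 h1 => by
        have : ¬ (k = 0 ∨ n - 1 ≤ k) := by omega
        simp only [hf, if_neg this]
        linarith }
  have hfW : ∀ k, f k ≤ W := fun k => by
    simp only [hf]
    split_ifs <;> linarith
  have hzz := isHeights_zigzag (T := 1) hm (by norm_num)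
  set P := mapPolygon swapCoords (mountain n (4 / 5) δ f) with hPdef
  set Q := mountain m 0 4 (zigzag m 1) with hQdef
  have hP : IsSimplePolygon P := (isSimplePolygon_mountain hfh hδ).map _
  have hQ : IsSimplePolygon Q := isSimplePolygon_mountain hzz (by norm_num)
  have hPmem : ∀ p, p ∈ polygonRegion P ↔ p 1 ∈ Icc (4 / 5 : ℝ) 1 ∧
      p 0 ∈ Icc 0 (skyline n (4 / 5) δ f (p 1)) := by
    intro p
    rw [hPdef, polygonRegion_mapPolygon, mem_image_swapCoords, polygonRegion_mountain hfh hδ,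
      mem_ofPred_eq, swapCoords_zero, swapCoords_one, hδn]
    norm_num
  have hQmem : ∀ p, p ∈ polygonRegion Q ↔ p 0 ∈ Icc (0 : ℝ) W ∧
      p 1 ∈ Icc 0 (skyline m 0 4 (zigzag m 1) (p 0)) := by
    intro p
    rw [hQdef, polygonRegion_mountain hzz (by norm_num), mem_ofPred_eq, zero_add]
  have hPsky : ∀ y ∈ Icc (4 / 5 : ℝ) 1, skyline n (4 / 5) δ f y ≤ W := fun y hy =>
    skyline_le hδ (fun k _ => hfW k) (by omega) (by rw [hδn]; norm_num; exact hy)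
  have hQsky : ∀ x ∈ Icc (0 : ℝ) W, skyline m 0 4 (zigzag m 1) x ∈ Icc (0 : ℝ) 1 := fun x hx =>
    ⟨hzz.skyline_nonneg (by norm_num) (by rwa [zero_add]),
      skyline_le (by norm_num) (fun k _ => zigzag_le (by norm_num) k) (by omega)
        (by rwa [zero_add])⟩
  -- the axis of the strip
  set y₁ : ℝ := 4 / 5 + δ with hy₁
  have haxis : ∀ x ∈ Icc (0 : ℝ) W, !₂[x, y₁] ∈ polygonRegion P := by
    intro x hx
    have h1 := skyline_natCast (x₀ := 4 / 5) (f := f) hδ (show 1 < n by omega)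
    have h2 : f 1 = W := if_neg (by omega)
    rw [Nat.cast_one, mul_one, h2] at h1
    rw [hPmem]
    simp only [Matrix.cons_val_zero, Matrix.cons_val_one]
    rw [hy₁, h1]
    exact ⟨⟨by linarith, by linarith⟩, hx⟩
  have hdist : Metric.hausdorffDist (polygonRegion P) (polygonRegion Q) ≤ 1 := by
    refine Metric.hausdorffDist_le_of_mem_dist zero_le_one (fun p hp => ?_) (fun p hp => ?_)
    · obtain ⟨h1, h0⟩ := (hPmem p).1 hp
      have h0' : p 0 ∈ Icc (0 : ℝ) W := ⟨h0.1, h0.2.trans (hPsky _ h1)⟩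
      refine ⟨!₂[p 0, 0], (hQmem _).2 ⟨by simpa using h0', by simpa using (hQsky _ h0').1⟩, ?_⟩
      rw [Plane.dist_le_iff zero_le_one]
      simp
      rw [abs_le]
      constructor <;> linarith [h1.1, h1.2]
    · obtain ⟨h0, h1⟩ := (hQmem p).1 hp
      refine ⟨!₂[p 0, y₁], haxis _ h0, ?_⟩
      have := h1.2.trans (hQsky _ h0).2
      rw [Plane.dist_le_iff zero_le_one]
      simp
      rw [abs_le]
      constructor <;> linarith [h1.1]
  have hne : polygonRegion P ≠ polygonRegion Q := by
    intro h
    have h1 : (!₂[0, 0] : Plane) ∈ polygonRegion Q := by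
      have h0 : (0 : ℝ) ∈ Icc (0 : ℝ) W := ⟨le_rfl, by positivity⟩
      rw [hQmem]
      exact ⟨by simpa using h0, by simpa using (hQsky 0 h0).1⟩
    rw [← h, hPmem] at h1
    have := h1.1.1
    simp at this
    linarith
  refine exists_polygons_hausdorffDist_eq_one hP hQ rfl hne fun hpos => ?_
  set h := Metric.hausdorffDist (polygonRegion P) (polygonRegion Q)
  set S := dilate (polygonRegion P) (h / 2) ∩ dilate (polygonRegion Q) (h / 2) with hS
  have hScl : IsClosed S := ((isCompact_dilate isCompact_polygonRegion _).isClosed).inter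
    (isCompact_dilate isCompact_polygonRegion _).isClosed
  intro L D
  -- the trace of the interior on the axis; its frontier points lie on the frontier of `S`
  set U : Set ℝ := {t | !₂[t, y₁] ∈ interior S} with hU
  have hcont : Continuous fun t : ℝ => (!₂[t, y₁] : Plane) := by
    refine (PiLp.continuous_toLp 2 _).comp (continuous_pi fun i => ?_)
    fin_cases i <;> simp <;> fun_prop
  have hUo : IsOpen U := isOpen_interior.preimage hcont
  have hgap : ∀ j : ℕ, (8 * j : ℝ) ∉ U := by
    intro j hj
    obtain ⟨q, hq, hd⟩ := mem_dilate.1 (interior_subset hj).2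
    obtain ⟨hq0, hq1⟩ := (hQmem q).1 hq
    obtain ⟨hd0, hd1⟩ := abs_sub_coord_le_dist !₂[(8 * j : ℝ), y₁] q
    have h1 := skyline_zigzag_le (x₀ := 0) (T := 1) hm (by norm_num) (by norm_num : (0 : ℝ) < 4)
      (even_two_mul j) (x := q 0) (u := 1 / 8) (by rwa [zero_add]) (by norm_num) (by
        rw [abs_sub_comm]
        push_cast
        have : (0 : ℝ) + 4 * (2 * j) = 8 * j := by ring
        rw [this]
        refine (hd0.trans hd).trans ?_
        linarith)
    have h2 := (abs_le.1 (hd1.trans hd)).2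
    simp at h2
    linarith [hq1.2]
  have htooth : ∀ j : ℕ, 2 * j + 3 ≤ m → (8 * j + 4 : ℝ) ∈ U := by
    intro j hj
    have h0 : (8 * j + 4 : ℝ) ∈ Icc (0 : ℝ) W := by
      refine ⟨by positivity, ?_⟩
      have : ((2 * j + 1 : ℕ) : ℝ) ≤ (m - 1 : ℕ) := by exact_mod_cast (by omega : 2 * j + 1 ≤ m - 1)
      push_cast at this
      linarith
    have h1 := skyline_natCast (x₀ := 0) (f := zigzag m 1) (by norm_num : (0 : ℝ) < 4)
      (show 2 * j + 1 < m by omega)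
    rw [zigzag_of_odd ⟨j, rfl⟩ (by omega)] at h1
    have h2 : (0 : ℝ) + 4 * (2 * j + 1 : ℕ) = 8 * j + 4 := by
      push_cast
      ring
    rw [h2] at h1
    have hQ' : (!₂[(8 * j + 4 : ℝ), y₁] : Plane) ∈ polygonRegion Q := by
      rw [hQmem]
      simp only [Matrix.cons_val_zero, Matrix.cons_val_one]
      rw [h1]
      exact ⟨h0, by linarith, by linarith⟩
    refine mem_interior.2 ⟨Metric.ball _ (h / 2), fun z hz => ⟨?_, ?_⟩, Metric.isOpen_ball,
      Metric.mem_ball_self (by linarith)⟩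
    · exact mem_dilate.2 ⟨_, haxis _ h0, (Metric.mem_ball.1 hz).le⟩
    · exact mem_dilate.2 ⟨_, hQ', (Metric.mem_ball.1 hz).le⟩
  have hpt : ∀ j ∈ Finset.range ((m - 1) / 2), ∃ t ∈ Icc (8 * j : ℝ) (8 * j + 4), t ∈ frontier U := by
    intro j hj
    rw [Finset.mem_range] at hj
    have h1 : (8 * j : ℝ) ≤ 8 * j + 4 := by linarith
    exact inter_frontier_nonempty_of_isPreconnected isPreconnected_Icc
      ⟨_, right_mem_Icc.2 h1, htooth j (by omega)⟩ ⟨_, left_mem_Icc.2 h1, hgap j⟩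
  choose! t ht htU using hpt
  have htIoo : ∀ j ∈ Finset.range ((m - 1) / 2), t j ∈ Ioo (-1 : ℝ) (4 * m) := by
    intro j hj
    have h1 := ht j hj
    rw [Finset.mem_range] at hj
    have h2 : (2 * j + 3 : ℝ) ≤ m := by exact_mod_cast (by omega : 2 * j + 3 ≤ m)
    have h3 : (0 : ℝ) ≤ j := by positivity
    exact ⟨by linarith [h1.1], by linarith [h1.2]⟩
  have hcount := card_le_two_mul_size_of_openSegment L D (I := Finset.range ((m - 1) / 2))
    (p := !₂[-1, y₁]) (q := !₂[4 * (m : ℝ), y₁]) (x := fun j => !₂[t j, y₁])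
    (by
      intro h
      have h0 := (Plane.ext_iff'.1 h).1
      simp at h0
      have : (0 : ℝ) ≤ m := by positivity
      linarith)
    (by
      intro i hi j hj hij
      have h0 : t i = t j := by simpa using (Plane.ext_iff'.1 hij).1
      have h1 := ht i hi
      have h2 := ht j hj
      rw [h0] at h1
      have h3 : (i : ℝ) < j + 1 := by linarith [h1.1, h2.2]
      have h4 : (j : ℝ) < i + 1 := by linarith [h1.2, h2.1]
      have h3 : i < j + 1 := by exact_mod_cast h3
      have h4 : j < i + 1 := by exact_mod_cast h4
      omega)
    (by
      intro j hj
      have h1 := htU j hj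
      rw [hUo.frontier_eq] at h1
      rw [hScl.frontier_eq]
      refine ⟨closure_minimal (t := S) ?_ hScl
        (image_closure_subset_closure_image hcont ⟨_, h1.1, rfl⟩), h1.2⟩
      rintro _ ⟨s, hs, rfl⟩
      exact interior_subset hs)
    (fun j hj => exists_toLp_mem_openSegment (htIoo j hj))
    (by
      intro j hj
      have h1 : t j ∈ closure (Ioo (-1 : ℝ) (4 * m) ∩ U) :=
        isOpen_Ioo.inter_closure ⟨htIoo j hj, (htU j hj).1⟩
      refine closure_mono ?_ (image_closure_subset_closure_image hcont ⟨_, h1, rfl⟩)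
      rintro _ ⟨s, ⟨hs, hsU⟩, rfl⟩
      exact ⟨exists_toLp_mem_openSegment hs, fun hfr => hfr.2 hsU⟩)
  rw [Finset.card_range] at hcount
  have h1 : m ≤ 8 * D.size := by omega
  have h2 : (m : ℝ) ≤ 8 * D.size := by exact_mod_cast h1
  have h3 : (n : ℝ) ≤ 80 := by exact_mod_cast hn'
  have h4 : (0 : ℝ) ≤ m := by positivity
  nlinarith [mul_le_mul_of_nonneg_right h3 h4]

end Saw

lemma middleSet_comm (A B : Set Plane) : middleSet A B (1 / 2) = middleSet B A (1 / 2) := by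
  unfold middleSet
  norm_num [inter_comm]

/-- The lower bound on the complexity of the frontier of `S_{1/2}(A, B)`. -/
theorem exists_polygons_le_size {n m : ℕ} (hn : 3 ≤ n) (hm : 3 ≤ m) :
    ∃ (P : Polygon Plane n) (Q : Polygon Plane m), IsSimplePolygon P ∧ IsSimplePolygon Q ∧
      Metric.hausdorffDist (polygonRegion P) (polygonRegion Q) = 1 ∧
      ∀ D : FeatureDecomposition
        (frontier (middleSet (polygonRegion P) (polygonRegion Q) (1 / 2))),
          1 / 1024 * ((n : ℝ) * (m : ℝ)) ≤ D.size := by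
  by_cases hn' : n ≤ 80
  · exact exists_polygons_of_saw hn hn' hm
  by_cases hm' : m ≤ 80
  · obtain ⟨P, Q, hP, hQ, hd, hD⟩ := exists_polygons_of_saw hm hm' hn
    refine ⟨Q, P, hQ, hP, by rwa [Metric.hausdorffDist_comm], ?_⟩
    rw [middleSet_comm, mul_comm (n : ℝ)]
    exact hD
  · exact exists_polygons_of_combs (by omega) (by omega)

theorem mainTheorem8 :
    (∃ C : ℝ, 0 < C ∧
      ∀ (n m : ℕ) (P : Polygon Plane n) (Q : Polygon Plane m),
        IsSimplePolygon P → IsSimplePolygon Q →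
        ∀ α ∈ Set.Icc (0 : ℝ) 1,
          ∃ D : FeatureDecomposition
              (frontier (middleSet (polygonRegion P) (polygonRegion Q) α)),
            (D.size : ℝ) ≤ C * ((n : ℝ) * (m : ℝ))) ∧
    (∃ c : ℝ, 0 < c ∧
      ∀ n m : ℕ, 3 ≤ n → 3 ≤ m →
        ∃ (P : Polygon Plane n) (Q : Polygon Plane m),
          IsSimplePolygon P ∧ IsSimplePolygon Q ∧
          Metric.hausdorffDist (polygonRegion P) (polygonRegion Q) = 1 ∧
          ∀ D : FeatureDecomposition
              (frontier (middleSet (polygonRegion P) (polygonRegion Q) (1 / 2))),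
            c * ((n : ℝ) * (m : ℝ)) ≤ (D.size : ℝ)) := by
  refine ⟨⟨6 * 528 ^ 2, by norm_num, fun n m P Q hP hQ α hα => ?_⟩,
    ⟨1 / 1024, by norm_num, fun n m hn hm => exists_polygons_le_size hn hm⟩⟩
  obtain ⟨D, hD⟩ := exists_featureDecomposition_middleSet hP hQ hα
  exact ⟨D, by exact_mod_cast hD⟩
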